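/- Let $M$ be a smooth manifold of dimension $n\ge 3$ with a conformal class $c$ of pseudo-Riemannian metrics (of any signature), let $\mathcal E[w]$ be the conformal densities of weight $w$ (a section is a function $f_g$ for each $g\in c$, with $f_{e^{2\omega}g}=e^{w\omega}f_g$), and let $\mathcal E^k[w]$ be the smooth $k$-forms with values in $\mathcal E[w]$. Let $\sigma\in\mathcal E[1]$ be an Einstein scale: $\sigma>0$ and the trace-free part of $\nabla_a\nabla_b\sigma+P_{ab}\sigma$ vanishes. Let $g=\sigma^{-2}\boldsymbol g\in c$ ($\boldsymbol g$ the conformal metric) be the Einstein metric in which $\sigma$ is represented by the constant $1$. Here $P_{ab}=\frac1{n-2}\bigl(\mathrm{Ric}_{ab}-\frac{\mathrm{Sc}}{2(n-1)}g_{ab}\bigr)$ is the Schouten tensor, $J=P^a{}_a$, $(df)_{a_0\dots a_k}=(k+1)\nabla_{[a_0}f_{a_1\dots a_k]}$, $(\delta f)_{a_2\dots a_k}=-\nabla^{a_1}f_{a_1\dots a_k}$, and $C_{abcd}$ is the Weyl tensor. *Tractors.* A metric of $c$ splits the standard tractor bundle, $V_A=\alpha Y_A+\mu_aZ_A{}^a+\tau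 X_A$ with $(\alpha,\mu_a,\tau)\in\mathcal E[1]\oplus\mathcal E_a[1]\oplus\mathcal E[-1]$, with the tractor metric given by $h^{AB}V_AV_B=2\alpha\tau+\mu^a\mu_a$ and the connection $\nabla_a(\alpha,\mu_b,\tau)=(\nabla_a\alpha-\mu_a,\ \nabla_a\mu_b+g_{ab}\tau+P_{ab}\alpha,\ \nabla_a\tau-P_{ab}\mu^b)$. Put $\mathbb Z_{AB}^{ab}=Z_{[A}{}^aZ_{B]}{}^b$, $\mathbb X_{AB}^{b}=X_{[A}Z_{B]}{}^b$ and $$\widetilde W_{ABCD}=\mathbb Z_{AB}^{ab}\mathbb Z_{CD}^{cd}C_{abcd}-4\mathbb Z_{AB}^{ab}\mathbb X_{CD}^{d}\nabla_{[a}P_{b]d}-4\mathbb X_{AB}^{b}\mathbb Z_{CD}^{cd}\nabla_{[c}P_{d]b}-8\mathbb X_{AB}^{b}\mathbb X_{CD}^{d}\sigma^{-1}(\nabla_{[b}P_{a]d})\nabla^a\sigma .$$ On tractor tensors of weight $w'$ let $$D_AV=(n+2w'-2)w'Y_AV+(n+2w'-2)Z_A{}^a\nabla_aV-X_A(\Delta+w'J)V,\qquad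 \mathbf D_A=D_A-X_A\widetilde W\sharp\sharp,$$ where $\Delta=\nabla^a\nabla_a$ and $\sharp\sharp$ is the double tensorial action, each skew index pair of $\widetilde W$ acting as an endomorphism of the standard tractor bundle. Put $I_A=\frac1nD_A\sigma$ and $\square_\sigma=I^A\mathbf D_A$. For $f\in\mathcal E^k[w]$, $k\ge1$, let $$(Mf)_{A_1\dots A_k}=\tfrac{n+w-2k}{k}\,Z_{A_1}{}^{a_1}\cdots Z_{A_k}{}^{a_k}f_{a_1\dots a_k}+X_{[A_1}Z_{A_2}{}^{a_2}\cdots Z_{A_k]}{}^{a_k}(\delta f)_{a_2\dots a_k},$$ a tractor $k$-form of weight $w-k$. Let $q^k$ be the contraction of a tractor $k$-form with $Z^{A_1}{}_{a_1}\cdots Z^{A_k}{}_{a_k}$, and let $(\iota(Y)F)_{A_2\dots A_k}=Y^{A_1}F_{A_1\dots A_k}$. Skew-symmetrization $[\cdots]$ over $r$ indices includes the factor $1/r!$. For $\ell\ge1$ and $w=k+\ell-\frac n2$ define $$L_k^\ell=\sigma^{-\ell}q^k(\square_\sigma)^\ell M,\qquad G_k^{\ell,\sigma}=\sigma^{-\ell}q^{k-1}\iota(Y)(\square_\sigma)^\ell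 M .$$ **Theorem.** Let $1\le k\le\frac n2$ and $w=k+1-\frac n2$. Computed in the Einstein scale $\sigma$ (that is, with splittings, $\nabla$, $d$, $\delta$ and $J$ those of the Einstein metric $g$, which also trivializes all densities), the operators $L_k^1:\mathcal E^k[w]\to\mathcal E^k[w-2]$ and $G_k^{1,\sigma}:\mathcal E^k[w]\to\mathcal E^{k-1}[w-4]$ are $$L_k^1=\frac1k\Bigl[\bigl(\tfrac n2-k-1\bigr)d\delta+\bigl(\tfrac n2-k+1\bigr)\delta d+\tfrac2n\bigl(\tfrac n2-k-1\bigr)\bigl(\tfrac n2-k+1\bigr)\bigl(\tfrac n2-k\bigr)J\Bigr],$$ $$G_k^{1,\sigma}=\frac1k\,\delta\Bigl[d\delta+\tfrac2n\bigl(\tfrac n2-k+1\bigr)\bigl(\tfrac n2-k\bigr)J\Bigr].$$ -/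

import Mathlib

open scoped Manifold ContDiff

noncomputable section

namespace WeightedForms

/-! ### Tensor calculus in a coordinate chart

In a chart a metric is a field of symmetric invertible matrices `G` on (an open subset of) `ℝⁿ`,
and a covariant tensor field is the field of its components.  A section of a weighted tensor bundle
is represented, in the scale given by the metric, by an unweighted tensor field; the connection on
density bundles is the flat one of this trivialization, so that the Levi-Civita connection acts on
weighted tensors through their representatives. -/

abbrev Pt (n : ℕ) : Type := EuclideanSpace ℝ (Fin n)

/-- Component fields of covariant tensors of rank `k`. -/
abbrev Tens (n k : ℕ) : Type := Pt n → (Fin k → Fin n) → ℝ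

/-- A metric in coordinates: `G y a b = g_{ab}(y)`; the inverse metric `g^{ab}` is `(G y)⁻¹ a b`. -/
abbrev MetricField (n : ℕ) : Type := Pt n → Matrix (Fin n) (Fin n) ℝ

/-- The partial derivative `∂_i u`. -/
def pd {n : ℕ} (i : Fin n) (u : Pt n → ℝ) (y : Pt n) : ℝ :=
  fderiv ℝ u y (EuclideanSpace.single i 1)

/-- The Christoffel symbol `Γ^c_{ab}` of the Levi-Civita connection. -/
def christoffel {n : ℕ} (G : MetricField n) (c a b : Fin n) (y : Pt n) : ℝ :=
  (1 / 2) * ∑ d, (G y)⁻¹ c d *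
    (pd a (fun z => G z b d) y + pd b (fun z => G z a d) y - pd d (fun z => G z a b) y)

/-- The Levi-Civita derivative, `(∇T)_{a₀ a₁ … a_k} = ∇_{a₀} T_{a₁ … a_k}`. -/
def nabla {n k : ℕ} (G : MetricField n) (T : Tens n k) : Tens n (k + 1) := fun y a =>
  pd (a 0) (fun z => T z (Fin.tail a)) y -
    ∑ j : Fin k, ∑ c, christoffel G c (a 0) (a j.succ) y *
      T y (Function.update (Fin.tail a) j c)

/-- The exterior derivative `(df)_{a₀ … a_k} = (k + 1) ∇_{[a₀} f_{a₁ … a_k]}`, written for skew `f`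
as the alternating sum `∑_j (-1)^j ∇_{a_j} f_{a₀ … (omit a_j) … a_k}`. -/
def extD {n k : ℕ} (G : MetricField n) (f : Tens n k) : Tens n (k + 1) := fun y a =>
  ∑ j : Fin (k + 1), (-1 : ℝ) ^ (j : ℕ) * nabla G f y (Fin.cons (a j) (j.removeNth a))

/-- The codifferential `(δf)_{a₂ … a_k} = -∇^{a₁} f_{a₁ a₂ … a_k}`. -/
def coD {n k : ℕ} (G : MetricField n) (f : Tens n (k + 1)) : Tens n k := fun y a =>
  -∑ b, ∑ c, (G y)⁻¹ b c * nabla G f y (Fin.cons b (Fin.cons c a))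

/-- The curvature `R_{ab}{}^c{}_d`, normalized by `[∇_a, ∇_b] v^c = R_{ab}{}^c{}_d v^d`. -/
def riemUp {n : ℕ} (G : MetricField n) (a b c d : Fin n) (y : Pt n) : ℝ :=
  pd a (christoffel G c b d) y - pd b (christoffel G c a d) y +
    ∑ e, (christoffel G c a e y * christoffel G e b d y -
      christoffel G c b e y * christoffel G e a d y)

/-- `R_{abcd} = g_{ce} R_{ab}{}^e{}_d`. -/
def riem {n : ℕ} (G : MetricField n) (a b c d : Fin n) (y : Pt n) : ℝ :=
  ∑ e, G y c e * riemUp G a b e d y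

/-- `Ric_{bd} = R_{ab}{}^a{}_d`. -/
def ricci {n : ℕ} (G : MetricField n) (b d : Fin n) (y : Pt n) : ℝ :=
  ∑ a, riemUp G a b a d y

def scalarCurv {n : ℕ} (G : MetricField n) (y : Pt n) : ℝ :=
  ∑ a, ∑ b, (G y)⁻¹ a b * ricci G a b y

/-- The Schouten tensor `P_{ab} = (n - 2)⁻¹ (Ric_{ab} - Sc / (2 (n - 1)) g_{ab})`. -/
def schouten {n : ℕ} (G : MetricField n) (a b : Fin n) (y : Pt n) : ℝ :=
  (1 / ((n : ℝ) - 2)) * (ricci G a b y - scalarCurv G y / (2 * ((n : ℝ) - 1)) * G y a b)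

/-- `J = P^a{}_a`. -/
def traceJ {n : ℕ} (G : MetricField n) (y : Pt n) : ℝ :=
  ∑ a, ∑ b, (G y)⁻¹ a b * schouten G a b y

/-- The Weyl tensor, `R_{abcd} = C_{abcd} + 2 g_{c[a} P_{b]d} + 2 g_{d[b} P_{a]c}`. -/
def weyl {n : ℕ} (G : MetricField n) (a b c d : Fin n) (y : Pt n) : ℝ :=
  riem G a b c d y -
    (G y c a * schouten G b d y - G y c b * schouten G a d y +
      G y d b * schouten G a c y - G y d a * schouten G b c y)

/-- `∇_{[a} P_{b]d}`. -/
def skewNablaP {n : ℕ} (G : MetricField n) (a b d : Fin n) (y : Pt n) : ℝ :=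
  (1 / 2) * (nabla G (fun z (i : Fin 2 → Fin n) => schouten G (i 0) (i 1) z) y ![a, b, d] -
    nabla G (fun z (i : Fin 2 → Fin n) => schouten G (i 0) (i 1) z) y ![b, a, d])

/-! ### Tractor calculus in a scale

A metric `g` in the conformal class splits the standard tractor bundle: a standard tractor is
`V_A = α Y_A + μ_a Z_A{}^a + τ X_A`, and is given by `(α, μ_a, τ)`.  Tractor tensors are given by
their components with respect to the frame `Y`, `Z^a`, `X`. -/

/-- Values of a (lower) tractor index: the slot of `Y`, the slots of `Z^a`, the slot of `X`. -/
abbrev TIdx (n : ℕ) : Type := Unit ⊕ Fin n ⊕ Unit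

/-- The index of the `Y` slot (primary part `α`). -/
abbrev iY {n : ℕ} : TIdx n := Sum.inl ()

/-- The index of the slot of `Z^a` (middle part `μ_a`). -/
abbrev iZ {n : ℕ} (a : Fin n) : TIdx n := Sum.inr (Sum.inl a)

/-- The index of the `X` slot (bottom part `τ`). -/
abbrev iX {n : ℕ} : TIdx n := Sum.inr (Sum.inr ())

/-- Component fields of tractor tensors with `k` lower tractor indices. -/
abbrev TField (n k : ℕ) : Type := Pt n → (Fin k → TIdx n) → ℝ

/-- The projector `Y_A`. -/
def projY {n : ℕ} : TIdx n → ℝ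
  | Sum.inl _ => 1
  | Sum.inr (Sum.inl _) => 0
  | Sum.inr (Sum.inr _) => 0

/-- The projector `Z_A{}^a`. -/
def projZ {n : ℕ} : TIdx n → Fin n → ℝ
  | Sum.inl _, _ => 0
  | Sum.inr (Sum.inl b), a => if a = b then 1 else 0
  | Sum.inr (Sum.inr _), _ => 0

/-- The projector `X_A`. -/
def projX {n : ℕ} : TIdx n → ℝ
  | Sum.inl _ => 0
  | Sum.inr (Sum.inl _) => 0
  | Sum.inr (Sum.inr _) => 1

/-- The (inverse) tractor metric
`h^{AB} U_A V_B = α_U τ_V + τ_U α_V + g^{ab} (μ_U)_a (μ_V)_b`. -/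
def hInv {n : ℕ} (G : MetricField n) (y : Pt n) : TIdx n → TIdx n → ℝ
  | Sum.inl _, Sum.inr (Sum.inr _) => 1
  | Sum.inr (Sum.inr _), Sum.inl _ => 1
  | Sum.inr (Sum.inl a), Sum.inr (Sum.inl b) => (G y)⁻¹ a b
  | _, _ => 0

/-- The coefficients of the tractor connection, `(∇_p V)_A = ∂_p V_A - ∑_B conn_p(A, B) V_B`, that
is `∇_p (α, μ_b, τ) = (∇_p α - μ_p, ∇_p μ_b + g_{pb} τ + P_{pb} α, ∇_p τ - P_{pb} μ^b)`. -/
def conn {n : ℕ} (G : MetricField n) (y : Pt n) (p : Fin n) : TIdx n → TIdx n → ℝ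
  | Sum.inl _, Sum.inr (Sum.inl b) => if p = b then 1 else 0
  | Sum.inr (Sum.inl b), Sum.inl _ => -schouten G p b y
  | Sum.inr (Sum.inl b), Sum.inr (Sum.inl c) => christoffel G c p b y
  | Sum.inr (Sum.inl b), Sum.inr (Sum.inr _) => -G y p b
  | Sum.inr (Sum.inr _), Sum.inr (Sum.inl c) => ∑ b, schouten G p b y * (G y)⁻¹ b c
  | _, _ => 0

/-- The tractor connection `∇_p` on tractor tensors. -/
def tnabla {n k : ℕ} (G : MetricField n) (p : Fin n) (V : TField n k) : TField n k := fun y A =>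
  pd p (fun z => V z A) y - ∑ j : Fin k, ∑ B, conn G y p (A j) B * V y (Function.update A j B)

/-- `Δ V = g^{pq} ∇_p ∇_q V` for the coupled tractor and Levi-Civita connection. -/
def tlap {n k : ℕ} (G : MetricField n) (V : TField n k) : TField n k := fun y A =>
  ∑ p, ∑ q, (G y)⁻¹ p q *
    (tnabla G p (tnabla G q V) y A - ∑ r, christoffel G r p q y * tnabla G r V y A)

/-- The tractor `D`-operator on tractor tensors of weight `w`,
`D_A V = (n + 2w - 2) w Y_A V + (n + 2w - 2) Z_A{}^a ∇_a V - X_A (Δ V + w J V)`. -/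
def tractorD {n k : ℕ} (G : MetricField n) (w : ℝ) (V : TField n k) : TField n (k + 1) :=
  fun y A =>
    ((n : ℝ) + 2 * w - 2) * w * projY (A 0) * V y (Fin.tail A) +
      ((n : ℝ) + 2 * w - 2) * ∑ a, projZ (A 0) a * tnabla G a V y (Fin.tail A) -
      projX (A 0) * (tlap G V y (Fin.tail A) + w * traceJ G y * V y (Fin.tail A))

/-- `Z_{[A}{}^a Z_{B]}{}^b`. -/
def projZZ {n : ℕ} (A B : TIdx n) (a b : Fin n) : ℝ :=
  (1 / 2) * (projZ A a * projZ B b - projZ B a * projZ A b)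

/-- `X_{[A} Z_{B]}{}^b`. -/
def projXZ {n : ℕ} (A B : TIdx n) (b : Fin n) : ℝ :=
  (1 / 2) * (projX A * projZ B b - projX B * projZ A b)

/-- The tractor curvature quantity of a conformally Einstein structure with Einstein scale `σ`,
`W_{ABCD} = ZZ_{AB}^{ab} ZZ_{CD}^{cd} C_{abcd} - 4 ZZ_{AB}^{ab} XZ_{CD}^d ∇_{[a} P_{b]d}
  - 4 XZ_{AB}^b ZZ_{CD}^{cd} ∇_{[c} P_{d]b}
  - 8 XZ_{AB}^b XZ_{CD}^d σ⁻¹ (∇_{[b} P_{a]d}) ∇^a σ`. -/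
def tractorW {n : ℕ} (G : MetricField n) (σ : Pt n → ℝ) (y : Pt n) (A B C D : TIdx n) : ℝ :=
  (∑ a, ∑ b, ∑ c, ∑ d, projZZ A B a b * projZZ C D c d * weyl G a b c d y) -
  4 * (∑ a, ∑ b, ∑ d, projZZ A B a b * projXZ C D d * skewNablaP G a b d y) -
  4 * (∑ b, ∑ c, ∑ d, projXZ A B b * projZZ C D c d * skewNablaP G c d b y) -
  8 * (∑ b, ∑ d, projXZ A B b * projXZ C D d * (σ y)⁻¹ *
    ∑ a, ∑ e, skewNablaP G b a d y * (G y)⁻¹ a e * pd e σ y)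

/-- `W_A{}^B{}_C{}^D`. -/
def tractorWUp {n : ℕ} (G : MetricField n) (σ : Pt n → ℝ) (y : Pt n) (A B C D : TIdx n) : ℝ :=
  ∑ B', ∑ D', hInv G y B B' * hInv G y D D' * tractorW G σ y A B' C D'

/-- The tensorial (derivation) action of an endomorphism `S` on components with lower indices,
`(S ♯ V)_{A₁ … A_k} = ∑_i S_{A_i}{}^B V_{A₁ … B … A_k}`. -/
def sharp {n k : ℕ} (S : TIdx n → TIdx n → ℝ) (V : (Fin k → TIdx n) → ℝ) :
    (Fin k → TIdx n) → ℝ := fun A =>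
  ∑ i : Fin k, ∑ B, S (A i) B * V (Function.update A i B)

/-- The double action `W ♯ ♯ V`: for `W_A{}^B{}_C{}^D = S_A{}^B T_C{}^D` this is `S ♯ (T ♯ V)`, and
it is linear in `W`. -/
def sharpSharp {n k : ℕ} (W : TIdx n → TIdx n → TIdx n → TIdx n → ℝ)
    (V : (Fin k → TIdx n) → ℝ) : (Fin k → TIdx n) → ℝ := fun A =>
  ∑ i : Fin k, ∑ B, sharp (fun C D => W (A i) B C D) V (Function.update A i B)

/-- The modified tractor `D`-operator `D_A - X_A W ♯ ♯` on tractor tensors of weight `w`. -/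
def modD {n k : ℕ} (G : MetricField n) (σ : Pt n → ℝ) (w : ℝ) (V : TField n k) :
    TField n (k + 1) := fun y A =>
  tractorD G w V y A - projX (A 0) * sharpSharp (tractorWUp G σ y) (V y) (Fin.tail A)

/-- The scale tractor `I_A = n⁻¹ D_A σ` of a density `σ` of weight one. -/
def scaleTractor {n : ℕ} (G : MetricField n) (σ : Pt n → ℝ) (y : Pt n) (A : TIdx n) : ℝ :=
  (1 / (n : ℝ)) * tractorD G 1 (fun z (_ : Fin 0 → TIdx n) => σ z) y ![A]

/-- The contraction `U^{A₁} V_{A₁ A₂ … A_k}`. -/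
def contract {n k : ℕ} (G : MetricField n) (U : Pt n → TIdx n → ℝ) (V : TField n (k + 1)) :
    TField n k := fun y A =>
  ∑ B, ∑ C, hInv G y B C * U y B * V y (Fin.cons C A)

/-- `□_σ V = I^A D_A V` with the modified `D`-operator, on tractor tensors of weight `w`. -/
def boxS {n k : ℕ} (G : MetricField n) (σ : Pt n → ℝ) (w : ℝ) (V : TField n k) : TField n k :=
  contract G (scaleTractor G σ) (modD G σ w V)

/-- The power `(□_σ)^ℓ` starting at weight `w`; every factor lowers the weight by one. -/
def boxPow {n k : ℕ} (G : MetricField n) (σ : Pt n → ℝ) (w : ℝ) : ℕ → TField n k → TField n k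
  | 0, V => V
  | ℓ + 1, V => boxS G σ (w - ℓ) (boxPow G σ w ℓ V)

/-- Skew-symmetrization (with the factor `1 / k!`). -/
def skew {n k : ℕ} (T : (Fin k → TIdx n) → ℝ) : (Fin k → TIdx n) → ℝ := fun A =>
  (1 / (k.factorial : ℝ)) *
    ∑ s : Equiv.Perm (Fin k), ((Equiv.Perm.sign s : ℤ) : ℝ) * T (fun i => A (s i))

/-- `Z_{A₁}{}^{a₁} ⋯ Z_{A_k}{}^{a_k} f_{a₁ … a_k}`. -/
def formZ {n k : ℕ} (f : (Fin k → Fin n) → ℝ) : (Fin k → TIdx n) → ℝ := fun A =>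
  ∑ a : Fin k → Fin n, (∏ j, projZ (A j) (a j)) * f a

/-- `X_{[A₁} Z_{A₂}{}^{a₂} ⋯ Z_{A_k]}{}^{a_k} ρ_{a₂ … a_k}`. -/
def formX {n k : ℕ} (ρ : (Fin k → Fin n) → ℝ) : (Fin (k + 1) → TIdx n) → ℝ :=
  skew fun A => projX (A 0) * formZ ρ (Fin.tail A)

/-- The operator `M f = (n + w - 2k) / k Z f + X δf` on forms of degree `k = p + 1` and weight `w`,
with values in tractor `k`-forms of weight `w - k`. -/
def opM {n p : ℕ} (G : MetricField n) (w : ℝ) (f : Tens n (p + 1)) : TField n (p + 1) :=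
  fun y A =>
    ((n : ℝ) + w - 2 * ((p : ℝ) + 1)) / ((p : ℝ) + 1) * formZ (f y) A + formX (coD G f y) A

/-- The projector `q^k : F ↦ Z^{A₁}{}_{a₁} ⋯ Z^{A_k}{}_{a_k} F_{A₁ … A_k}`, that is, the
`Z ⋯ Z` components. -/
def opQ {n k : ℕ} (F : TField n k) : Tens n k := fun y a => F y (fun j => iZ (a j))

/-- The operator `L_k^ℓ f = σ^{-ℓ} q^k (□_σ)^ℓ M f`, `k = p + 1`, on `k`-forms of weight
`k + ℓ - n / 2`. -/
def opL {n p : ℕ} (G : MetricField n) (σ : Pt n → ℝ) (ℓ : ℕ) (f : Tens n (p + 1)) :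
    Tens n (p + 1) :=
  let k : ℝ := (p : ℝ) + 1
  let w : ℝ := k + ℓ - (n : ℝ) / 2
  fun y a => ((σ y) ^ ℓ)⁻¹ * opQ (boxPow G σ (w - k) ℓ (opM G w f)) y a

/-- The operator `G_k^{ℓ,σ} f = σ^{-ℓ} q^{k-1} ι(Y) (□_σ)^ℓ M f`, `k = p + 1`, on `k`-forms of
weight `k + ℓ - n / 2`. -/
def opG {n p : ℕ} (G : MetricField n) (σ : Pt n → ℝ) (ℓ : ℕ) (f : Tens n (p + 1)) : Tens n p :=
  let k : ℝ := (p : ℝ) + 1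
  let w : ℝ := k + ℓ - (n : ℝ) / 2
  fun y a => ((σ y) ^ ℓ)⁻¹ *
    opQ (contract G (fun _ => projY) (boxPow G σ (w - k) ℓ (opM G w f))) y a

/-! ### Manifolds, conformal classes and weighted forms -/

section Manifold

variable (n : ℕ) (M : Type*) [TopologicalSpace M] [ChartedSpace (EuclideanSpace ℝ (Fin n)) M]

/-- The charts of the smooth structure of `M`. -/
abbrev Chart : Set (OpenPartialHomeomorph M (EuclideanSpace ℝ (Fin n))) :=
  IsManifold.maximalAtlas (𝓡 n) ∞ M

variable {M}

/-- The coordinate vector field `∂_i` of a chart `e`, at the point with coordinates `y`. -/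
def coordVec (e : OpenPartialHomeomorph M (EuclideanSpace ℝ (Fin n))) (y : Pt n) (i : Fin n) :
    TangentSpace (𝓡 n) (e.symm y) :=
  mfderiv (𝓡 n) (𝓡 n) e.symm y (EuclideanSpace.single i (1 : ℝ))

variable (M)

/-- Smooth pseudo-Riemannian metrics (of any signature) on `M`. -/
structure Metric where
  val : ∀ x : M, LinearMap.BilinForm ℝ (TangentSpace (𝓡 n) x)
  symm : ∀ x u v, val x u v = val x v u
  nondeg : ∀ x u, (∀ v, val x u v = 0) → u = 0
  smooth : ∀ e ∈ Chart n M, ∀ i j, ContDiffOn ℝ ∞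
    (fun y => val (e.symm y) (coordVec n e y i) (coordVec n e y j)) e.target

/-- Smooth differential forms of degree `k` on `M`. -/
structure Form (k : ℕ) where
  val : ∀ x : M, (TangentSpace (𝓡 n) x) [⋀^Fin k]→ₗ[ℝ] ℝ
  smooth : ∀ e ∈ Chart n M, ∀ a : Fin k → Fin n, ContDiffOn ℝ ∞
    (fun y => val (e.symm y) (fun j => coordVec n e y (a j))) e.target

variable {n M}

/-- The components `g_{ij}` of a metric in a chart. -/
def Metric.comp (g : Metric n M) (e : OpenPartialHomeomorph M (EuclideanSpace ℝ (Fin n))) :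
    MetricField n := fun y =>
  Matrix.of fun i j => g.val (e.symm y) (coordVec n e y i) (coordVec n e y j)

/-- The components of a form in a chart. -/
def Form.comp {k : ℕ} (f : Form n M k)
    (e : OpenPartialHomeomorph M (EuclideanSpace ℝ (Fin n))) : Tens n k := fun y a =>
  f.val (e.symm y) (fun j => coordVec n e y (a j))

/-- `h = e^{2φ} g`. -/
def IsRescaling (g h : Metric n M) (φ : M → ℝ) : Prop :=
  ∀ x u v, h.val x u v = Real.exp (2 * φ x) * g.val x u v

/-- `c` is a conformal class of metrics. -/
def IsConformalClass (c : Set (Metric n M)) : Prop :=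
  ∃ g, c = {h | ∃ φ : M → ℝ, ContMDiff (𝓡 n) 𝓘(ℝ) ∞ φ ∧ IsRescaling g h φ}

/-- Sections of the density bundle `E[w]` of a conformal class: a smooth function for every metric
of the class, with `f_{e^{2φ} g} = e^{wφ} f_g`. -/
structure Density (c : Set (Metric n M)) (w : ℝ) where
  rep : Metric n M → M → ℝ
  smooth : ∀ g ∈ c, ContMDiff (𝓡 n) 𝓘(ℝ) ∞ (rep g)
  equivariant : ∀ g ∈ c, ∀ h ∈ c, ∀ φ : M → ℝ, IsRescaling g h φ →
    ∀ x, rep h x = Real.exp (w * φ x) * rep g x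

/-- Sections of `Λ^k T*M ⊗ E[w]`: a smooth form for every metric of the class, with
`f_{e^{2φ} g} = e^{wφ} f_g`. -/
structure WeightedForm (c : Set (Metric n M)) (k : ℕ) (w : ℝ) where
  rep : Metric n M → Form n M k
  equivariant : ∀ g ∈ c, ∀ h ∈ c, ∀ φ : M → ℝ, IsRescaling g h φ →
    ∀ x, (rep h).val x = Real.exp (w * φ x) • (rep g).val x

/-- `σ` is an Einstein scale: a positive section of `E[1]` for which the trace-free part of
`∇_a ∇_b σ + P_{ab} σ` vanishes (a conformally invariant condition). -/
def IsEinsteinScale {c : Set (Metric n M)} (σ : Density c 1) : Prop :=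
  ∀ g ∈ c, (∀ x, 0 < σ.rep g x) ∧ ∀ e ∈ Chart n M, ∀ y ∈ e.target,
    let G := g.comp e
    let s : Pt n → ℝ := fun z => σ.rep g (e.symm z)
    let H : Matrix (Fin n) (Fin n) ℝ := fun a b =>
      nabla G (nabla G (fun z (_ : Fin 0 → Fin n) => s z)) y ![a, b] + schouten G a b y * s y
    ∀ a b, H a b = (1 / (n : ℝ)) * (∑ i, ∑ j, (G y)⁻¹ i j * H i j) * G y a b

end Manifold

end WeightedForms

end

open WeightedForms

/-! At this weight $Mf$ has tractor weight $1-\frac n2$, where the factor $n+2w'-2$ vanishes, so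
$\mathbf D_A$ is $X_A$ times $-(\Delta+(1-\frac n2)J)-\widetilde W\sharp\sharp$. In the Einstein
scale $P=\lambda g$ with $\lambda=J/n$ and $I=Y-\lambda X$. Since $X$ is null and pairs to one with
$Y$, $\square_\sigma$ is exactly that second order operator (`IsEinsteinOn.boxS_eq`). The Cotton
tensor vanishes, so $\widetilde W$ is the Weyl tensor placed in the $Z$ slots.

The tractor form $Mf$ has just two kinds of components: $\varphi=rf$ in $Z\cdots Z$, with $r=(\frac
n2-k+1)/k$, and $\rho=\frac1k\delta f$ in $XZ\cdots Z$. For any such tractor $k$-form the Laplacian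
has components $\Delta\varphi+2d\rho-2\lambda k\varphi$ and
$\Delta\rho+2\lambda\delta\varphi-\lambda n\rho$ (`IsEinsteinOn.tlap_zT`, `IsEinsteinOn.tlap_X`).

The Weitzenböck identity replaces $-\Delta$ by $d\delta+\delta d$ plus the double action of the
Riemann tensor. On $k$-forms the Weyl action exceeds the Riemann action by the scalar $2\lambda
k(n-k)$ (`IsEinsteinOn.dblAct_weyl`), so the curvature actions cancel and only scalars remain. In
the $Z\cdots Z$ slot one is left with $r(d\delta+\delta d)-\frac2k d\delta$, hence the two
coefficients $(\frac n2-k\mp1)/k$, and a zeroth order term. In the other slot $\delta\delta=0$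
(`IsEinsteinOn.coD_coD`) leaves only $\delta d\delta f$ and a multiple of $\lambda\,\delta f$. The
contracted Bianchi identity makes $\lambda$ locally constant (`IsEinsteinOn.pd_lam`); this enters
the Laplacian in the $X$ slot and lets $J$ pass inside the outer $\delta$.

The computation takes place in the components of one chart, so the parallel metric, the Ricci
identity and both Bianchi identities are derived from the Christoffel symbols. -/

noncomputable section

namespace WeightedForms

/-! ### The derivation action of an endomorphism on tensor components -/

section Algebra

variable {ι : Type*} [Fintype ι] {k : ℕ}

/-- The derivation action of an endomorphism on the components of a covariant tensor. -/
def act (S : ι → ι → ℝ) (V : (Fin k → ι) → ℝ) : (Fin k → ι) → ℝ := fun a =>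
  ∑ j : Fin k, ∑ c, S (a j) c * V (Function.update a j c)

/-- The part of a double derivation action in which the two endomorphisms hit distinct slots. -/
def actOff (S T : ι → ι → ℝ) (V : (Fin k → ι) → ℝ) (a : Fin k → ι) : ℝ :=
  ∑ i : Fin k, ∑ j : Fin k, if i = j then 0 else
    ∑ c, ∑ d, S (a i) c * T (a j) d * V (Function.update (Function.update a i c) j d)

theorem act_comp_perm (S : ι → ι → ℝ) (V : (Fin k → ι) → ℝ) (s : Equiv.Perm (Fin k))
    (a : Fin k → ι) :
    act S (fun b => V (fun i => b (s i))) a = act S V (fun i => a (s i)) := by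
  unfold act
  rw [← Equiv.sum_comp s]
  refine Finset.sum_congr rfl fun j _ => Finset.sum_congr rfl fun c _ => ?_
  refine congrArg (S _ c * V ·) (funext fun i => ?_)
  by_cases h : i = j
  · subst h; simp
  · simp [Function.update_of_ne h, Function.update_of_ne (fun h' => h (s.injective h'))]

/-- A derivation acts either on the inserted index or on one of the others. Applied to connection
coefficients, this separates the correction of one distinguished slot. -/
theorem act_insertNth (S : ι → ι → ℝ) (V : (Fin (k + 1) → ι) → ℝ) (j : Fin (k + 1)) (x : ι)
    (a : Fin k → ι) :
    act S V (j.insertNth x a) =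
      ∑ c, S x c * V (j.insertNth c a) + act S (fun b => V (j.insertNth x b)) a := by
  unfold act
  rw [Fin.sum_univ_succAbove _ j]
  simp only [Fin.insertNth_apply_same, Fin.insertNth_apply_succAbove, Fin.update_insertNth,
    Fin.insertNth_update]

theorem act_cons (S : ι → ι → ℝ) (V : (Fin (k + 1) → ι) → ℝ) (x : ι) (a : Fin k → ι) :
    act S V (Fin.cons x a) =
      ∑ c, S x c * V (Fin.cons c a) + act S (fun b => V (Fin.cons x b)) a := by
  simpa [Fin.insertNth_zero'] using act_insertNth S V 0 x a

theorem act_fun_add (S : ι → ι → ℝ) (V W : (Fin k → ι) → ℝ) (a : Fin k → ι) :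
    act S (fun b => V b + W b) a = act S V a + act S W a := by
  simp only [act, mul_add, Finset.sum_add_distrib]

theorem act_fun_sub (S : ι → ι → ℝ) (V W : (Fin k → ι) → ℝ) (a : Fin k → ι) :
    act S (fun b => V b - W b) a = act S V a - act S W a := by
  simp only [act, mul_sub, Finset.sum_sub_distrib]

theorem act_fun_mul (S : ι → ι → ℝ) (r : ℝ) (V : (Fin k → ι) → ℝ) (a : Fin k → ι) :
    act S (fun b => r * V b) a = r * act S V a := by
  simp only [act, Finset.mul_sum]
  exact Finset.sum_congr rfl fun j _ => Finset.sum_congr rfl fun c _ => by ring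

theorem act_fun_sum {κ : Type*} (t : Finset κ) (S : ι → ι → ℝ) (V : κ → (Fin k → ι) → ℝ)
    (a : Fin k → ι) : act S (fun b => ∑ m ∈ t, V m b) a = ∑ m ∈ t, act S (V m) a := by
  classical
  induction t using Finset.induction_on with
  | empty => simp [act]
  | insert m t hm ih => simp only [Finset.sum_insert hm, act_fun_add, ih]

theorem act_sub (S T : ι → ι → ℝ) (V : (Fin k → ι) → ℝ) (a : Fin k → ι) :
    act (fun b c => S b c - T b c) V a = act S V a - act T V a := by
  simp only [act, sub_mul, Finset.sum_sub_distrib]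

/-- A pair of equal slots contributes the matrix product; pairs of distinct slots are collected in
`actOff`. -/
theorem act_act (S T : ι → ι → ℝ) (V : (Fin k → ι) → ℝ) (a : Fin k → ι) :
    act S (act T V) a = act (fun b d => ∑ c, S b c * T c d) V a + actOff S T V a := by
  unfold act actOff
  rw [← Finset.sum_add_distrib]
  refine Finset.sum_congr rfl fun i _ => ?_
  have h1 : ∀ c, S (a i) c * ∑ j, ∑ d, T (Function.update a i c j) d *
      V (Function.update (Function.update a i c) j d) =
      ∑ j, ∑ d, S (a i) c * (T (Function.update a i c j) d *
        V (Function.update (Function.update a i c) j d)) := fun c => by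
    simp only [Finset.mul_sum]
  simp only [h1]
  rw [Finset.sum_comm, ← Finset.add_sum_erase _ _ (Finset.mem_univ i),
    ← Finset.add_sum_erase Finset.univ (fun j => if i = j then (0 : ℝ) else _)
      (Finset.mem_univ i)]
  simp only [if_true, zero_add]
  congr 1
  · simp only [Function.update_self, Function.update_idem]
    rw [Finset.sum_comm]
    refine Finset.sum_congr rfl fun d _ => ?_
    rw [Finset.sum_mul]
    exact Finset.sum_congr rfl fun c _ => by ring
  · refine Finset.sum_congr rfl fun j hj => ?_
    have hne : j ≠ i := (Finset.mem_erase.mp hj).1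
    rw [if_neg (Ne.symm hne)]
    refine Finset.sum_congr rfl fun c _ => Finset.sum_congr rfl fun d _ => ?_
    rw [Function.update_of_ne hne]
    ring

/-- Endomorphisms acting in different slots commute, so only the matrix commutator survives below.
It supplies the quadratic part of the curvature in the Ricci identity. -/
theorem actOff_comm (S T : ι → ι → ℝ) (V : (Fin k → ι) → ℝ) (a : Fin k → ι) :
    actOff S T V a = actOff T S V a := by
  unfold actOff
  rw [Finset.sum_comm]
  refine Finset.sum_congr rfl fun i _ => Finset.sum_congr rfl fun j _ => ?_
  by_cases h : i = j
  · rw [if_pos h, if_pos h.symm]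
  rw [if_neg h, if_neg (Ne.symm h), Finset.sum_comm]
  refine Finset.sum_congr rfl fun c _ => Finset.sum_congr rfl fun d _ => ?_
  rw [Function.update_comm (Ne.symm h)]
  ring

theorem act_commutator (S T : ι → ι → ℝ) (V : (Fin k → ι) → ℝ) (a : Fin k → ι) :
    act S (act T V) a - act T (act S V) a =
      act (fun b d => ∑ c, (S b c * T c d - T b c * S c d)) V a := by
  rw [act_act, act_act, actOff_comm]
  simp only [Finset.sum_sub_distrib, act_sub]
  ring

end Algebra

/-! ### Totally skew tensors and moving a slot to the front -/

section Skew

variable {ι : Type*} {k : ℕ}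

/-- Total skewness of the components of a covariant tensor. -/
def IsSkew (V : (Fin k → ι) → ℝ) : Prop :=
  ∀ (s : Equiv.Perm (Fin k)) (a : Fin k → ι),
    V (fun i => a (s i)) = ((Equiv.Perm.sign s : ℤ) : ℝ) * V a

theorem IsSkew.swap {V : (Fin k → ι) → ℝ} (hV : IsSkew V) {i j : Fin k} (hij : i ≠ j)
    (a : Fin k → ι) : V (fun l => a (Equiv.swap i j l)) = -V a := by
  rw [hV, Equiv.Perm.sign_swap hij]; simp

/-- Moving an entry from the front to slot `j` is the cycle `j.cycleRange`, whose sign is $(-1)^j$.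
-/
theorem IsSkew.insertNth {V : (Fin (k + 1) → ι) → ℝ} (hV : IsSkew V) (j : Fin (k + 1)) (x : ι)
    (a : Fin k → ι) : V (j.insertNth x a) = (-1 : ℝ) ^ (j : ℕ) * V (Fin.cons x a) := by
  have h := hV j.cycleRange (Fin.cons x a)
  rw [Fin.sign_cycleRange] at h
  have h2 : (fun i => (Fin.cons x a : Fin (k + 1) → ι) (j.cycleRange i)) = j.insertNth x a :=
    Fin.cons_comp_cycleRange x a j
  rw [h2] at h
  simpa using h

/-- This converts the alternating sums of exterior calculus into sums over replacements of a single
index, the shape in which derivation actions are written. -/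
theorem IsSkew.cons_removeNth {V : (Fin (k + 1) → ι) → ℝ} (hV : IsSkew V) (j : Fin (k + 1))
    (x : ι) (a : Fin (k + 1) → ι) :
    (-1 : ℝ) ^ (j : ℕ) * V (Fin.cons x (j.removeNth a)) = V (Function.update a j x) := by
  rw [← Fin.insertNth_removeNth, hV.insertNth]

/-- Slot `j` is moved to the front. -/
theorem cons_removeNth_eq (j : Fin (k + 1)) (a : Fin (k + 1) → ι) :
    (Fin.cons (a j) (j.removeNth a) : Fin (k + 1) → ι) = fun i => a (j.cycleRange.symm i) :=
  Fin.cons_removeNth_eq_comp_cycleRange_symm a j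

/-- The permutation fixing `0` and acting by `s` on the remaining slots. -/
theorem exists_perm_cons (s : Equiv.Perm (Fin k)) :
    ∃ s' : Equiv.Perm (Fin (k + 1)), Equiv.Perm.sign s' = Equiv.Perm.sign s ∧
      ∀ (x : ι) (a : Fin k → ι), (fun i => (Fin.cons x a : Fin (k + 1) → ι) (s' i)) =
        Fin.cons x (fun i => a (s i)) := by
  refine ⟨Equiv.Perm.decomposeFin.symm (0, s), ?_, ?_⟩
  · simp [Equiv.Perm.decomposeFin.symm_sign]
  · intro x a
    funext i
    refine Fin.cases ?_ (fun i => ?_) i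
    · simp
    · simp [Equiv.Perm.decomposeFin_symm_apply_succ]

theorem IsSkew.cons {V : (Fin (k + 1) → ι) → ℝ} (hV : IsSkew V) (x : ι) :
    IsSkew fun a => V (Fin.cons x a) := by
  intro s a
  obtain ⟨s', hs, h⟩ := exists_perm_cons (ι := ι) s
  have := hV s' (Fin.cons x a)
  rwa [h, hs] at this

end Skew

/-! ### Partial derivatives and the Levi-Civita connection on an open set -/

section Calculus

variable {n : ℕ} {U : Set (Pt n)} {y : Pt n}

/-- Smoothness on a set. -/
abbrev SmoothOn (U : Set (Pt n)) (u : Pt n → ℝ) : Prop := ContDiffOn ℝ ∞ u U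

theorem SmoothOn.differentiableAt {u : Pt n → ℝ} (h : SmoothOn U u) (hU : IsOpen U)
    (hy : y ∈ U) : DifferentiableAt ℝ u y :=
  (h.contDiffAt (hU.mem_nhds hy)).differentiableAt (by simp)

theorem SmoothOn.pd {u : Pt n → ℝ} (h : SmoothOn U u) (hU : IsOpen U) (i : Fin n) :
    SmoothOn U (pd i u) := by
  have h1 : ContDiffOn ℝ ∞ (fderiv ℝ u) U := h.fderiv_of_isOpen hU (by simp)
  exact h1.clm_apply contDiffOn_const

/-- Identities are only available on the open set `U`, the image of a chart in the application;
openness suffices to differentiate them. -/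
theorem pd_congr {u v : Pt n → ℝ} (hU : IsOpen U) (hy : y ∈ U) (h : ∀ z ∈ U, u z = v z)
    (i : Fin n) : pd i u y = pd i v y := by
  have : u =ᶠ[nhds y] v := by filter_upwards [hU.mem_nhds hy] with z hz using h z hz
  simp only [pd, this.fderiv_eq]

@[simp] theorem pd_const (i : Fin n) (r : ℝ) (y : Pt n) : pd i (fun _ => r) y = 0 := by
  simp [pd]

theorem pd_add {u v : Pt n → ℝ} (hu : DifferentiableAt ℝ u y) (hv : DifferentiableAt ℝ v y)
    (i : Fin n) : pd i (fun z => u z + v z) y = pd i u y + pd i v y := by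
  simp only [pd]; rw [fderiv_fun_add hu hv]; rfl

theorem pd_sub {u v : Pt n → ℝ} (hu : DifferentiableAt ℝ u y) (hv : DifferentiableAt ℝ v y)
    (i : Fin n) : pd i (fun z => u z - v z) y = pd i u y - pd i v y := by
  simp only [pd]; rw [fderiv_fun_sub hu hv]; rfl

theorem pd_mul {u v : Pt n → ℝ} (hu : DifferentiableAt ℝ u y) (hv : DifferentiableAt ℝ v y)
    (i : Fin n) : pd i (fun z => u z * v z) y = pd i u y * v y + u y * pd i v y := by
  simp only [pd]; rw [fderiv_fun_mul hu hv]; simp; ring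

theorem pd_const_mul {u : Pt n → ℝ} (hu : DifferentiableAt ℝ u y) (r : ℝ) (i : Fin n) :
    pd i (fun z => r * u z) y = r * pd i u y := by
  rw [pd_mul (differentiableAt_const r) hu]; simp

theorem pd_sum {κ : Type*} (t : Finset κ) {u : κ → Pt n → ℝ}
    (hu : ∀ m ∈ t, DifferentiableAt ℝ (u m) y) (i : Fin n) :
    pd i (fun z => ∑ m ∈ t, u m z) y = ∑ m ∈ t, pd i (u m) y := by
  simp only [pd]; rw [fderiv_fun_sum hu]; simp

theorem pd_comm {u : Pt n → ℝ} (h : SmoothOn U u) (hU : IsOpen U) (hy : y ∈ U) (i j : Fin n) :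
    pd i (pd j u) y = pd j (pd i u) y := by
  have hc : ContDiffAt ℝ ∞ u y := h.contDiffAt (hU.mem_nhds hy)
  have hs : IsSymmSndFDerivAt ℝ u y := hc.isSymmSndFDerivAt (by
    rw [minSmoothness_of_isRCLikeNormedField]; exact WithTop.coe_le_coe.2 (le_top : (2 : ℕ∞) ≤ ⊤))
  have h1 : ContDiffOn ℝ ∞ (fderiv ℝ u) U := h.fderiv_of_isOpen hU (by simp)
  have hd : DifferentiableAt ℝ (fderiv ℝ u) y :=
    (h1.contDiffAt (hU.mem_nhds hy)).differentiableAt (by simp)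
  have key : ∀ i j : Fin n, pd i (pd j u) y =
      fderiv ℝ (fderiv ℝ u) y (EuclideanSpace.single i 1) (EuclideanSpace.single j 1) := by
    intro i j
    change fderiv ℝ (fun z => fderiv ℝ u z (EuclideanSpace.single j 1)) y _ = _
    rw [fderiv_clm_apply hd (differentiableAt_const _)]
    simp
  rw [key, key, hs]

/-- A metric which is smooth, symmetric and nondegenerate on an open set. -/
structure IsMetricOn (G : MetricField n) (U : Set (Pt n)) : Prop where
  isOpen : IsOpen U
  smooth : ∀ a b, SmoothOn U fun z => G z a b
  symm : ∀ z ∈ U, ∀ a b, G z a b = G z b a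
  det_ne_zero : ∀ z ∈ U, (G z).det ≠ 0

/-- Smoothness of all components of a tensor on a set. -/
abbrev SmoothTens {k : ℕ} (U : Set (Pt n)) (T : Tens n k) : Prop :=
  ∀ a, SmoothOn U fun z => T z a

/-- The connection coefficients `Γ^c_{pb}` as an endomorphism in `(b, c)`. -/
abbrev chr (G : MetricField n) (y : Pt n) (p : Fin n) : Fin n → Fin n → ℝ :=
  fun b c => christoffel G c p b y

theorem nabla_cons {k : ℕ} (G : MetricField n) (T : Tens n k) (y : Pt n) (p : Fin n)
    (a : Fin k → Fin n) :
    nabla G T y (Fin.cons p a) = pd p (fun z => T z a) y - act (chr G y p) (T y) a := by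
  simp [nabla, act]

theorem SmoothOn.det {m : ℕ} {A : Pt n → Matrix (Fin m) (Fin m) ℝ}
    (h : ∀ a b, SmoothOn U fun z => A z a b) : SmoothOn U fun z => (A z).det := by
  simp only [Matrix.det_apply']
  exact ContDiffOn.sum fun s _ => contDiffOn_const.mul (contDiffOn_prod fun i _ => h _ _)

variable {G : MetricField n}

/-- Cramer's rule: the entries are cofactors divided by a nowhere vanishing determinant. -/
theorem IsMetricOn.smooth_inv (hG : IsMetricOn G U) (a b : Fin n) :
    SmoothOn U fun z => (G z)⁻¹ a b := by
  have h : ∀ z ∈ U, (G z)⁻¹ a b = ((G z).det)⁻¹ * (G z).adjugate a b := fun z _ => by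
    rw [Matrix.inv_def, Matrix.smul_apply, Ring.inverse_eq_inv', smul_eq_mul]
  refine ContDiffOn.congr (ContDiffOn.mul ((SmoothOn.det hG.smooth).inv hG.det_ne_zero) ?_) h
  simp only [Matrix.adjugate_apply]
  refine SmoothOn.det fun c d => ?_
  by_cases hc : c = b
  · subst hc; simpa using contDiffOn_const
  · simpa [Matrix.updateRow_ne hc] using hG.smooth c d

theorem IsMetricOn.mul_inv (hG : IsMetricOn G U) (hy : y ∈ U) (a b : Fin n) :
    ∑ c, G y a c * (G y)⁻¹ c b = if a = b then 1 else 0 := by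
  have := congrFun (congrFun (Matrix.mul_nonsing_inv (G y)
    (isUnit_iff_ne_zero.2 (hG.det_ne_zero y hy))) a) b
  simpa [Matrix.mul_apply, Matrix.one_apply] using this

theorem IsMetricOn.inv_mul (hG : IsMetricOn G U) (hy : y ∈ U) (a b : Fin n) :
    ∑ c, (G y)⁻¹ a c * G y c b = if a = b then 1 else 0 := by
  have := congrFun (congrFun (Matrix.nonsing_inv_mul (G y)
    (isUnit_iff_ne_zero.2 (hG.det_ne_zero y hy))) a) b
  simpa [Matrix.mul_apply, Matrix.one_apply] using this

theorem IsMetricOn.inv_symm (hG : IsMetricOn G U) (hy : y ∈ U) (a b : Fin n) :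
    (G y)⁻¹ a b = (G y)⁻¹ b a := by
  have h : (G y).transpose = G y := by ext a b; exact hG.symm y hy b a
  have := congrFun (congrFun (Matrix.transpose_nonsing_inv (G y)) b) a
  rwa [h, Matrix.transpose_apply] at this

theorem IsMetricOn.smooth_chr (hG : IsMetricOn G U) (c a b : Fin n) :
    SmoothOn U (christoffel G c a b) := by
  refine contDiffOn_const.mul (ContDiffOn.sum fun d _ => (hG.smooth_inv _ _).mul ?_)
  exact (((hG.smooth _ _).pd hG.isOpen _).add ((hG.smooth _ _).pd hG.isOpen _)).sub
    ((hG.smooth _ _).pd hG.isOpen _)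

theorem IsMetricOn.chr_symm (hG : IsMetricOn G U) (hy : y ∈ U) (c a b : Fin n) :
    christoffel G c a b y = christoffel G c b a y := by
  simp only [christoffel]
  congr 1
  refine Finset.sum_congr rfl fun d _ => ?_
  rw [pd_congr hG.isOpen hy (fun z hz => hG.symm z hz a b) d]
  ring

theorem IsMetricOn.lower_chr (hG : IsMetricOn G U) (hy : y ∈ U) (c a b : Fin n) :
    ∑ e, G y c e * christoffel G e a b y = (1 / 2) *
      (pd a (fun z => G z b c) y + pd b (fun z => G z a c) y - pd c (fun z => G z a b) y) := by
  have h : ∀ e, G y c e * christoffel G e a b y = ∑ d, (1 / 2) * (G y c e * (G y)⁻¹ e d) *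
      (pd a (fun z => G z b d) y + pd b (fun z => G z a d) y - pd d (fun z => G z a b) y) := by
    intro e
    simp only [christoffel, Finset.mul_sum]
    exact Finset.sum_congr rfl fun d _ => by ring
  simp only [h]
  rw [Finset.sum_comm]
  simp only [← Finset.sum_mul, ← Finset.mul_sum, hG.mul_inv hy]
  simp

/-- Metric compatibility: in the sum of the two lowered Christoffel symbols four of the six
derivatives cancel. -/
theorem IsMetricOn.pd_metric (hG : IsMetricOn G U) (hy : y ∈ U) (p a b : Fin n) :
    pd p (fun z => G z a b) y =
      ∑ e, christoffel G e p a y * G y e b + ∑ e, christoffel G e p b y * G y a e := by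
  have h1 := hG.lower_chr hy b p a
  have h2 := hG.lower_chr hy a p b
  have s1 : ∑ e, christoffel G e p a y * G y e b = ∑ e, G y b e * christoffel G e p a y :=
    Finset.sum_congr rfl fun e _ => by rw [hG.symm y hy e b]; ring
  have s2 : ∑ e, christoffel G e p b y * G y a e = ∑ e, G y a e * christoffel G e p b y :=
    Finset.sum_congr rfl fun e _ => by ring
  rw [s1, s2, h1, h2, pd_congr hG.isOpen hy (fun z hz => hG.symm z hz b a) p]
  ring

/-- Differentiate $g^{-1}g=1$ and solve for the derivative of $g^{-1}$, using metric compatibility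
in the matrix form $\partial_pg=Cg+gC^{T}$. -/
theorem IsMetricOn.pd_inv (hG : IsMetricOn G U) (hy : y ∈ U) (p a b : Fin n) :
    pd p (fun z => (G z)⁻¹ a b) y =
      -∑ e, christoffel G a p e y * (G y)⁻¹ e b - ∑ e, christoffel G b p e y * (G y)⁻¹ a e := by
  have hd : ∀ d, ∑ c, pd p (fun z => (G z)⁻¹ a c) y * G y c d =
      -∑ c, (G y)⁻¹ a c * pd p (fun z => G z c d) y := by
    intro d
    have h0 : pd p (fun z => ∑ c, (G z)⁻¹ a c * G z c d) y = 0 := by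
      rw [pd_congr hG.isOpen hy (fun z hz => hG.inv_mul hz a d)]; simp
    rw [pd_sum (u := fun c z => (G z)⁻¹ a c * G z c d) _ (fun c _ =>
      ((hG.smooth_inv a c).differentiableAt hG.isOpen hy).fun_mul
      ((hG.smooth c d).differentiableAt hG.isOpen hy))] at h0
    simp only [pd_mul ((hG.smooth_inv a _).differentiableAt hG.isOpen hy)
      ((hG.smooth _ d).differentiableAt hG.isOpen hy), Finset.sum_add_distrib] at h0
    linarith
  let C : Matrix (Fin n) (Fin n) ℝ := Matrix.of fun b c => christoffel G c p b y
  have hC : ∀ c d, pd p (fun z => G z c d) y = (C * G y + G y * C.transpose) c d := by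
    intro c d
    rw [hG.pd_metric hy, Matrix.add_apply, Matrix.mul_apply, Matrix.mul_apply]
    congr 1
    exact Finset.sum_congr rfl fun e _ => mul_comm _ _
  -- All rows of `E` repeat the derivative of row `a` of the inverse; only row `a` is used, so that
  -- matrix algebra applies to a single row.
  let E : Matrix (Fin n) (Fin n) ℝ := Matrix.of fun _ c => pd p (fun z => (G z)⁻¹ a c) y
  have hu : IsUnit (G y).det := isUnit_iff_ne_zero.2 (hG.det_ne_zero y hy)
  have hE : (E * G y) a = (-((G y)⁻¹ * (C * G y + G y * C.transpose))) a := by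
    funext d
    simp only [Matrix.mul_apply (M := E), Matrix.neg_apply, Matrix.mul_apply (M := (G y)⁻¹), ← hC]
    exact hd d
  have hE2 : E a b = (-((G y)⁻¹ * C) - C.transpose * (G y)⁻¹) a b := by
    have h1 : E a b = ((E * G y) * (G y)⁻¹) a b := by
      rw [Matrix.mul_assoc, Matrix.mul_nonsing_inv _ hu, Matrix.mul_one]
    have h2 : -((G y)⁻¹ * C) - C.transpose * (G y)⁻¹ =
        -((G y)⁻¹ * (C * G y + G y * C.transpose)) * (G y)⁻¹ := by
      rw [Matrix.mul_add, ← Matrix.mul_assoc, ← Matrix.mul_assoc, Matrix.nonsing_inv_mul _ hu,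
        Matrix.one_mul, Matrix.neg_mul, Matrix.add_mul, Matrix.mul_assoc _ (G y),
        Matrix.mul_nonsing_inv _ hu, Matrix.mul_one, neg_add, sub_eq_add_neg]
    rw [h1, h2, Matrix.mul_apply, Matrix.mul_apply]
    exact Finset.sum_congr rfl fun d _ => by rw [congrFun hE d]
  change E a b = _
  rw [hE2, Matrix.sub_apply, Matrix.neg_apply, Matrix.mul_apply, Matrix.mul_apply]
  have s1 : ∑ e, (G y)⁻¹ a e * C e b = ∑ e, christoffel G b p e y * (G y)⁻¹ a e :=
    Finset.sum_congr rfl fun e _ => mul_comm _ _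
  have s2 : ∑ e, C.transpose a e * (G y)⁻¹ e b = ∑ e, christoffel G a p e y * (G y)⁻¹ e b := rfl
  rw [s1, s2]
  ring

end Calculus

/-! ### Rules for the Levi-Civita derivative of tensors -/

section Connection

variable {n k : ℕ} {U : Set (Pt n)} {y : Pt n} {G : MetricField n}

theorem nabla_congr {T T' : Tens n k} (hU : IsOpen U) (hy : y ∈ U)
    (h : ∀ z ∈ U, ∀ a, T z a = T' z a) (b : Fin (k + 1) → Fin n) :
    nabla G T y b = nabla G T' y b := by
  simp only [nabla, h y hy]
  rw [pd_congr hU hy fun z hz => h z hz _]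

theorem SmoothTens.nabla {T : Tens n k} (hG : IsMetricOn G U) (hT : SmoothTens U T) :
    SmoothTens U (nabla G T) := fun _ =>
  ((hT _).pd hG.isOpen _).sub <| ContDiffOn.sum fun _ _ => ContDiffOn.sum fun _ _ =>
    (hG.smooth_chr _ _ _).mul (hT _)

theorem nabla_add (hG : IsMetricOn G U) (hy : y ∈ U) {S T : Tens n k} (hS : SmoothTens U S)
    (hT : SmoothTens U T) (b : Fin (k + 1) → Fin n) :
    nabla G (fun z a => S z a + T z a) y b = nabla G S y b + nabla G T y b := by
  simp only [nabla, pd_add ((hS _).differentiableAt hG.isOpen hy)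
    ((hT _).differentiableAt hG.isOpen hy), mul_add, Finset.sum_add_distrib]
  ring

theorem nabla_sub (hG : IsMetricOn G U) (hy : y ∈ U) {S T : Tens n k} (hS : SmoothTens U S)
    (hT : SmoothTens U T) (b : Fin (k + 1) → Fin n) :
    nabla G (fun z a => S z a - T z a) y b = nabla G S y b - nabla G T y b := by
  simp only [nabla, pd_sub ((hS _).differentiableAt hG.isOpen hy)
    ((hT _).differentiableAt hG.isOpen hy), mul_sub, Finset.sum_sub_distrib]
  ring

theorem nabla_fun_mul (hG : IsMetricOn G U) (hy : y ∈ U) {u : Pt n → ℝ} (hu : SmoothOn U u)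
    {T : Tens n k} (hT : SmoothTens U T) (p : Fin n) (a : Fin k → Fin n) :
    nabla G (fun z a => u z * T z a) y (Fin.cons p a) =
      pd p u y * T y a + u y * nabla G T y (Fin.cons p a) := by
  rw [nabla_cons, nabla_cons, pd_mul (hu.differentiableAt hG.isOpen hy)
    ((hT _).differentiableAt hG.isOpen hy), act_fun_mul]
  ring

theorem nabla_const_mul (hG : IsMetricOn G U) (hy : y ∈ U) (r : ℝ) {T : Tens n k}
    (hT : SmoothTens U T) (b : Fin (k + 1) → Fin n) :
    nabla G (fun z a => r * T z a) y b = r * nabla G T y b := by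
  rw [← Fin.cons_self_tail b, nabla_fun_mul hG hy contDiffOn_const hT]
  simp

theorem nabla_sum (hG : IsMetricOn G U) (hy : y ∈ U) {κ : Type*} (t : Finset κ)
    {T : κ → Tens n k} (hT : ∀ m ∈ t, SmoothTens U (T m)) (b : Fin (k + 1) → Fin n) :
    nabla G (fun z a => ∑ m ∈ t, T m z a) y b = ∑ m ∈ t, nabla G (T m) y b := by
  rw [← Fin.cons_self_tail b]
  simp only [nabla_cons]
  rw [pd_sum _ fun m hm => ((hT m hm) _).differentiableAt hG.isOpen hy, act_fun_sum,
    Finset.sum_sub_distrib]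

theorem nabla_comp_perm (G : MetricField n) (T : Tens n k) (y : Pt n) (s : Equiv.Perm (Fin k))
    (p : Fin n) (a : Fin k → Fin n) :
    nabla G (fun z b => T z fun i => b (s i)) y (Fin.cons p a) =
      nabla G T y (Fin.cons p fun i => a (s i)) := by
  rw [nabla_cons, nabla_cons, act_comp_perm]

/-- Skewness is preserved by covariant differentiation. -/
theorem isSkew_nabla (hG : IsMetricOn G U) (hy : y ∈ U) {T : Tens n k} (hT : SmoothTens U T)
    (h : ∀ z ∈ U, IsSkew (T z)) (p : Fin n) : IsSkew fun a => nabla G T y (Fin.cons p a) := by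
  intro s a
  dsimp only
  rw [← nabla_comp_perm, ← nabla_const_mul hG hy _ hT]
  exact nabla_congr hG.isOpen hy (fun z hz b => h z hz s b) _

theorem isSkew_nabla_nabla (hG : IsMetricOn G U) (hy : y ∈ U) {T : Tens n k}
    (hT : SmoothTens U T) (h : ∀ z ∈ U, IsSkew (T z)) (p q : Fin n) :
    IsSkew fun a => nabla G (nabla G T) y (Fin.cons p (Fin.cons q a)) := by
  intro s a
  dsimp only
  obtain ⟨s', _, hs⟩ := exists_perm_cons (ι := Fin n) s
  -- The permutation is extended to fix the inner derivative slot, so the outer derivative commutes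
  -- with it.
  rw [← hs, ← nabla_comp_perm, ← nabla_const_mul hG hy _ (hT.nabla hG)]
  refine nabla_congr hG.isOpen hy (fun z hz b => ?_) _
  rw [← Fin.cons_self_tail b, hs]
  exact isSkew_nabla hG hz hT h _ s _

/-- The trace over the first two slots. -/
def trace₂ (G : MetricField n) (T : Tens n (k + 2)) : Tens n k := fun y a =>
  ∑ b, ∑ c, (G y)⁻¹ b c * T y (Fin.cons b (Fin.cons c a))

theorem SmoothTens.trace₂ (hG : IsMetricOn G U) {T : Tens n (k + 2)} (hT : SmoothTens U T) :
    SmoothTens U (trace₂ G T) := fun _ =>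
  ContDiffOn.sum fun _ _ => ContDiffOn.sum fun _ _ => (hG.smooth_inv _ _).mul (hT _)

/-- The inverse metric is parallel: the two terms of its derivative cancel the connection terms of
the two traced slots (`h4` and `h5`). -/
theorem nabla_trace₂ (hG : IsMetricOn G U) (hy : y ∈ U) {T : Tens n (k + 2)}
    (hT : SmoothTens U T) (p : Fin n) (a : Fin k → Fin n) :
    nabla G (trace₂ G T) y (Fin.cons p a) =
      ∑ b, ∑ c, (G y)⁻¹ b c * nabla G T y (Fin.cons p (Fin.cons b (Fin.cons c a))) := by
  have hd := fun b c => (hG.smooth_inv b c).differentiableAt hG.isOpen hy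
  have hdT := fun a => (hT a).differentiableAt hG.isOpen hy
  rw [nabla_cons]
  have h1 : pd p (fun z => trace₂ G T z a) y = ∑ b, ∑ c,
      (pd p (fun z => (G z)⁻¹ b c) y * T y (Fin.cons b (Fin.cons c a)) +
        (G y)⁻¹ b c * pd p (fun z => T z (Fin.cons b (Fin.cons c a))) y) := by
    unfold trace₂
    rw [pd_sum (u := fun b z => ∑ c, (G z)⁻¹ b c * T z (Fin.cons b (Fin.cons c a))) _ fun b _ =>
      DifferentiableAt.fun_sum fun c _ => (hd b c).fun_mul (hdT _)]
    refine Finset.sum_congr rfl fun b _ => ?_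
    rw [pd_sum (u := fun c z => (G z)⁻¹ b c * T z (Fin.cons b (Fin.cons c a))) _ fun c _ =>
      (hd b c).fun_mul (hdT _)]
    exact Finset.sum_congr rfl fun c _ => pd_mul (hd b c) (hdT _) p
  have h2 : act (chr G y p) (trace₂ G T y) a = ∑ b, ∑ c, (G y)⁻¹ b c *
      act (chr G y p) (fun d => T y (Fin.cons b (Fin.cons c d))) a := by
    unfold trace₂
    rw [act_fun_sum]
    refine Finset.sum_congr rfl fun b _ => ?_
    rw [act_fun_sum]
    exact Finset.sum_congr rfl fun c _ => act_fun_mul _ _ _ _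
  have h3 : ∀ b c, nabla G T y (Fin.cons p (Fin.cons b (Fin.cons c a))) =
      pd p (fun z => T z (Fin.cons b (Fin.cons c a))) y -
      (∑ e, christoffel G e p b y * T y (Fin.cons e (Fin.cons c a)) +
      (∑ e, christoffel G e p c y * T y (Fin.cons b (Fin.cons e a)) +
        act (chr G y p) (fun d => T y (Fin.cons b (Fin.cons c d))) a)) := by
    intro b c
    rw [nabla_cons, act_cons, act_cons]
  have h4 : ∑ b, ∑ c, (∑ e, christoffel G b p e y * (G y)⁻¹ e c) *
      T y (Fin.cons b (Fin.cons c a)) = ∑ b, ∑ c, (G y)⁻¹ b c *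
      ∑ e, christoffel G e p b y * T y (Fin.cons e (Fin.cons c a)) := by
    simp only [Finset.sum_mul, Finset.mul_sum]
    rw [Finset.sum_congr rfl fun b _ => Finset.sum_comm, Finset.sum_comm]
    refine Finset.sum_congr rfl fun b _ => ?_
    rw [Finset.sum_comm]
    exact Finset.sum_congr rfl fun c _ => Finset.sum_congr rfl fun e _ => by ring
  have h5 : ∑ b, ∑ c, (∑ e, christoffel G c p e y * (G y)⁻¹ b e) *
      T y (Fin.cons b (Fin.cons c a)) = ∑ b, ∑ c, (G y)⁻¹ b c *
      ∑ e, christoffel G e p c y * T y (Fin.cons b (Fin.cons e a)) := by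
    simp only [Finset.sum_mul, Finset.mul_sum]
    refine Finset.sum_congr rfl fun b _ => ?_
    rw [Finset.sum_comm]
    exact Finset.sum_congr rfl fun c _ => Finset.sum_congr rfl fun e _ => by ring
  rw [h1, h2]
  simp only [h3, hG.pd_inv hy, mul_sub, mul_add, sub_mul, neg_mul, Finset.sum_add_distrib,
    Finset.sum_sub_distrib, Finset.sum_neg_distrib]
  rw [h4, h5]
  ring

/-- The metric is parallel. -/
theorem nabla_metric_mul (hG : IsMetricOn G U) (hy : y ∈ U) {T : Tens n k}
    (hT : SmoothTens U T) (j : Fin (k + 1)) (p q x : Fin n) (b : Fin k → Fin n) :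
    nabla G (fun z (a : Fin (k + 2) → Fin n) => G z (a 0) (a j.succ) *
        T z (j.removeNth (Fin.tail a))) y (Fin.cons p (Fin.cons q (j.insertNth x b))) =
      G y q x * nabla G T y (Fin.cons p b) := by
  rw [nabla_cons, nabla_cons, act_cons, act_insertNth]
  simp only [Fin.cons_zero, Fin.cons_succ, Fin.tail_cons, Fin.insertNth_apply_same,
    Fin.removeNth_insertNth]
  rw [pd_mul ((hG.smooth q x).differentiableAt hG.isOpen hy)
    ((hT b).differentiableAt hG.isOpen hy), act_fun_mul, hG.pd_metric hy]
  simp only [← mul_assoc, ← Finset.sum_mul]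
  ring

/-- The Ricci identity. -/
theorem nabla_nabla_sub (hG : IsMetricOn G U) (hy : y ∈ U) {T : Tens n k}
    (hT : SmoothTens U T) (p q : Fin n) (a : Fin k → Fin n) :
    nabla G (nabla G T) y (Fin.cons p (Fin.cons q a)) -
      nabla G (nabla G T) y (Fin.cons q (Fin.cons p a)) =
      -act (fun b c => riemUp G p q c b y) (T y) a := by
  have hdT := fun a => (hT a).differentiableAt hG.isOpen hy
  have hdC := fun c p b => (hG.smooth_chr c p b).differentiableAt hG.isOpen hy
  have hact : ∀ p q, pd p (fun z => act (chr G z q) (T z) a) y =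
      act (fun b c => pd p (christoffel G c q b) y) (T y) a +
        act (chr G y q) (fun b => pd p (fun z => T z b) y) a := by
    intro p q
    unfold act
    rw [pd_sum _ fun j _ => DifferentiableAt.fun_sum fun c _ => (hdC _ _ _).fun_mul (hdT _),
      ← Finset.sum_add_distrib]
    refine Finset.sum_congr rfl fun j _ => ?_
    rw [pd_sum _ fun c _ => (hdC _ _ _).fun_mul (hdT _), ← Finset.sum_add_distrib]
    exact Finset.sum_congr rfl fun c _ => pd_mul (hdC _ _ _) (hdT _) p
  have key : ∀ p q, nabla G (nabla G T) y (Fin.cons p (Fin.cons q a)) =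
      pd p (pd q fun z => T z a) y - act (fun b c => pd p (christoffel G c q b) y) (T y) a -
        act (chr G y q) (fun b => pd p (fun z => T z b) y) a -
        ∑ c, christoffel G c p q y * nabla G T y (Fin.cons c a) -
        act (chr G y p) (fun b => pd q (fun z => T z b) y) a +
        act (chr G y p) (act (chr G y q) (T y)) a := by
    intro p q
    have hda : DifferentiableAt ℝ (fun z => act (chr G z q) (T z) a) y :=
      DifferentiableAt.fun_sum fun j _ => DifferentiableAt.fun_sum fun c _ =>
        (hdC _ _ _).fun_mul (hdT _)
    rw [nabla_cons, act_cons]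
    simp only [nabla_cons]
    rw [pd_sub (((hT a).pd hG.isOpen q).differentiableAt hG.isOpen hy) hda, hact, act_fun_sub]
    ring
  -- Under exchange of $p$ and $q$ the second partial derivatives and the mixed terms
  -- $\Gamma\,\partial T$ cancel, and the correction of the inner derivative slot cancels by
  -- torsion-freeness. What remains is $d\Gamma$ and the commutator of connection matrices.
  rw [key, key, pd_comm (hT a) hG.isOpen hy p q]
  have hc := act_commutator (chr G y p) (chr G y q) (T y) a
  have hr : act (fun b c => riemUp G p q c b y) (T y) a =
      act (fun b c => pd p (christoffel G c q b) y) (T y) a -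
        act (fun b c => pd q (christoffel G c p b) y) (T y) a -
        act (fun b d => ∑ c, (chr G y p b c * chr G y q c d - chr G y q b c * chr G y p c d))
          (T y) a := by
    rw [← act_sub, ← act_sub]
    congr 1
    funext b c
    rw [riemUp, sub_eq_add_neg (_ - _), ← Finset.sum_neg_distrib]
    congr 1
    exact Finset.sum_congr rfl fun e _ => by ring
  have hs : ∑ c, christoffel G c p q y * nabla G T y (Fin.cons c a) =
      ∑ c, christoffel G c q p y * nabla G T y (Fin.cons c a) :=
    Finset.sum_congr rfl fun c _ => by rw [hG.chr_symm hy]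
  rw [hr, ← hc, hs]
  ring

end Connection

/-! ### Symmetries of the curvature, Bianchi identities, Einstein metrics -/

section Curvature

variable {n : ℕ} {U : Set (Pt n)} {y : Pt n} {G : MetricField n}

theorem IsMetricOn.smooth_riemUp (hG : IsMetricOn G U) (a b c d : Fin n) :
    SmoothOn U (riemUp G a b c d) :=
  (((hG.smooth_chr _ _ _).pd hG.isOpen _).sub ((hG.smooth_chr _ _ _).pd hG.isOpen _)).add <|
    ContDiffOn.sum fun _ _ => ((hG.smooth_chr _ _ _).mul (hG.smooth_chr _ _ _)).sub
      ((hG.smooth_chr _ _ _).mul (hG.smooth_chr _ _ _))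

theorem IsMetricOn.smooth_riem (hG : IsMetricOn G U) (a b c d : Fin n) :
    SmoothOn U (riem G a b c d) :=
  ContDiffOn.sum fun _ _ => (hG.smooth _ _).mul (hG.smooth_riemUp _ _ _ _)

theorem IsMetricOn.smooth_ricci (hG : IsMetricOn G U) (b d : Fin n) :
    SmoothOn U (ricci G b d) :=
  ContDiffOn.sum fun _ _ => hG.smooth_riemUp _ _ _ _

theorem IsMetricOn.smooth_scalarCurv (hG : IsMetricOn G U) : SmoothOn U (scalarCurv G) :=
  ContDiffOn.sum fun _ _ => ContDiffOn.sum fun _ _ =>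
    (hG.smooth_inv _ _).mul (hG.smooth_ricci _ _)

theorem IsMetricOn.smooth_schouten (hG : IsMetricOn G U) (a b : Fin n) :
    SmoothOn U (schouten G a b) :=
  contDiffOn_const.mul ((hG.smooth_ricci _ _).sub
    ((hG.smooth_scalarCurv.div_const _).mul (hG.smooth _ _)))

theorem IsMetricOn.smooth_traceJ (hG : IsMetricOn G U) : SmoothOn U (traceJ G) :=
  ContDiffOn.sum fun _ _ => ContDiffOn.sum fun _ _ =>
    (hG.smooth_inv _ _).mul (hG.smooth_schouten _ _)

theorem riemUp_swap (G : MetricField n) (a b c d : Fin n) (y : Pt n) :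
    riemUp G a b c d y = -riemUp G b a c d y := by
  simp only [riemUp, Finset.sum_sub_distrib]; ring

theorem riem_swap_left (G : MetricField n) (a b c d : Fin n) (y : Pt n) :
    riem G a b c d y = -riem G b a c d y := by
  simp only [riem, riemUp_swap G a b, mul_neg, Finset.sum_neg_distrib]

theorem IsMetricOn.riemUp_eq (hG : IsMetricOn G U) (hy : y ∈ U) (a b c d : Fin n) :
    riemUp G a b c d y = ∑ e, (G y)⁻¹ c e * riem G a b e d y := by
  simp only [riem, Finset.mul_sum, ← mul_assoc]
  rw [Finset.sum_comm]
  simp only [← Finset.sum_mul, hG.inv_mul hy]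
  simp

/-- Both the $\partial\Gamma$ and the $\Gamma\Gamma$ terms cancel cyclically because $\Gamma$ is
symmetric in its lower indices. -/
theorem IsMetricOn.riemUp_bianchi (hG : IsMetricOn G U) (hy : y ∈ U) (a b c d : Fin n) :
    riemUp G a b c d y + riemUp G b d c a y + riemUp G d a c b y = 0 := by
  have h := fun i a b => pd_congr hG.isOpen hy (fun z hz => hG.chr_symm hz c a b) i
  simp only [riemUp, Finset.sum_sub_distrib]
  rw [h a d b, h b a d, h d b a]
  simp only [hG.chr_symm hy _ d b, hG.chr_symm hy _ a d, hG.chr_symm hy _ b a]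
  ring

theorem IsMetricOn.riem_bianchi (hG : IsMetricOn G U) (hy : y ∈ U) (a b c d : Fin n) :
    riem G a b c d y + riem G b d c a y + riem G d a c b y = 0 := by
  simp only [riem, ← Finset.sum_add_distrib, ← mul_add, hG.riemUp_bianchi hy]
  simp

/-- The metric as a tensor. -/
abbrev metricT (G : MetricField n) : Tens n 2 := fun z i => G z (i 0) (i 1)

theorem IsMetricOn.nabla_metric (hG : IsMetricOn G U) (hy : y ∈ U) (b : Fin 3 → Fin n) :
    nabla G (metricT G) y b = 0 := by
  rw [← Fin.cons_self_tail b, nabla_cons, hG.pd_metric hy]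
  simp [act, Fin.sum_univ_succ, metricT, Function.update_apply]

/-- The Ricci identity applied to the metric: its derivatives vanish, so the curvature acts on it
trivially. -/
theorem IsMetricOn.riem_swap_right (hG : IsMetricOn G U) (hy : y ∈ U) (a b c d : Fin n) :
    riem G a b c d y = -riem G a b d c y := by
  have h := nabla_nabla_sub hG hy (T := metricT G) (fun i => hG.smooth _ _) a b ![d, c]
  have h0 : ∀ i, nabla G (nabla G (metricT G)) y i = 0 := by
    intro i
    rw [nabla_congr (T' := fun _ _ => 0) hG.isOpen hy (fun z hz a => hG.nabla_metric hz a)]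
    simp [nabla]
  rw [h0, h0] at h
  have h1 : act (fun b' c => riemUp G a b c b' y) (metricT G y) ![d, c] =
      riem G a b c d y + riem G a b d c y := by
    simp only [act, Fin.sum_univ_two, riem]
    congr 1
    · exact Finset.sum_congr rfl fun e _ => by
        simp [metricT, hG.symm y hy e c, mul_comm]
    · exact Finset.sum_congr rfl fun e _ => by
        simp [metricT, mul_comm]
  rw [h1] at h
  linarith

/-- The curvature as a tensor. -/
abbrev riemT (G : MetricField n) : Tens n 4 := fun z i => riem G (i 0) (i 1) (i 2) (i 3) z

/-- The covariant derivative of the curvature as an endomorphism-valued two-form. -/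
def dRiemUp (G : MetricField n) (c a b f d : Fin n) (y : Pt n) : ℝ :=
  pd c (riemUp G a b f d) y + ∑ h, (christoffel G f c h y * riemUp G a b h d y -
    riemUp G a b f h y * christoffel G h c d y)

/-- In terms of connection matrices, $R=dA+A\wedge A$ and the derivative is $\partial R+[A,R]$. Once
second partial derivatives are symmetric, the cyclic sum vanishes identically in a noncommutative
ring. -/
theorem IsMetricOn.dRiemUp_bianchi (hG : IsMetricOn G U) (hy : y ∈ U) (a b c f d : Fin n) :
    dRiemUp G c a b f d y + dRiemUp G a b c f d y + dRiemUp G b c a f d y = 0 := by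
  let A : Fin n → Matrix (Fin n) (Fin n) ℝ := fun p => Matrix.of fun f d => christoffel G f p d y
  let D : Fin n → Fin n → Matrix (Fin n) (Fin n) ℝ := fun c p =>
    Matrix.of fun f d => pd c (christoffel G f p d) y
  let E : Fin n → Fin n → Fin n → Matrix (Fin n) (Fin n) ℝ := fun c a p =>
    Matrix.of fun f d => pd c (pd a (christoffel G f p d)) y
  have hE : ∀ c a p, E c a p = E a c p := fun c a p => by
    ext f d; exact pd_comm (hG.smooth_chr f p d) hG.isOpen hy c a
  have hR : ∀ a b f d, riemUp G a b f d y = (D a b - D b a + (A a * A b - A b * A a)) f d := by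
    intro a b f d
    simp only [riemUp, Matrix.add_apply, Matrix.sub_apply, Matrix.mul_apply,
      Finset.sum_sub_distrib]
    rfl
  have hs := fun f p d => (hG.smooth_chr f p d).differentiableAt hG.isOpen hy
  have hs' := fun i f p d => ((hG.smooth_chr f p d).pd hG.isOpen i).differentiableAt hG.isOpen hy
  have hdR : ∀ c a b f d, pd c (riemUp G a b f d) y = (E c a b - E c b a +
      (D c a * A b + A a * D c b - (D c b * A a + A b * D c a))) f d := by
    intro c a b f d
    unfold riemUp
    rw [pd_add ((hs' _ _ _ _).fun_sub (hs' _ _ _ _)) (DifferentiableAt.fun_sum fun e _ =>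
      ((hs _ _ _).fun_mul (hs _ _ _)).fun_sub ((hs _ _ _).fun_mul (hs _ _ _))),
      pd_sub (hs' _ _ _ _) (hs' _ _ _ _), pd_sum _ fun e _ =>
      ((hs _ _ _).fun_mul (hs _ _ _)).fun_sub ((hs _ _ _).fun_mul (hs _ _ _))]
    simp only [pd_sub ((hs _ _ _).fun_mul (hs _ _ _)) ((hs _ _ _).fun_mul (hs _ _ _)),
      pd_mul (hs _ _ _) (hs _ _ _), Matrix.add_apply, Matrix.sub_apply, Matrix.mul_apply,
      Finset.sum_sub_distrib, Finset.sum_add_distrib]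
    rfl
  have key : ∀ c a b, dRiemUp G c a b f d y = (E c a b - E c b a +
      (D c a * A b + A a * D c b - (D c b * A a + A b * D c a)) +
      (A c * (D a b - D b a + (A a * A b - A b * A a)) -
        (D a b - D b a + (A a * A b - A b * A a)) * A c)) f d := by
    intro c a b
    rw [dRiemUp, hdR, Matrix.add_apply _ (A c * _ - _)]
    congr 1
    rw [Matrix.sub_apply, Matrix.mul_apply, Matrix.mul_apply, ← Finset.sum_sub_distrib]
    exact Finset.sum_congr rfl fun h _ => by rw [hR, hR]; rfl
  rw [key, key, key, ← Matrix.add_apply, ← Matrix.add_apply, hE a c b, hE b c a, hE b a c]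
  have : ∀ X : Matrix (Fin n) (Fin n) ℝ, X = 0 → X f d = 0 := fun X hX => by rw [hX]; rfl
  apply this
  noncomm_ring

/-- Metric compatibility absorbs the correction of the lowered index `e`, so the full derivative
differs from the endomorphism-valued one only by the corrections of the two form indices. -/
theorem IsMetricOn.nabla_riem (hG : IsMetricOn G U) (hy : y ∈ U) (c a b e d : Fin n) :
    nabla G (riemT G) y ![c, a, b, e, d] = ∑ f, G y e f * dRiemUp G c a b f d y -
      ∑ h, christoffel G h c a y * riem G h b e d y -
      ∑ h, christoffel G h c b y * riem G a h e d y := by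
  have h0 := nabla_cons G (riemT G) y c ![a, b, e, d]
  have h1 : pd c (fun z => riemT G z ![a, b, e, d]) y =
      ∑ f, ((∑ h, christoffel G h c e y * G y h f + ∑ h, christoffel G h c f y * G y e h) *
        riemUp G a b f d y + G y e f * pd c (riemUp G a b f d) y) := by
    change pd c (fun z => ∑ f, G z e f * riemUp G a b f d z) y = _
    rw [pd_sum _ fun f _ => ((hG.smooth e f).differentiableAt hG.isOpen hy).fun_mul
      ((hG.smooth_riemUp a b f d).differentiableAt hG.isOpen hy)]
    refine Finset.sum_congr rfl fun f _ => ?_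
    rw [pd_mul ((hG.smooth e f).differentiableAt hG.isOpen hy)
      ((hG.smooth_riemUp a b f d).differentiableAt hG.isOpen hy), hG.pd_metric hy]
  have h2 : act (chr G y c) (riemT G y) ![a, b, e, d] =
      ∑ h, christoffel G h c a y * riem G h b e d y +
      (∑ h, christoffel G h c b y * riem G a h e d y +
      (∑ h, christoffel G h c e y * riem G a b h d y +
      ∑ h, christoffel G h c d y * riem G a b e h y)) := by
    simp [act, Fin.sum_univ_succ, riemT, Function.update_apply]
  have h3 : ∑ h, christoffel G h c e y * riem G a b h d y =
      ∑ f, (∑ h, christoffel G h c e y * G y h f) * riemUp G a b f d y := by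
    simp only [riem, Finset.mul_sum, Finset.sum_mul]
    rw [Finset.sum_comm]
    exact Finset.sum_congr rfl fun f _ => Finset.sum_congr rfl fun h _ => by ring
  have h4 : ∑ h, christoffel G h c d y * riem G a b e h y =
      ∑ f, G y e f * ∑ h, riemUp G a b f h y * christoffel G h c d y := by
    simp only [riem, Finset.mul_sum]
    rw [Finset.sum_comm]
    exact Finset.sum_congr rfl fun f _ => Finset.sum_congr rfl fun h _ => by ring
  have h5 : ∑ f, (∑ h, christoffel G h c f y * G y e h) * riemUp G a b f d y =
      ∑ f, G y e f * ∑ h, christoffel G f c h y * riemUp G a b h d y := by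
    simp only [Finset.mul_sum, Finset.sum_mul]
    rw [Finset.sum_comm]
    exact Finset.sum_congr rfl fun f _ => Finset.sum_congr rfl fun h _ => by ring
  refine h0.trans ?_
  rw [h1, h2, h3, h4]
  simp only [dRiemUp, mul_add, add_mul, Finset.sum_add_distrib, Finset.sum_sub_distrib, mul_sub,
    h5]
  ring

/-- The form-index corrections cancel in pairs by torsion-freeness and skewness, reducing the claim
to the endomorphism-valued identity. -/
theorem IsMetricOn.nabla_riem_bianchi (hG : IsMetricOn G U) (hy : y ∈ U) (a b c e d : Fin n) :
    nabla G (riemT G) y ![c, a, b, e, d] + nabla G (riemT G) y ![a, b, c, e, d] +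
      nabla G (riemT G) y ![b, c, a, e, d] = 0 := by
  rw [hG.nabla_riem hy, hG.nabla_riem hy, hG.nabla_riem hy]
  have h1 : ∑ f, G y e f * dRiemUp G c a b f d y + ∑ f, G y e f * dRiemUp G a b c f d y +
      ∑ f, G y e f * dRiemUp G b c a f d y = 0 := by
    simp only [← Finset.sum_add_distrib, ← mul_add, hG.dRiemUp_bianchi hy]
    simp
  have h2 : ∀ p q r, ∑ h, christoffel G h p q y * riem G h r e d y =
      -∑ h, christoffel G h q p y * riem G r h e d y := by
    intro p q r
    rw [← Finset.sum_neg_distrib]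
    exact Finset.sum_congr rfl fun h _ => by rw [riem_swap_left, hG.chr_symm hy]; ring
  rw [h2 c a b, h2 a b c, h2 b c a]
  linarith

/-- The metric is Einstein on `U`, with `P = lam g`. -/
structure IsEinsteinOn (G : MetricField n) (U : Set (Pt n)) (lam : Pt n → ℝ) : Prop
    extends IsMetricOn G U where
  dim : 3 ≤ n
  smooth_lam : SmoothOn U lam
  schouten_eq : ∀ z ∈ U, ∀ a b, schouten G a b z = lam z * G z a b

variable {lam : Pt n → ℝ}

theorem IsMetricOn.trace_metric (hG : IsMetricOn G U) (hy : y ∈ U) :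
    ∑ a, ∑ b, (G y)⁻¹ a b * G y a b = n := by
  have : ∀ a, ∑ b, (G y)⁻¹ a b * G y a b = 1 := fun a => by
    simp only [hG.symm y hy a, hG.inv_mul hy]; simp
  simp [this]

theorem IsEinsteinOn.ricci_eq (hE : IsEinsteinOn G U lam) (hy : y ∈ U) (a b : Fin n) :
    ricci G a b y = 2 * ((n : ℝ) - 1) * lam y * G y a b := by
  have hn : (3 : ℝ) ≤ n := by exact_mod_cast hE.dim
  have h1 : (n : ℝ) - 1 ≠ 0 := by linarith
  have h2 : (n : ℝ) - 2 ≠ 0 := by linarith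
  have hR : ∀ a b, ricci G a b y =
      (((n : ℝ) - 2) * lam y + scalarCurv G y / (2 * ((n : ℝ) - 1))) * G y a b := by
    intro a b
    have h := hE.schouten_eq y hy a b
    rw [schouten] at h
    field_simp at h ⊢
    linarith
  -- Tracing the Einstein equation gives a linear equation for the scalar curvature, solvable
  -- because $n\ne2$.
  have hS : scalarCurv G y =
      (n : ℝ) * (((n : ℝ) - 2) * lam y + scalarCurv G y / (2 * ((n : ℝ) - 1))) := by
    conv_lhs => rw [scalarCurv]
    simp only [hR]
    have : ∀ a b, (G y)⁻¹ a b * ((((n : ℝ) - 2) * lam y +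
        scalarCurv G y / (2 * ((n : ℝ) - 1))) * G y a b) = (((n : ℝ) - 2) * lam y +
        scalarCurv G y / (2 * ((n : ℝ) - 1))) * ((G y)⁻¹ a b * G y a b) := fun a b => by ring
    simp only [this, ← Finset.mul_sum, hE.trace_metric hy]
    ring
  have hS' : scalarCurv G y = 2 * ((n : ℝ) - 1) * n * lam y := by
    field_simp at hS
    have : ((n : ℝ) - 2) * (scalarCurv G y - 2 * ((n : ℝ) - 1) * n * lam y) = 0 := by linarith
    rcases mul_eq_zero.1 this with h | h
    · exact absurd h h2
    · linarith
  rw [hR, hS']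
  field_simp
  ring

theorem IsEinsteinOn.traceJ_eq (hE : IsEinsteinOn G U lam) (hy : y ∈ U) :
    traceJ G y = n * lam y := by
  simp only [traceJ, hE.schouten_eq y hy, mul_left_comm _ (lam y), ← Finset.mul_sum,
    hE.trace_metric hy]
  ring

theorem IsMetricOn.trace_nabla_riem (hG : IsMetricOn G U) (hy : y ∈ U) (c b d : Fin n) :
    ∑ a, ∑ e, (G y)⁻¹ a e * nabla G (riemT G) y ![c, a, b, e, d] =
      nabla G (fun z (i : Fin 2 → Fin n) => ricci G (i 0) (i 1) z) y ![c, b, d] := by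
  -- The middle slots are exchanged so that the traced pair `a`, `e` comes first, as `trace₂`
  -- requires.
  let T : Tens n 4 := fun z i => riemT G z fun l => i (Equiv.swap 1 2 l)
  have hT : SmoothTens U T := fun i => hG.smooth_riem _ _ _ _
  have h1 := nabla_trace₂ hG hy hT c ![b, d]
  have h2 : ∀ z ∈ U, ∀ i, ricci G (i 0) (i 1) z = trace₂ G T z i := by
    intro z hz i
    simp only [ricci, trace₂, hG.riemUp_eq hz]
    rfl
  have h3 := nabla_congr (G := G) hG.isOpen hy h2 ![c, b, d]
  rw [h3]
  refine Eq.trans ?_ h1.symm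
  refine Finset.sum_congr rfl fun a _ => Finset.sum_congr rfl fun e _ => ?_
  rw [nabla_comp_perm]
  congr 2
  funext l
  fin_cases l <;> rfl

/-- Schur's lemma. With $\mathrm{Ric}=2(n-1)\lambda g$, the three double traces of the second
Bianchi identity are $n\mu$, $-\mu$, $-\mu$ for $\mu=2(n-1)d\lambda$. Their sum is zero, and $n\ne2$
and $n\neq1$. -/
theorem IsEinsteinOn.pd_lam (hE : IsEinsteinOn G U lam) (hy : y ∈ U) (c : Fin n) :
    pd c lam y = 0 := by
  have hn : (3 : ℝ) ≤ n := by exact_mod_cast hE.dim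
  have hG := hE.toIsMetricOn
  let μ : Fin n → ℝ := fun c => 2 * ((n : ℝ) - 1) * pd c lam y
  let B : Fin n → Fin n → Fin n → Fin n → Fin n → ℝ := fun c a b e d =>
    nabla G (riemT G) y ![c, a, b, e, d]
  have hB : ∀ c b d, ∑ a, ∑ e, (G y)⁻¹ a e * B c a b e d = μ c * G y b d := by
    intro c b d
    have h1 : ∀ z ∈ U, ∀ i : Fin 2 → Fin n, ricci G (i 0) (i 1) z =
        2 * ((n : ℝ) - 1) * (lam z * metricT G z i) := fun z hz i => by
      rw [hE.ricci_eq hz]; ring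
    have hm : SmoothTens U (metricT G) := fun i => hG.smooth _ _
    rw [hG.trace_nabla_riem hy, nabla_congr hG.isOpen hy h1,
      nabla_const_mul hG hy _ (T := fun z i => lam z * metricT G z i)
        fun i => hE.smooth_lam.mul (hm i)]
    have h2 := nabla_fun_mul hG hy hE.smooth_lam hm c ![b, d]
    rw [hG.nabla_metric hy] at h2
    have h3 : nabla G (fun z i => lam z * metricT G z i) y ![c, b, d] =
        pd c lam y * G y b d + lam y * 0 := h2
    rw [h3]
    simp only [μ]
    ring
  have hcyc : ∀ c a b e d, B c a b e d + B a b c e d + B b c a e d = 0 := fun c a b e d =>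
    hG.nabla_riem_bianchi hy a b c e d
  -- A sign symmetry of the curvature on the whole open set is inherited by its covariant
  -- derivative.
  have hneg : ∀ (s : Equiv.Perm (Fin 4)), (∀ z ∈ U, ∀ i : Fin 4 → Fin n,
      riemT G z (fun l => i (s l)) = -1 * riemT G z i) → ∀ (p : Fin n) (i : Fin 4 → Fin n),
      nabla G (riemT G) y (Fin.cons p fun l => i (s l)) =
        -1 * nabla G (riemT G) y (Fin.cons p i) := by
    intro s hs p i
    rw [← nabla_comp_perm, ← nabla_const_mul hG hy _ fun i => hG.smooth_riem _ _ _ _]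
    exact nabla_congr hG.isOpen hy hs _
  have hright : ∀ c a b e d, B c a b e d = -B c a b d e := by
    intro c a b e d
    have h := hneg (Equiv.swap 2 3) (fun z hz i => by
      change riem G (i 0) (i 1) (i 3) (i 2) z = -1 * riem G (i 0) (i 1) (i 2) (i 3) z
      rw [hG.riem_swap_right hz]; ring) c ![a, b, d, e]
    have h' : (fun l => (![a, b, d, e] : Fin 4 → Fin n) (Equiv.swap 2 3 l)) = ![a, b, e, d] := by
      funext l; fin_cases l <;> rfl
    rw [h'] at h
    exact h.trans (by ring_nf; rfl)
  have hleft : ∀ c a b e d, B c a b e d = -B c b a e d := by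
    intro c a b e d
    have h := hneg (Equiv.swap 0 1) (fun z hz i => by
      change riem G (i 1) (i 0) (i 2) (i 3) z = -1 * riem G (i 0) (i 1) (i 2) (i 3) z
      rw [riem_swap_left]; ring) c ![b, a, e, d]
    have h' : (fun l => (![b, a, e, d] : Fin 4 → Fin n) (Equiv.swap 0 1 l)) = ![a, b, e, d] := by
      funext l; fin_cases l <;> rfl
    rw [h'] at h
    exact h.trans (by ring_nf; rfl)
  -- contract the differential Bianchi identity twice
  have h1 : ∑ b, ∑ d, (G y)⁻¹ b d * ∑ a, ∑ e, (G y)⁻¹ a e * B c a b e d = n * μ c := by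
    simp only [hB, mul_left_comm _ (μ c), ← Finset.mul_sum, hG.trace_metric hy]
    ring
  have hδ : ∑ b, ∑ d, (G y)⁻¹ b d * (μ b * G y c d) = μ c := by
    have : ∀ b, ∑ d, (G y)⁻¹ b d * (μ b * G y c d) = μ b * if b = c then 1 else 0 := by
      intro b
      simp only [mul_left_comm _ (μ b), ← Finset.mul_sum, hG.symm y hy c, hG.inv_mul hy]
    simp [this]
  have h3 : ∑ b, ∑ d, (G y)⁻¹ b d * ∑ a, ∑ e, (G y)⁻¹ a e * B b c a e d = -μ c := by
    rw [← hδ, ← Finset.sum_neg_distrib]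
    refine Finset.sum_congr rfl fun b _ => ?_
    rw [← Finset.sum_neg_distrib]
    refine Finset.sum_congr rfl fun d _ => ?_
    rw [← hB]
    simp only [hleft b c, mul_neg, Finset.sum_neg_distrib]
  have h2 : ∑ b, ∑ d, (G y)⁻¹ b d * ∑ a, ∑ e, (G y)⁻¹ a e * B a b c e d = -μ c := by
    have : ∑ b, ∑ d, (G y)⁻¹ b d * ∑ a, ∑ e, (G y)⁻¹ a e * B a b c e d =
        ∑ a, ∑ e, (G y)⁻¹ a e * ∑ b, ∑ d, (G y)⁻¹ b d * B a b c e d := by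
      simp only [Finset.mul_sum]
      rw [Finset.sum_congr rfl fun b _ => Finset.sum_comm, Finset.sum_comm]
      refine Finset.sum_congr rfl fun a _ => ?_
      rw [Finset.sum_congr rfl fun b _ => Finset.sum_comm, Finset.sum_comm]
      exact Finset.sum_congr rfl fun e _ => Finset.sum_congr rfl fun b _ =>
        Finset.sum_congr rfl fun d _ => by ring
    rw [this, ← hδ, ← Finset.sum_neg_distrib]
    refine Finset.sum_congr rfl fun a _ => ?_
    rw [← Finset.sum_neg_distrib]
    refine Finset.sum_congr rfl fun e _ => ?_
    rw [← hB, ← mul_neg]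
    simp only [← Finset.sum_neg_distrib, ← mul_neg]
    exact congrArg _ (Finset.sum_congr rfl fun b _ => Finset.sum_congr rfl fun d _ => by
      rw [hright a b c e d])
  have hsum : (n : ℝ) * μ c + -μ c + -μ c = 0 := by
    have h := congrArg₂ (· + ·) (congrArg₂ (· + ·) h1 h2) h3
    simp only [← Finset.sum_add_distrib, ← mul_add, hcyc] at h
    simpa using h.symm
  have : ((n : ℝ) - 2) * (2 * ((n : ℝ) - 1)) * pd c lam y = 0 := by
    simp only [μ] at hsum; linarith
  rcases mul_eq_zero.1 this with h | h
  · exact absurd h (by apply mul_ne_zero <;> [skip; apply mul_ne_zero] <;> linarith)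
  · exact h

end Curvature

/-! ### Skew tensors and double actions -/

section SkewAlgebra

variable {ι : Type*} {k : ℕ}

theorem IsSkew.update_update {V : (Fin k → ι) → ℝ} (hV : IsSkew V) {i j : Fin k} (hij : i ≠ j)
    (a : Fin k → ι) (c d : ι) : V (Function.update (Function.update a i d) j c) =
      -V (Function.update (Function.update a i c) j d) := by
  rw [← hV.swap hij]
  congr 1
  funext l
  by_cases hi : l = i
  · subst hi; simp [Function.update_of_ne hij]
  · by_cases hj : l = j
    · subst hj; simp [Function.update_of_ne hij]
    · simp [Equiv.swap_apply_of_ne_of_ne hi hj, hi, hj]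

theorem IsSkew.cons_cons {V : (Fin (k + 2) → ι) → ℝ} (hV : IsSkew V) (x z : ι)
    (a : Fin k → ι) : V (Fin.cons x (Fin.cons z a)) = -V (Fin.cons z (Fin.cons x a)) := by
  have h : ∀ x z : ι, (Fin.cons x (Fin.cons z a) : Fin (k + 2) → ι) =
      Function.update (Function.update (Fin.cons x (Fin.cons z a)) 0 x) 1 z := by
    intro x z
    simp
  have h2 : (Fin.cons z (Fin.cons x a) : Fin (k + 2) → ι) =
      Function.update (Function.update (Fin.cons x (Fin.cons z a)) 0 z) 1 x := by
    rw [Fin.update_cons_zero, show (1 : Fin (k + 2)) = Fin.succ 0 from rfl, ← Fin.cons_update,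
      Fin.update_cons_zero]
  rw [h x z, h2]
  exact hV.update_update (by simp) _ _ _

/-- The prepended index must pass `i` others to reach the vacated slot. This is the sign count for
the terms of $\delta d$ in which the differentiating index is not the contracted one. -/
theorem IsSkew.removeNth_succ_cons {V : (Fin k → ι) → ℝ} (hV : IsSkew V) (i : Fin k) (x : ι)
    (a : Fin k → ι) : (-1 : ℝ) ^ (i : ℕ) * V (i.succ.removeNth (Fin.cons x a : Fin (k + 1) → ι)) =
      V (Function.update a i x) := by
  cases k with
  | zero => exact i.elim0
  | succ k =>
    rw [← hV.cons_removeNth]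
    congr 2
    funext l
    refine Fin.cases ?_ (fun l => ?_) l
    · simp [Fin.removeNth]
    · simp [Fin.removeNth]

variable [Fintype ι]

/-- The double derivation action of a four-index quantity. -/
def dblAct (W : ι → ι → ι → ι → ℝ) (V : (Fin k → ι) → ℝ) (a : Fin k → ι) : ℝ :=
  ∑ i : Fin k, ∑ c, act (fun b d => W (a i) c b d) V (Function.update a i c)

theorem dblAct_sub (W W' : ι → ι → ι → ι → ℝ) (V : (Fin k → ι) → ℝ) (a : Fin k → ι) :
    dblAct (fun b c d e => W b c d e - W' b c d e) V a = dblAct W V a - dblAct W' V a := by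
  simp only [dblAct, act_sub, Finset.sum_sub_distrib]

theorem sum_symm_mul_skew (g F : ι → ι → ℝ) (hg : ∀ b c, g b c = g c b)
    (hF : ∀ b c, F b c = -F c b) : ∑ b, ∑ c, g b c * F b c = 0 := by
  have h : ∑ b, ∑ c, g b c * F b c = -∑ b, ∑ c, g b c * F b c := by
    conv_lhs => rw [Finset.sum_comm]
    rw [← Finset.sum_neg_distrib]
    refine Finset.sum_congr rfl fun b _ => ?_
    rw [← Finset.sum_neg_distrib]
    exact Finset.sum_congr rfl fun c _ => by rw [hg, hF]; ring
  linarith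

/-- The double action of a curvature of constant-curvature type on skew tensors. -/
theorem dblAct_const_curv [DecidableEq ι] (g h : ι → ι → ℝ)
    (hh : ∀ b c, h b c = h c b)
    (hgh : ∀ b c, ∑ e, h b e * g e c = if b = c then 1 else 0)
    (r : ℝ) {V : (Fin k → ι) → ℝ} (hV : IsSkew V) (a : Fin k → ι) :
    dblAct (fun b c d e => r * (g d b * h c e -
      (if c = d then (1 : ℝ) else 0) * if b = e then 1 else 0)) V a =
      -(r * k * ((Fintype.card ι : ℝ) - k)) * V a := by
  -- With $N$ the cardinality of `ι`, the $k$ diagonal pairs give $r(1-N)$ each and the $k(k-1)$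
  -- others give $r$, in total $-rk(N-k)$.
  have key : ∀ i j : Fin k, ∑ c, ∑ d, (r * (g (Function.update a i c j) (a i) * h c d -
      (if c = Function.update a i c j then (1 : ℝ) else 0) * if a i = d then 1 else 0)) *
        V (Function.update (Function.update a i c) j d) =
      if i = j then r * (1 - (Fintype.card ι : ℝ)) * V a else r * V a := by
    intro i j
    have h2 : ∑ c, ∑ d, (r * (g (Function.update a i c j) (a i) * h c d -
      (if c = Function.update a i c j then (1 : ℝ) else 0) * if a i = d then 1 else 0)) *
        V (Function.update (Function.update a i c) j d) =
      r * (∑ c, ∑ d, g (Function.update a i c j) (a i) * h c d *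
        V (Function.update (Function.update a i c) j d)) -
      r * ∑ c, (if c = Function.update a i c j then (1 : ℝ) else 0) *
        V (Function.update (Function.update a i c) j (a i)) := by
      rw [Finset.mul_sum, Finset.mul_sum, ← Finset.sum_sub_distrib]
      refine Finset.sum_congr rfl fun c _ => ?_
      simp only [mul_sub, sub_mul, Finset.sum_sub_distrib]
      congr 1
      · rw [Finset.mul_sum]
        exact Finset.sum_congr rfl fun d _ => by ring
      · rw [Finset.sum_eq_single (a i)]
        · simp
        · intro d _ hd; simp [Ne.symm hd]
        · simp
    rw [h2]
    by_cases hij : i = j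
    · subst hij
      rw [if_pos rfl]
      simp only [Function.update_self, Function.update_idem, if_true, one_mul,
        Function.update_eq_self]
      rw [Finset.sum_comm]
      have h3 : ∀ d, ∑ c, g c (a i) * h c d * V (Function.update a i d) =
          (if d = a i then 1 else 0) * V (Function.update a i d) := by
        intro d
        rw [← hgh d (a i), Finset.sum_mul]
        exact Finset.sum_congr rfl fun c _ => by rw [hh d c]; ring
      simp only [h3]
      simp
      ring
    · rw [if_neg hij]
      simp only [Function.update_of_ne (Ne.symm hij), mul_assoc]
      -- In distinct slots the metric part contracts the symmetric `h` with two skew indices. The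
      -- identity part exchanges two indices and changes the sign.
      have h3 : ∑ c, ∑ d, g (a j) (a i) *
          (h c d * V (Function.update (Function.update a i c) j d)) = 0 := by
        simp only [← Finset.mul_sum]
        rw [sum_symm_mul_skew h _ hh fun c d => hV.update_update hij a d c, mul_zero]
      rw [h3, Finset.sum_eq_single (a j)]
      · rw [hV.update_update hij]; simp
      · intro c _ hc; simp [hc]
      · simp
  unfold dblAct act
  have h4 : ∀ i : Fin k, ∑ c, ∑ j, ∑ d, (r * (g (Function.update a i c j) (a i) * h c d -
      (if c = Function.update a i c j then (1 : ℝ) else 0) * if a i = d then 1 else 0)) *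
        V (Function.update (Function.update a i c) j d) =
      r * (1 - (Fintype.card ι : ℝ)) * V a + ((k : ℝ) - 1) * (r * V a) := by
    intro i
    rw [Finset.sum_comm]
    simp only [key]
    rw [← Finset.add_sum_erase _ _ (Finset.mem_univ i), if_pos rfl,
      Finset.sum_congr rfl fun j hj => if_neg (Ne.symm (Finset.mem_erase.mp hj).1),
      Finset.sum_const, Finset.card_erase_of_mem (Finset.mem_univ i), Finset.card_univ,
      Fintype.card_fin, nsmul_eq_mul, Nat.cast_sub i.pos]
    simp
  simp only [h4]
  simp
  ring

end SkewAlgebra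

/-! ### Second order operators on forms and the Weitzenböck identity -/

section Forms

variable {n k : ℕ} {U : Set (Pt n)} {y : Pt n} {G : MetricField n} {lam : Pt n → ℝ}

/-- `W_a{}^b{}_c{}^d`. -/
def raise (G : MetricField n) (y : Pt n) (W : Fin n → Fin n → Fin n → Fin n → ℝ)
    (a b c d : Fin n) : ℝ :=
  ∑ b', ∑ d', (G y)⁻¹ b b' * (G y)⁻¹ d d' * W a b' c d'

/-- The Laplacian `∇^a ∇_a` of the Levi-Civita connection. -/
def lap (G : MetricField n) (T : Tens n k) : Tens n k := trace₂ G (nabla G (nabla G T))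

/-- The second covariant derivative `∇_p ∇_q T`. -/
abbrev hess (G : MetricField n) (T : Tens n k) (y : Pt n) (p q : Fin n) (a : Fin k → Fin n) : ℝ :=
  nabla G (nabla G T) y (Fin.cons p (Fin.cons q a))

theorem coD_eq (G : MetricField n) (f : Tens n (k + 1)) (y : Pt n) (a : Fin k → Fin n) :
    coD G f y a = -trace₂ G (nabla G f) y a := rfl

theorem SmoothTens.coD {f : Tens n (k + 1)} (hG : IsMetricOn G U) (hf : SmoothTens U f) :
    SmoothTens U (coD G f) := fun a => ((hf.nabla hG).trace₂ hG a).neg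

theorem isSkew_coD (hG : IsMetricOn G U) (hy : y ∈ U) {f : Tens n (k + 1)} (hf : SmoothTens U f)
    (h : ∀ z ∈ U, IsSkew (f z)) : IsSkew (coD G f y) := by
  intro s a
  have := fun b c => ((isSkew_nabla hG hy hf h b).cons c) s a
  simp only [coD, this, mul_left_comm _ (((Equiv.Perm.sign s : ℤ) : ℝ)), ← Finset.mul_sum]
  ring

theorem nabla_coD (hG : IsMetricOn G U) (hy : y ∈ U) {f : Tens n (k + 1)} (hf : SmoothTens U f)
    (p : Fin n) (a : Fin k → Fin n) : nabla G (coD G f) y (Fin.cons p a) =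
      -∑ b, ∑ c, (G y)⁻¹ b c * hess G f y p b (Fin.cons c a) := by
  rw [nabla_congr (T' := fun z a => -1 * trace₂ G (nabla G f) z a) hG.isOpen hy
    (fun z _ b => by rw [coD_eq]; ring), nabla_const_mul hG hy _ ((hf.nabla hG).trace₂ hG),
    nabla_trace₂ hG hy (hf.nabla hG)]
  ring

theorem hess_update (hG : IsMetricOn G U) (hy : y ∈ U) {f : Tens n (k + 1)}
    (hf : SmoothTens U f) (h : ∀ z ∈ U, IsSkew (f z)) (p q : Fin n) (i : Fin (k + 1)) (c : Fin n)
    (a : Fin (k + 1) → Fin n) : (-1 : ℝ) ^ (i : ℕ) * hess G f y p q (Fin.cons c (i.removeNth a)) =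
      hess G f y p q (Function.update a i c) :=
  (isSkew_nabla_nabla hG hy hf h p q).cons_removeNth i c a

theorem extD_coD (hG : IsMetricOn G U) (hy : y ∈ U) {f : Tens n (k + 1)} (hf : SmoothTens U f)
    (h : ∀ z ∈ U, IsSkew (f z)) (a : Fin (k + 1) → Fin n) : extD G (coD G f) y a =
      -∑ i, ∑ b, ∑ c, (G y)⁻¹ b c * hess G f y (a i) b (Function.update a i c) := by
  simp only [extD, nabla_coD hG hy hf, mul_neg, Finset.sum_neg_distrib, Finset.mul_sum]
  congr 1
  refine Finset.sum_congr rfl fun i _ => Finset.sum_congr rfl fun b _ =>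
    Finset.sum_congr rfl fun c _ => ?_
  rw [← hess_update hG hy hf h]
  ring

theorem nabla_extD (hG : IsMetricOn G U) (hy : y ∈ U) {f : Tens n k} (hf : SmoothTens U f)
    (p : Fin n) (a : Fin (k + 1) → Fin n) : nabla G (extD G f) y (Fin.cons p a) =
      ∑ j : Fin (k + 1), (-1 : ℝ) ^ (j : ℕ) * hess G f y p (a j) (j.removeNth a) := by
  -- Each summand of $df$ is $\nabla f$ with permuted slots, and covariant differentiation commutes
  -- with permuting slots.
  have h1 : ∀ z ∈ U, ∀ a, extD G f z a = ∑ j : Fin (k + 1), (-1 : ℝ) ^ (j : ℕ) *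
      nabla G f z (fun i => a (j.cycleRange.symm i)) := fun z _ a =>
    Finset.sum_congr rfl fun j _ => by rw [cons_removeNth_eq]
  have hs : ∀ j : Fin (k + 1), SmoothTens U
      (fun z (a : Fin (k + 1) → Fin n) => nabla G f z (fun i => a (j.cycleRange.symm i))) :=
    fun j a => hf.nabla hG _
  rw [nabla_congr hG.isOpen hy h1, nabla_sum hG hy (T := fun (j : Fin (k + 1)) z a =>
    (-1 : ℝ) ^ (j : ℕ) * nabla G f z (fun i => a (j.cycleRange.symm i))) Finset.univ
    fun j _ a => contDiffOn_const.mul (hs j a)]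
  refine Finset.sum_congr rfl fun j _ => ?_
  rw [nabla_const_mul hG hy _ (hs j), nabla_comp_perm, ← cons_removeNth_eq]

/-- After contraction, the term of $df$ that differentiates along the contracted index gives the
Laplacian. The others give $\nabla^c\nabla_{a_i}f$ with $c$ in slot $i$. -/
theorem coD_extD (hG : IsMetricOn G U) (hy : y ∈ U) {f : Tens n k} (hf : SmoothTens U f)
    (h : ∀ z ∈ U, IsSkew (f z)) (a : Fin k → Fin n) : coD G (extD G f) y a = -lap G f y a +
      ∑ i, ∑ b, ∑ c, (G y)⁻¹ b c * hess G f y b (a i) (Function.update a i c) := by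
  have h1 : ∀ b c, nabla G (extD G f) y (Fin.cons b (Fin.cons c a)) =
      hess G f y b c a - ∑ i, hess G f y b (a i) (Function.update a i c) := by
    intro b c
    rw [nabla_extD hG hy hf, Fin.sum_univ_succ, sub_eq_add_neg, ← Finset.sum_neg_distrib]
    congr 1
    · simp [Fin.removeNth_zero]
    · refine Finset.sum_congr rfl fun i _ => ?_
      have h3 : (-1 : ℝ) ^ (i : ℕ) * hess G f y b (a i)
          (i.succ.removeNth (Fin.cons c a : Fin (k + 1) → Fin n)) =
          hess G f y b (a i) (Function.update a i c) :=
        (isSkew_nabla_nabla hG hy hf h b (a i)).removeNth_succ_cons i c a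
      rw [← h3]
      simp only [Fin.cons_succ, Fin.val_succ, pow_succ]
      ring
  simp only [coD, h1, mul_sub, Finset.sum_sub_distrib, lap, trace₂, Finset.mul_sum]
  rw [neg_sub', sub_neg_eq_add]
  congr 1
  rw [Finset.sum_congr rfl fun b _ => Finset.sum_comm, Finset.sum_comm]

/-- The Weitzenböck identity for `δd`. -/
theorem coD_extD_eq (hG : IsMetricOn G U) (hy : y ∈ U) {f : Tens n k} (hf : SmoothTens U f)
    (h : ∀ z ∈ U, IsSkew (f z)) (a : Fin k → Fin n) : coD G (extD G f) y a = -lap G f y a -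
      dblAct (raise G y fun a b c d => riem G a b c d y) (f y) a +
      ∑ i, ∑ b, ∑ c, (G y)⁻¹ b c * hess G f y (a i) b (Function.update a i c) := by
  -- Skewness is used once in each index pair, and the two signs cancel.
  have hr : ∀ p c d x, ∑ b, (G y)⁻¹ b c * riemUp G b p d x y =
      raise G y (fun a b c d => riem G a b c d y) p c x d := by
    intro p c d x
    simp only [raise, hG.riemUp_eq hy, Finset.mul_sum]
    refine Finset.sum_congr rfl fun b _ => Finset.sum_congr rfl fun e _ => ?_
    rw [riem_swap_left, hG.riem_swap_right hy, hG.inv_symm hy b c]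
    ring
  have h1 : dblAct (raise G y fun a b c d => riem G a b c d y) (f y) a =
      ∑ i, ∑ b, ∑ c, (G y)⁻¹ b c * act (fun x d => riemUp G b (a i) d x y) (f y)
        (Function.update a i c) := by
    unfold dblAct
    refine Finset.sum_congr rfl fun i _ => ?_
    rw [Finset.sum_comm]
    refine Finset.sum_congr rfl fun c _ => ?_
    simp only [← hr, act, Finset.mul_sum, Finset.sum_mul]
    rw [Finset.sum_congr rfl fun j _ => Finset.sum_comm, Finset.sum_comm]
    refine Finset.sum_congr rfl fun b _ => Finset.sum_congr rfl fun j _ =>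
      Finset.sum_congr rfl fun d _ => by ring
  -- Interchanging the derivatives brings the divergence inside, as in $d\delta f$; the commutators
  -- add up to the double curvature action of `h1`.
  have h2 : ∀ i b c, hess G f y b (a i) (Function.update a i c) =
      hess G f y (a i) b (Function.update a i c) -
        act (fun x d => riemUp G b (a i) d x y) (f y) (Function.update a i c) := fun i b c => by
    have := nabla_nabla_sub hG hy hf b (a i) (Function.update a i c)
    linarith
  rw [coD_extD hG hy hf h, h1]
  simp only [h2, mul_sub, Finset.sum_sub_distrib]
  ring

/-- The Weitzenböck identity. -/
theorem weitzenboeck (hG : IsMetricOn G U) (hy : y ∈ U) {f : Tens n (k + 1)}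
    (hf : SmoothTens U f) (h : ∀ z ∈ U, IsSkew (f z)) (a : Fin (k + 1) → Fin n) :
    extD G (coD G f) y a + coD G (extD G f) y a = -lap G f y a -
      dblAct (raise G y fun a b c d => riem G a b c d y) (f y) a := by
  rw [extD_coD hG hy hf h, coD_extD_eq hG hy hf h]
  ring

/-- For $P=\lambda g$ the Schouten part of the curvature collapses to the constant-curvature tensor
with factor $2\lambda$. -/
theorem IsEinsteinOn.raise_weyl (hE : IsEinsteinOn G U lam) (hy : y ∈ U) (a b c d : Fin n) :
    raise G y (fun a b c d => weyl G a b c d y) a b c d =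
      raise G y (fun a b c d => riem G a b c d y) a b c d -
      2 * lam y * (G y c a * (G y)⁻¹ b d -
        (if b = c then (1 : ℝ) else 0) * if a = d then 1 else 0) := by
  have hG := hE.toIsMetricOn
  have h1 : ∀ b' d', weyl G a b' c d' y = riem G a b' c d' y -
      2 * lam y * (G y c a * G y b' d' - G y b' c * G y d' a) := by
    intro b' d'
    simp only [weyl, hE.schouten_eq y hy]
    rw [hG.symm y hy b' c, hG.symm y hy a c, hG.symm y hy d' b',
      hG.symm y hy d' a]
    ring
  have h2 : ∑ b', ∑ d', (G y)⁻¹ b b' * (G y)⁻¹ d d' * (G y b' c * G y d' a) =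
      (if b = c then (1 : ℝ) else 0) * if a = d then 1 else 0 := by
    have h := congrArg₂ (· * ·) (hG.inv_mul hy b c) (hG.inv_mul hy d a)
    simp only [Finset.sum_mul_sum, eq_comm (a := d)] at h
    rw [← h]
    exact Finset.sum_congr rfl fun b' _ => Finset.sum_congr rfl fun d' _ => by ring
  have h3 : ∑ b', ∑ d', (G y)⁻¹ b b' * (G y)⁻¹ d d' * (G y c a * G y b' d') =
      G y c a * (G y)⁻¹ b d := by
    have h4 : ∀ b', ∑ d', (G y)⁻¹ b b' * (G y)⁻¹ d d' * (G y c a * G y b' d') =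
        G y c a * ((G y)⁻¹ b b' * if d = b' then 1 else 0) := by
      intro b'
      rw [← hG.inv_mul hy, Finset.mul_sum, Finset.mul_sum]
      exact Finset.sum_congr rfl fun d' _ => by rw [hG.symm y hy b' d']; ring
    simp only [h4]
    simp
  rw [← h2, ← h3]
  simp only [raise, h1]
  simp only [mul_sub, Finset.mul_sum, Finset.sum_sub_distrib]
  congr 2 <;> exact Finset.sum_congr rfl fun b' _ => Finset.sum_congr rfl fun d' _ => by ring

/-- The constant-curvature part acts on skew tensors by a scalar (`dblAct_const_curv`). This is the
source of the quadratic dependence on the degree in the zeroth order terms. -/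
theorem IsEinsteinOn.dblAct_weyl (hE : IsEinsteinOn G U lam) (hy : y ∈ U)
    {V : (Fin k → Fin n) → ℝ} (hV : IsSkew V) (a : Fin k → Fin n) :
    dblAct (raise G y fun a b c d => weyl G a b c d y) V a =
      dblAct (raise G y fun a b c d => riem G a b c d y) V a +
      2 * lam y * k * ((n : ℝ) - k) * V a := by
  have hG := hE.toIsMetricOn
  have h : raise G y (fun a b c d => weyl G a b c d y) = fun a b c d =>
      raise G y (fun a b c d => riem G a b c d y) a b c d -
      2 * lam y * (G y c a * (G y)⁻¹ b d -
        (if b = c then (1 : ℝ) else 0) * if a = d then 1 else 0) := by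
    funext a b c d; exact hE.raise_weyl hy a b c d
  rw [h, dblAct_sub, dblAct_const_curv (fun b c => G y b c) (fun b c => (G y)⁻¹ b c)
    (fun b c => hG.inv_symm hy b c)
    (fun b c => hG.inv_mul hy b c) _ hV]
  simp

end Forms

/-! ### The identity $\delta\delta=0$ and its consequence for $\delta f$ -/

section CoclosedForms

variable {n k : ℕ} {U : Set (Pt n)} {y : Pt n} {G : MetricField n} {lam : Pt n → ℝ}

theorem sum_comm_four {ι κ : Type*} [Fintype ι] [Fintype κ] (T : ι → ι → ι → ι → κ → ℝ) :
    ∑ b, ∑ c, ∑ d, ∑ e, ∑ j, T b c d e j = ∑ j, ∑ b, ∑ c, ∑ d, ∑ e, T b c d e j :=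
  (Finset.sum_congr rfl fun _ _ => (Finset.sum_congr rfl fun _ _ =>
    (Finset.sum_congr rfl fun _ _ => Finset.sum_comm).trans Finset.sum_comm).trans
      Finset.sum_comm).trans Finset.sum_comm

theorem sum_comm_pairs {ι : Type*} [Fintype ι] (T : ι → ι → ι → ι → ℝ) :
    ∑ b, ∑ c, ∑ d, ∑ e, T b c d e = ∑ d, ∑ e, ∑ b, ∑ c, T b c d e := by
  rw [Finset.sum_congr rfl fun b _ => Finset.sum_comm, Finset.sum_comm]
  refine Finset.sum_congr rfl fun d _ => ?_
  rw [Finset.sum_congr rfl fun b _ => Finset.sum_comm, Finset.sum_comm]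

/-- Contraction of a cyclic curvature identity with a skew quantity. -/
theorem sum_bianchi_skew {ι : Type*} [Fintype ι] (g : ι → ι → ℝ) (Q F : ι → ι → ι → ℝ)
    (hQ : ∀ b d z, Q b d z + Q d z b + Q z b d = 0) (hF : ∀ e c x, F e c x = F x e c) :
    ∑ b, ∑ d, ∑ z, Q b d z * ∑ c, ∑ e, ∑ x, g b c * g d e * g z x * F e c x = 0 := by
  let P : ι → ι → ι → ℝ := fun b d z => ∑ c, ∑ e, ∑ x, g b c * g d e * g z x * F e c x
  -- The contracted factor is invariant under cyclic shifts, so the three cyclic versions of `Q`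
  -- have equal contractions, while their sum is zero.
  have hP : ∀ b d z, P d z b = P b d z := by
    intro b d z
    simp only [P]
    rw [Finset.sum_congr rfl fun c _ => Finset.sum_comm, Finset.sum_comm]
    refine Finset.sum_congr rfl fun c _ => Finset.sum_congr rfl fun e _ =>
      Finset.sum_congr rfl fun x _ => ?_
    rw [hF e c x]; ring
  have r1 : ∑ b, ∑ d, ∑ z, Q d z b * P b d z = ∑ b, ∑ d, ∑ z, Q b d z * P b d z := by
    rw [Finset.sum_comm, Finset.sum_congr rfl fun c _ => Finset.sum_comm]
    refine Finset.sum_congr rfl fun c _ => Finset.sum_congr rfl fun e _ =>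
      Finset.sum_congr rfl fun x _ => ?_
    rw [← hP]
  have r2 : ∑ b, ∑ d, ∑ z, Q z b d * P b d z = ∑ b, ∑ d, ∑ z, Q b d z * P b d z := by
    rw [Finset.sum_congr rfl fun c _ => Finset.sum_comm, Finset.sum_comm]
    refine Finset.sum_congr rfl fun c _ => Finset.sum_congr rfl fun e _ =>
      Finset.sum_congr rfl fun x _ => ?_
    rw [hP]
  have h0 : ∑ b, ∑ d, ∑ z, (Q b d z + Q d z b + Q z b d) * P b d z = 0 := by
    simp [hQ]
  simp only [add_mul, Finset.sum_add_distrib] at h0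
  rw [r1, r2] at h0
  change ∑ b, ∑ d, ∑ z, Q b d z * P b d z = 0
  linarith

/-- This trace is the Ricci tensor with an index raised, a multiple of the identity for an Einstein
metric. -/
theorem IsEinsteinOn.sum_inv_riemUp (hE : IsEinsteinOn G U lam) (hy : y ∈ U) (b x : Fin n) :
    ∑ d, ∑ e, (G y)⁻¹ d e * riemUp G b d x e y =
      if x = b then 2 * ((n : ℝ) - 1) * lam y else 0 := by
  have hG := hE.toIsMetricOn
  have h1 : ∑ d, ∑ e, (G y)⁻¹ d e * riemUp G b d x e y =
      ∑ z, (G y)⁻¹ x z * ricci G b z y := by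
    simp only [ricci, hG.riemUp_eq hy, Finset.mul_sum]
    rw [Finset.sum_congr rfl fun d _ => Finset.sum_comm, Finset.sum_comm]
    refine Finset.sum_congr rfl fun z _ => Finset.sum_congr rfl fun d _ =>
      Finset.sum_congr rfl fun e _ => ?_
    rw [riem_swap_left, hG.riem_swap_right hy]; ring
  rw [h1]
  simp only [hE.ricci_eq hy, mul_left_comm _ (2 * ((n : ℝ) - 1) * lam y), ← Finset.mul_sum,
    hG.symm y hy b, hG.inv_mul hy]
  simp

/-- `δδ = 0`. -/
theorem IsEinsteinOn.coD_coD (hE : IsEinsteinOn G U lam) (hy : y ∈ U) {f : Tens n (k + 2)}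
    (hf : SmoothTens U f) (h : ∀ z ∈ U, IsSkew (f z)) (a : Fin k → Fin n) :
    coD G (coD G f) y a = 0 := by
  have hG := hE.toIsMetricOn
  let g : Fin n → Fin n → ℝ := fun b c => (G y)⁻¹ b c
  have hg : ∀ b c, g b c = g c b := fun b c => hG.inv_symm hy b c
  let V := f y
  have hV : IsSkew V := h y hy
  let H : Fin n → Fin n → Fin n → Fin n → ℝ := fun b d e c =>
    hess G f y b d (Fin.cons e (Fin.cons c a))
  have hHs : ∀ b d e c, H b d e c = -H b d c e := fun b d e c =>
    (isSkew_nabla_nabla hG hy hf h b d).cons_cons e c a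
  have h1 : coD G (coD G f) y a = ∑ b, ∑ c, ∑ d, ∑ e, g b c * g d e * H b d e c := by
    rw [coD]
    simp only [nabla_coD hG hy hf, mul_neg, Finset.sum_neg_distrib, neg_neg, Finset.mul_sum,
      ← mul_assoc]
    rfl
  -- Relabelling the two contracted pairs exchanges the derivatives at the cost of a sign. Hence
  -- $2\delta\delta f$ is a contracted commutator of derivatives, and only curvature terms remain.
  have h2 : ∑ b, ∑ c, ∑ d, ∑ e, g b c * g d e * H b d e c =
      -∑ b, ∑ c, ∑ d, ∑ e, g b c * g d e * H d b e c := by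
    rw [sum_comm_pairs]
    simp only [← Finset.sum_neg_distrib]
    refine Finset.sum_congr rfl fun b _ => Finset.sum_congr rfl fun c _ =>
      Finset.sum_congr rfl fun d _ => Finset.sum_congr rfl fun e _ => ?_
    rw [hHs]; ring
  have h3 : ∀ b c d e, H b d e c - H d b e c =
      -(∑ x, riemUp G b d x e y * V (Fin.cons x (Fin.cons c a)) +
        (∑ x, riemUp G b d x c y * V (Fin.cons e (Fin.cons x a)) +
        ∑ j, ∑ x, riemUp G b d x (a j) y *
          V (Fin.cons e (Fin.cons c (Function.update a j x))))) := by
    intro b c d e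
    have := nabla_nabla_sub hG hy hf b d (Fin.cons e (Fin.cons c a))
    rw [act_cons, act_cons] at this
    exact this
  -- Curvature acting on a contracted slot yields Ricci, hence the inverse metric traced against two
  -- skew slots; the same holds for `t2`.
  have t1 : ∑ b, ∑ c, ∑ d, ∑ e, g b c * g d e *
      ∑ x, riemUp G b d x e y * V (Fin.cons x (Fin.cons c a)) = 0 := by
    have : ∀ b c, ∑ d, ∑ e, g b c * g d e *
        ∑ x, riemUp G b d x e y * V (Fin.cons x (Fin.cons c a)) =
        2 * ((n : ℝ) - 1) * lam y * (g b c * V (Fin.cons b (Fin.cons c a))) := by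
      intro b c
      have h4 : ∑ d, ∑ e, g b c * g d e *
          ∑ x, riemUp G b d x e y * V (Fin.cons x (Fin.cons c a)) =
          ∑ x, (∑ d, ∑ e, g d e * riemUp G b d x e y) *
            (g b c * V (Fin.cons x (Fin.cons c a))) := by
        simp only [Finset.mul_sum, Finset.sum_mul]
        rw [Finset.sum_congr rfl fun d _ => Finset.sum_comm, Finset.sum_comm]
        exact Finset.sum_congr rfl fun x _ => Finset.sum_congr rfl fun d _ =>
          Finset.sum_congr rfl fun e _ => by ring
      rw [h4]
      simp only [g, hE.sum_inv_riemUp hy]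
      simp
    simp only [this, ← Finset.mul_sum]
    rw [sum_symm_mul_skew g _ hg fun b c => hV.cons_cons b c a, mul_zero]
  have t2 : ∑ b, ∑ c, ∑ d, ∑ e, g b c * g d e *
      ∑ x, riemUp G b d x c y * V (Fin.cons e (Fin.cons x a)) = 0 := by
    have : ∀ d e, ∑ b, ∑ c, g b c * g d e *
        ∑ x, riemUp G b d x c y * V (Fin.cons e (Fin.cons x a)) =
        -(2 * ((n : ℝ) - 1) * lam y) * (g d e * V (Fin.cons e (Fin.cons d a))) := by
      intro d e
      have h4 : ∑ b, ∑ c, g b c * g d e *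
          ∑ x, riemUp G b d x c y * V (Fin.cons e (Fin.cons x a)) =
          ∑ x, (∑ b, ∑ c, g b c * riemUp G d b x c y) *
            (-(g d e * V (Fin.cons e (Fin.cons x a)))) := by
        simp only [Finset.mul_sum, Finset.sum_mul]
        rw [Finset.sum_congr rfl fun d _ => Finset.sum_comm, Finset.sum_comm]
        exact Finset.sum_congr rfl fun x _ => Finset.sum_congr rfl fun b _ =>
          Finset.sum_congr rfl fun c _ => by rw [riemUp_swap G d b]; ring
      rw [h4]
      simp only [g, hE.sum_inv_riemUp hy]
      simp
    rw [sum_comm_pairs]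
    simp only [this, ← Finset.mul_sum]
    rw [sum_symm_mul_skew g (fun d e => V (Fin.cons e (Fin.cons d a))) hg
      fun b c => hV.cons_cons c b a, mul_zero]
  -- Curvature acting on a free slot meets three skew indices, so the first Bianchi identity kills
  -- it.
  have t3 : ∑ b, ∑ c, ∑ d, ∑ e, g b c * g d e * ∑ j, ∑ x, riemUp G b d x (a j) y *
      V (Fin.cons e (Fin.cons c (Function.update a j x))) = 0 := by
    have h6 : ∀ j, ∑ b, ∑ c, ∑ d, ∑ e, g b c * g d e * ∑ x, riemUp G b d x (a j) y *
        V (Fin.cons e (Fin.cons c (Function.update a j x))) = 0 := by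
      intro j
      let F : Fin n → Fin n → Fin n → ℝ := fun e c x =>
        V (Fin.cons e (Fin.cons c (Function.update a j x)))
      have hF1 : ∀ e c x, F e c x = -F c e x := fun e c x => hV.cons_cons e c _
      have hF2 : ∀ e c x, F e c x = -F e x c := by
        intro e c x
        have := ((hV.cons e).update_update (i := 0) (j := j.succ) (Fin.succ_ne_zero j).symm
          (Fin.cons e a) c x)
        simp only [Fin.update_cons_zero, ← Fin.cons_update] at this
        simp only [F]
        linarith
      have hS := sum_bianchi_skew g (fun b d z => riem G b d z (a j) y) F (fun b d z => by
        have := hG.riem_bianchi hy b d (a j) z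
        rw [hG.riem_swap_right hy b d, hG.riem_swap_right hy d z, hG.riem_swap_right hy z b] at this
        linarith) (fun e c x => by rw [hF2, hF1, neg_neg])
      rw [← hS]
      have h7 : ∀ b d x, riemUp G b d x (a j) y = ∑ z, g z x * riem G b d z (a j) y := by
        intro b d x
        rw [hG.riemUp_eq hy]
        exact Finset.sum_congr rfl fun z _ => by rw [← hg]
      simp only [h7, Finset.mul_sum, Finset.sum_mul]
      refine Finset.sum_congr rfl fun b _ => ?_
      rw [sum_comm_four]
      rw [Finset.sum_congr rfl fun z _ => Finset.sum_comm, Finset.sum_comm]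
      refine Finset.sum_congr rfl fun d _ => Finset.sum_congr rfl fun z _ =>
        Finset.sum_congr rfl fun c _ => Finset.sum_congr rfl fun e _ =>
        Finset.sum_congr rfl fun x _ => ?_
      simp only [F]
      ring
    rw [← Finset.sum_const_zero (s := (Finset.univ : Finset (Fin k)))]
    rw [← Finset.sum_congr rfl fun j _ => h6 j, ← sum_comm_four]
    exact Finset.sum_congr rfl fun b _ => Finset.sum_congr rfl fun c _ =>
      Finset.sum_congr rfl fun d _ => Finset.sum_congr rfl fun e _ => by
      rw [Finset.mul_sum]
  have h8 : ∑ b, ∑ c, ∑ d, ∑ e, g b c * g d e * (H b d e c - H d b e c) = 0 := by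
    simp only [h3, mul_neg, mul_add, Finset.sum_neg_distrib, Finset.sum_add_distrib]
    rw [t1, t2, t3]
    simp
  simp only [mul_sub, Finset.sum_sub_distrib] at h8
  rw [h1]
  linarith

/-- The Weitzenböck identity on coclosed skew tensors of the form `δf`. -/
theorem IsEinsteinOn.weitzenboeck_coD (hE : IsEinsteinOn G U lam) (hy : y ∈ U)
    {f : Tens n (k + 1)} (hf : SmoothTens U f) (h : ∀ z ∈ U, IsSkew (f z)) (a : Fin k → Fin n) :
    coD G (extD G (coD G f)) y a = -lap G (coD G f) y a -
      dblAct (raise G y fun a b c d => riem G a b c d y) (coD G f y) a := by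
  have hG := hE.toIsMetricOn
  have hsk : ∀ z ∈ U, IsSkew (coD G f z) := fun z hz => isSkew_coD hG hz hf h
  rw [coD_extD_eq hG hy (hf.coD hG) hsk]
  cases k with
  -- For functions the remaining sum runs over an empty set of slots; in positive degree it is
  -- $-d\delta(\delta f)=0$.
  | zero => simp
  | succ k =>
    have h1 := extD_coD hG hy (hf.coD hG) hsk a
    have h2 : extD G (coD G (coD G f)) y a = 0 := by
      unfold extD
      refine Finset.sum_eq_zero fun j _ => ?_
      rw [nabla_congr (T' := fun _ _ => 0) hG.isOpen hy fun z hz b => hE.coD_coD hz hf h b]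
      simp [nabla]
    linarith

end CoclosedForms

/-! ### Components of tractor forms -/

section TractorAlgebra

variable {n k : ℕ}

/-- The tractor multi-index with all slots of `Z` type. -/
abbrev zT (a : Fin k → Fin n) : Fin k → TIdx n := fun j => iZ (a j)

theorem update_zT (a : Fin k → Fin n) (j : Fin k) (c : Fin n) :
    Function.update (zT a) j (iZ c) = zT (Function.update a j c) := by
  funext l
  by_cases h : l = j
  · subst h; simp
  · simp [h]

theorem cons_zT (c : Fin n) (a : Fin k → Fin n) :
    (Fin.cons (iZ c) (zT a) : Fin (k + 1) → TIdx n) = zT (Fin.cons c a) := by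
  funext l
  refine Fin.cases ?_ (fun l => ?_) l <;> simp

theorem sum_TIdx (u : TIdx n → ℝ) : ∑ B, u B = u iY + (∑ c, u (iZ c) + u iX) := by
  simp [Fintype.sum_sum_type]

theorem act_update {ι : Type*} [Fintype ι] (S : ι → ι → ℝ) (V : (Fin k → ι) → ℝ) (i : Fin k)
    (x : ι) (a : Fin k → ι) : act S V (Function.update a i x) =
      ∑ c, S x c * V (Function.update a i c) + ∑ j ∈ Finset.univ.erase i, ∑ c, S (a j) c *
        V (Function.update (Function.update a i x) j c) := by
  unfold act
  rw [← Finset.add_sum_erase _ _ (Finset.mem_univ i)]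
  congr 1
  · simp
  · exact Finset.sum_congr rfl fun j hj => by
      rw [Function.update_of_ne (Finset.mem_erase.mp hj).1]

/-- `S` only involves the `Z` slots. -/
def IsZ (S : TIdx n → TIdx n → ℝ) : Prop :=
  ∀ A B, (∀ a, A ≠ iZ a) ∨ (∀ a, B ≠ iZ a) → S A B = 0

theorem IsZ.act_zT {S : TIdx n → TIdx n → ℝ} (hS : IsZ S) (V : (Fin k → TIdx n) → ℝ)
    (a : Fin k → Fin n) :
    act S V (zT a) = act (fun b c => S (iZ b) (iZ c)) (fun b => V (zT b)) a := by
  unfold act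
  refine Finset.sum_congr rfl fun j _ => ?_
  rw [sum_TIdx, hS _ iY (Or.inr (by simp)), hS _ iX (Or.inr (by simp))]
  simp only [update_zT]
  ring

theorem IsZ.act_cons_X {S : TIdx n → TIdx n → ℝ} (hS : IsZ S) (V : (Fin (k + 1) → TIdx n) → ℝ)
    (a : Fin k → Fin n) : act S V (Fin.cons iX (zT a)) =
      act (fun b c => S (iZ b) (iZ c)) (fun b => V (Fin.cons iX (zT b))) a := by
  rw [act_cons, hS.act_zT]
  simp [hS iX _ (Or.inl (by simp))]

/-- `W` only involves the `Z` slots. -/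
def IsZ₄ (W : TIdx n → TIdx n → TIdx n → TIdx n → ℝ) : Prop :=
  ∀ A B, IsZ (fun C D => W A B C D) ∧ IsZ (fun C D => W C D A B)

/-- No intermediate index can leave the $Z$ slots, so the tractor action reduces to the tensor
action. With an $X$ in front the same holds, since $X$ is annihilated. -/
theorem IsZ₄.dblAct_zT {W : TIdx n → TIdx n → TIdx n → TIdx n → ℝ} (hW : IsZ₄ W)
    (V : (Fin k → TIdx n) → ℝ) (a : Fin k → Fin n) : dblAct W V (zT a) =
      dblAct (fun b c d e => W (iZ b) (iZ c) (iZ d) (iZ e)) (fun b => V (zT b)) a := by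
  unfold dblAct
  refine Finset.sum_congr rfl fun i _ => ?_
  have h0 : ∀ B, (∀ a, B ≠ iZ a) → ∀ A, act (fun C D => W (iZ (a i)) B C D) V A = 0 := by
    intro B hB A
    have : ∀ C D, W (iZ (a i)) B C D = 0 := fun C D => (hW C D).2 _ _ (Or.inr hB)
    simp [act, this]
  rw [sum_TIdx, h0 iY (by simp), h0 iX (by simp)]
  simp only [update_zT, (hW _ _).1.act_zT]
  ring

theorem IsZ₄.dblAct_cons_X {W : TIdx n → TIdx n → TIdx n → TIdx n → ℝ} (hW : IsZ₄ W)
    (V : (Fin (k + 1) → TIdx n) → ℝ) (a : Fin k → Fin n) : dblAct W V (Fin.cons iX (zT a)) =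
      dblAct (fun b c d e => W (iZ b) (iZ c) (iZ d) (iZ e)) (fun b => V (Fin.cons iX (zT b))) a := by
  unfold dblAct
  have h0 : ∀ A' B, (∀ a, A' ≠ iZ a) ∨ (∀ a, B ≠ iZ a) → ∀ A,
      act (fun C D => W A' B C D) V A = 0 := by
    intro A' B hB A
    have : ∀ C D, W A' B C D = 0 := fun C D => (hW C D).2 _ _ hB
    simp [act, this]
  rw [Fin.sum_univ_succ]
  simp only [Fin.cons_zero, Fin.cons_succ]
  rw [Finset.sum_eq_zero fun B _ => h0 _ B (Or.inl (by simp)) _, zero_add]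
  refine Finset.sum_congr rfl fun i _ => ?_
  rw [sum_TIdx, h0 _ iY (Or.inr (by simp)), h0 _ iX (Or.inr (by simp))]
  simp only [← Fin.cons_update, update_zT, (hW _ _).1.act_cons_X]
  ring

theorem formZ_zT (f : (Fin k → Fin n) → ℝ) (a : Fin k → Fin n) : formZ f (zT a) = f a := by
  unfold formZ
  rw [Finset.sum_eq_single a]
  · simp [projZ]
  · intro b _ hb
    obtain ⟨j, hj⟩ := Function.ne_iff.mp hb
    rw [Finset.prod_eq_zero (Finset.mem_univ j) (by simp [projZ, hj]), zero_mul]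
  · simp

theorem projZ_eq_zero {A : TIdx n} (h : ∀ a, A ≠ iZ a) (b : Fin n) : projZ A b = 0 := by
  rcases A with _ | a | _
  · rfl
  · exact absurd rfl (h a)
  · rfl

theorem formZ_eq_zero (f : (Fin k → Fin n) → ℝ) {A : Fin k → TIdx n} (j : Fin k)
    (h : ∀ a, A j ≠ iZ a) : formZ f A = 0 :=
  Finset.sum_eq_zero fun a _ => by
    rw [Finset.prod_eq_zero (Finset.mem_univ j) (projZ_eq_zero h _), zero_mul]

theorem isSkew_skew (T : (Fin k → TIdx n) → ℝ) : IsSkew (skew T) := by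
  intro t a
  unfold skew
  rw [mul_left_comm]
  refine congrArg _ ?_
  rw [Finset.mul_sum]
  conv_rhs => rw [← Equiv.sum_comp (Equiv.mulLeft t)]
  refine Finset.sum_congr rfl fun s _ => ?_
  simp only [Equiv.coe_mulLeft, Equiv.Perm.coe_mul, Function.comp_apply, Equiv.Perm.sign_mul]
  rcases Int.units_eq_one_or (Equiv.Perm.sign t) with h | h <;> simp [h]

theorem isSkew_formZ {f : (Fin k → Fin n) → ℝ} (hf : IsSkew f) : IsSkew (formZ f) := by
  intro s A
  unfold formZ
  rw [Finset.mul_sum, ← Equiv.sum_comp (Equiv.arrowCongr s.symm (Equiv.refl (Fin n)))]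
  refine Finset.sum_congr rfl fun a _ => ?_
  have h1 : (Equiv.arrowCongr s.symm (Equiv.refl (Fin n))) a = fun i => a (s i) := rfl
  rw [h1, hf s a, Equiv.prod_comp s (fun j => projZ (A j) (a j))]
  ring

/-- Each term of the skew-symmetrization is a product of one $X$ projector and $Z$ projectors; it
suffices that every permutation meets a vanishing factor. -/
theorem formX_eq_zero (ρ : (Fin k → Fin n) → ℝ) {A : Fin (k + 1) → TIdx n}
    (h : ∀ s : Equiv.Perm (Fin (k + 1)), projX (A (s 0)) = 0 ∨
      ∃ j : Fin k, ∀ a, A (s j.succ) ≠ iZ a) :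
    formX ρ A = 0 := by
  unfold formX skew
  rw [Finset.sum_eq_zero, mul_zero]
  intro s _
  rcases h s with h | ⟨j, h⟩
  · simp [h]
  · dsimp only
    rw [formZ_eq_zero ρ (A := Fin.tail fun i => A (s i)) j h]; simp

/-- Only permutations fixing slot $0$ keep $X$ on the $X$ projector. There are $k!$ of them among
$(k+1)!$, and by skewness of `ρ` each contributes the same. -/
theorem formX_cons_X {ρ : (Fin k → Fin n) → ℝ} (hρ : IsSkew ρ) (a : Fin k → Fin n) :
    formX ρ (Fin.cons iX (zT a)) = 1 / ((k : ℝ) + 1) * ρ a := by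
  unfold formX skew
  rw [← Equiv.sum_comp Equiv.Perm.decomposeFin.symm, Fintype.sum_prod_type, Fin.sum_univ_succ]
  have h1 : ∀ (i : Fin k), ∑ s : Equiv.Perm (Fin k),
      ((Equiv.Perm.sign (Equiv.Perm.decomposeFin.symm (i.succ, s)) : ℤ) : ℝ) *
      (projX ((Fin.cons iX (zT a) : Fin (k + 1) → TIdx n)
        (Equiv.Perm.decomposeFin.symm (i.succ, s) 0)) *
        formZ ρ (Fin.tail fun l => (Fin.cons iX (zT a) : Fin (k + 1) → TIdx n)
          (Equiv.Perm.decomposeFin.symm (i.succ, s) l))) = 0 := fun i =>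
    Finset.sum_eq_zero fun s _ => by simp [projX]
  rw [Finset.sum_eq_zero fun i _ => h1 i, add_zero]
  have h2 : ∀ s : Equiv.Perm (Fin k),
      ((Equiv.Perm.sign (Equiv.Perm.decomposeFin.symm ((0 : Fin (k + 1)), s)) : ℤ) : ℝ) *
      (projX ((Fin.cons iX (zT a) : Fin (k + 1) → TIdx n)
        (Equiv.Perm.decomposeFin.symm ((0 : Fin (k + 1)), s) 0)) *
        formZ ρ (Fin.tail fun l => (Fin.cons iX (zT a) : Fin (k + 1) → TIdx n)
          (Equiv.Perm.decomposeFin.symm ((0 : Fin (k + 1)), s) l))) = ρ a := by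
    intro s
    have h3 : (Fin.tail fun l => (Fin.cons iX (zT a) : Fin (k + 1) → TIdx n)
          (Equiv.Perm.decomposeFin.symm ((0 : Fin (k + 1)), s) l)) = zT fun i => a (s i) := by
      funext l
      simp [Fin.tail, Equiv.Perm.decomposeFin_symm_apply_succ]
    rw [h3, formZ_zT, hρ, Equiv.Perm.decomposeFin.symm_sign]
    rcases Int.units_eq_one_or (Equiv.Perm.sign s) with h | h <;> simp [h, projX]
  rw [Finset.sum_congr rfl fun s _ => h2 s, Finset.sum_const, Finset.card_univ,
    Fintype.card_perm, Fintype.card_fin, nsmul_eq_mul, Nat.factorial_succ]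
  push_cast
  field_simp

/-- `V` is a tractor form whose only components are `φ` (in the `Z ⋯ Z` slot) and `ρ` (in the
`X Z ⋯ Z` slot). -/
structure IsXZForm (V : (Fin (k + 1) → TIdx n) → ℝ) (φ : (Fin (k + 1) → Fin n) → ℝ)
    (ρ : (Fin k → Fin n) → ℝ) : Prop where
  skew : IsSkew V
  zT : ∀ a, V (zT a) = φ a
  cons_X : ∀ a, V (Fin.cons iX (WeightedForms.zT a)) = ρ a
  of_Y : ∀ A j, A j = iY → V A = 0

theorem IsXZForm.insertNth_X {V : (Fin (k + 1) → TIdx n) → ℝ} {φ : (Fin (k + 1) → Fin n) → ℝ}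
    {ρ : (Fin k → Fin n) → ℝ} (h : IsXZForm V φ ρ) (j : Fin (k + 1)) (a : Fin k → Fin n) :
    V (j.insertNth iX (WeightedForms.zT a)) = (-1 : ℝ) ^ (j : ℕ) * ρ a := by
  rw [h.skew.insertNth, h.cons_X]

theorem IsXZForm.update_X {V : (Fin (k + 1) → TIdx n) → ℝ} {φ : (Fin (k + 1) → Fin n) → ℝ}
    {ρ : (Fin k → Fin n) → ℝ} (h : IsXZForm V φ ρ) (j : Fin (k + 1)) (a : Fin (k + 1) → Fin n) :
    V (Function.update (WeightedForms.zT a) j iX) = (-1 : ℝ) ^ (j : ℕ) * ρ (j.removeNth a) := by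
  rw [← h.insertNth_X, ← Fin.insertNth_removeNth]
  rfl

theorem IsSkew.eq_zero_of_eq {ι : Type*} {V : (Fin k → ι) → ℝ} (h : IsSkew V) {A : Fin k → ι}
    {i j : Fin k} (hij : i ≠ j) (hA : A i = A j) : V A = 0 := by
  have h1 := h.swap hij A
  have h2 : (fun l => A (Equiv.swap i j l)) = A := by
    funext l
    by_cases hi : l = i
    · subst hi; simp [hA]
    · by_cases hj : l = j
      · subst hj; simp [hA]
      · simp [Equiv.swap_apply_of_ne_of_ne hi hj]
  rw [h2] at h1
  linarith

/-- This describes the image of $M$. The factor $1/(k+1)$ is the normalization of the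
skew-symmetrization in form degree $k+1$. -/
theorem isXZForm_form {f : (Fin (k + 1) → Fin n) → ℝ} {ρ : (Fin k → Fin n) → ℝ} (hf : IsSkew f)
    (hρ : IsSkew ρ) (r : ℝ) : IsXZForm (fun A => r * formZ f A + formX ρ A) (fun a => r * f a)
      (fun a => 1 / ((k : ℝ) + 1) * ρ a) where
  skew := by
    intro s A
    dsimp only
    have h : IsSkew (formX ρ) := isSkew_skew _
    rw [isSkew_formZ hf s A, h s A]
    ring
  zT a := by rw [formZ_zT, formX_eq_zero ρ fun s => Or.inl rfl, add_zero]
  cons_X a := by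
    rw [formZ_eq_zero f 0 (by simp), formX_cons_X hρ, mul_zero, zero_add]
  of_Y A j hA := by
    rw [formZ_eq_zero f j (by simp [hA]), formX_eq_zero ρ fun s => ?_, mul_zero, zero_add]
    obtain ⟨i, hi⟩ := s.surjective j
    subst hi
    refine Fin.cases (fun hA => Or.inl ?_) (fun i hA => Or.inr ⟨i, ?_⟩) i hA
    · rw [hA]; rfl
    · simp [hA]

end TractorAlgebra

/-! ### The tractor connection and Laplacian on forms with only Z and X components -/

section TractorCalculus

variable {n k : ℕ} {U : Set (Pt n)} {y : Pt n} {G : MetricField n} {lam : Pt n → ℝ}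

theorem tnabla_eq (G : MetricField n) (p : Fin n) (V : TField n k) (y : Pt n)
    (A : Fin k → TIdx n) :
    tnabla G p V y A = pd p (fun z => V z A) y - act (conn G y p) (V y) A := rfl

/-- Skewness of a tractor field on `U` is preserved by the tractor connection. -/
theorem isSkew_tnabla (hU : IsOpen U) (hy : y ∈ U) {V : TField n k}
    (hV : ∀ A, SmoothOn U fun z => V z A) (h : ∀ z ∈ U, IsSkew (V z)) (p : Fin n) :
    IsSkew (tnabla G p V y) := by
  intro s A
  rw [tnabla_eq, tnabla_eq, ← act_comp_perm, pd_congr hU hy fun z hz => h z hz s A,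
    pd_const_mul ((hV A).differentiableAt hU hy)]
  have : (fun b : Fin k → TIdx n => V y fun i => b (s i)) =
      fun b => ((Equiv.Perm.sign s : ℤ) : ℝ) * V y b := funext fun b => h y hy s b
  rw [this, act_fun_mul]
  ring

/-- For $P=\lambda g$ the metric and Schouten terms of the connection merge: the $Z$ slot sees the
$X$ and $Y$ slots only through $\tau+\lambda\alpha$. -/
theorem IsEinsteinOn.sum_conn_Z (hE : IsEinsteinOn G U lam) (hy : y ∈ U) (p b : Fin n)
    (u : TIdx n → ℝ) : ∑ B, conn G y p (iZ b) B * u B =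
      ∑ c, chr G y p b c * u (iZ c) - G y p b * (u iX + lam y * u iY) := by
  rw [sum_TIdx]
  simp only [conn, hE.schouten_eq y hy]
  ring

theorem IsEinsteinOn.sum_conn_X (hE : IsEinsteinOn G U lam) (hy : y ∈ U) (p : Fin n)
    (u : TIdx n → ℝ) : ∑ B, conn G y p iX B * u B = lam y * u (iZ p) := by
  rw [sum_TIdx]
  simp only [conn, hE.schouten_eq y hy, mul_assoc, ← Finset.mul_sum, hE.mul_inv hy]
  simp

theorem sum_conn_Y (G : MetricField n) (y : Pt n) (p : Fin n) (u : TIdx n → ℝ) :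
    ∑ B, conn G y p iY B * u B = u (iZ p) := by
  rw [sum_TIdx]
  simp [conn]

theorem IsEinsteinOn.act_conn_zT (hE : IsEinsteinOn G U lam) (hy : y ∈ U) (p : Fin n)
    (V : (Fin k → TIdx n) → ℝ) (a : Fin k → Fin n) : act (conn G y p) V (zT a) =
      act (chr G y p) (fun b => V (zT b)) a - ∑ j, G y p (a j) *
        (V (Function.update (zT a) j iX) + lam y * V (Function.update (zT a) j iY)) := by
  unfold act
  rw [← Finset.sum_sub_distrib]
  refine Finset.sum_congr rfl fun j _ => ?_
  rw [hE.sum_conn_Z hy p (a j) fun B => V (Function.update (zT a) j B)]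
  simp only [update_zT]

theorem IsEinsteinOn.tnabla_zT (hE : IsEinsteinOn G U lam) (hy : y ∈ U) (p : Fin n)
    (V : TField n k) (a : Fin k → Fin n) : tnabla G p V y (zT a) =
      nabla G (fun z b => V z (zT b)) y (Fin.cons p a) + ∑ j, G y p (a j) *
        (V y (Function.update (zT a) j iX) + lam y * V y (Function.update (zT a) j iY)) := by
  rw [tnabla_eq, hE.act_conn_zT hy, nabla_cons]
  ring

theorem IsEinsteinOn.tnabla_cons (hE : IsEinsteinOn G U lam) (hy : y ∈ U) (p : Fin n)
    (V : TField n (k + 1)) (x : TIdx n) (a : Fin k → Fin n) :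
    tnabla G p V y (Fin.cons x (zT a)) =
      nabla G (fun z b => V z (Fin.cons x (zT b))) y (Fin.cons p a) -
      ∑ B, conn G y p x B * V y (Fin.cons B (zT a)) + ∑ j, G y p (a j) *
        (V y (Fin.cons x (Function.update (zT a) j iX)) +
          lam y * V y (Fin.cons x (Function.update (zT a) j iY))) := by
  rw [tnabla_eq, act_cons, hE.act_conn_zT hy, nabla_cons]
  ring

variable {V : TField n (k + 1)} {φ : Tens n (k + 1)} {ρ : Tens n k}

theorem IsXZForm.isSkew_zT {V : (Fin (k + 1) → TIdx n) → ℝ} {φ : (Fin (k + 1) → Fin n) → ℝ}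
    {ρ : (Fin k → Fin n) → ℝ} (h : IsXZForm V φ ρ) : IsSkew φ := fun s b => by
  rw [← h.zT b]
  exact (h.zT _).symm.trans (h.skew s (WeightedForms.zT b))

theorem IsEinsteinOn.tnabla_zT_of_isXZForm (hE : IsEinsteinOn G U lam) (hy : y ∈ U)
    (hV : ∀ z ∈ U, IsXZForm (V z) (φ z) (ρ z)) (q : Fin n) (a : Fin (k + 1) → Fin n) :
    tnabla G q V y (zT a) = nabla G φ y (Fin.cons q a) +
      ∑ j : Fin (k + 1), (-1 : ℝ) ^ (j : ℕ) * (G y q (a j) * ρ y (j.removeNth a)) := by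
  rw [hE.tnabla_zT hy, nabla_congr hE.isOpen hy fun z hz b => (hV z hz).zT b]
  congr 1
  refine Finset.sum_congr rfl fun j _ => ?_
  rw [(hV y hy).update_X, (hV y hy).of_Y _ j (by simp)]
  ring

theorem IsEinsteinOn.tnabla_X_of_isXZForm (hE : IsEinsteinOn G U lam) (hy : y ∈ U)
    (hV : ∀ z ∈ U, IsXZForm (V z) (φ z) (ρ z)) (q : Fin n) (a : Fin k → Fin n) :
    tnabla G q V y (Fin.cons iX (zT a)) =
      nabla G ρ y (Fin.cons q a) - lam y * φ y (Fin.cons q a) := by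
  rw [hE.tnabla_cons hy, nabla_congr hE.isOpen hy fun z hz b => (hV z hz).cons_X b,
    hE.sum_conn_X hy q fun B => V y (Fin.cons B (zT a)), cons_zT, (hV y hy).zT,
    Finset.sum_eq_zero, add_zero]
  intro j _
  have h1 : V y (Fin.cons iX (Function.update (zT a) j iY)) = 0 :=
    (hV y hy).of_Y _ j.succ (by simp)
  have h2 : V y (Fin.cons iX (Function.update (zT a) j iX)) = 0 :=
    (hV y hy).skew.eq_zero_of_eq (i := 0) (j := j.succ) (Fin.succ_ne_zero j).symm (by simp)
  rw [h1, h2]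
  simp

/-- Differentiation creates a $Y$ component out of the $Z$ components. It vanishes for the form
itself but feeds back into the $Z$ slots at second order. -/
theorem IsEinsteinOn.tnabla_Y_of_isXZForm (hE : IsEinsteinOn G U lam) (hy : y ∈ U)
    (hV : ∀ z ∈ U, IsXZForm (V z) (φ z) (ρ z)) (q : Fin n) (a : Fin k → Fin n) :
    tnabla G q V y (Fin.cons iY (zT a)) = -φ y (Fin.cons q a) := by
  rw [hE.tnabla_cons hy, nabla_congr (T' := fun _ _ => 0) hE.isOpen hy
    fun z hz b => (hV z hz).of_Y _ 0 (by simp),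
    sum_conn_Y G y q fun B => V y (Fin.cons B (zT a)), cons_zT, (hV y hy).zT, Finset.sum_eq_zero]
  · simp [nabla]
  · intro j _
    rw [(hV y hy).of_Y _ 0 (by simp), (hV y hy).of_Y _ 0 (by simp)]
    simp

/-- The $XYZ\cdots Z$ component arises in the same way from `ρ`, and is needed for the second
derivative in the $X$ slot. -/
theorem IsEinsteinOn.tnabla_XY_of_isXZForm (hE : IsEinsteinOn G U lam) (hy : y ∈ U)
    (hV : ∀ z ∈ U, IsXZForm (V z) (φ z) (ρ z)) (q : Fin n) (a : Fin k → Fin n) (i : Fin k) :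
    tnabla G q V y (Fin.cons iX (Function.update (zT a) i iY)) =
      -ρ y (Function.update a i q) := by
  have hY := fun A j h => (hV y hy).of_Y A j h
  have h0 : pd q (fun z => V z (Fin.cons iX (Function.update (zT a) i iY))) y = 0 := by
    rw [pd_congr (v := fun _ => 0) hE.isOpen hy fun z hz => (hV z hz).of_Y _ i.succ (by simp)]
    simp
  rw [tnabla_eq, h0, act_cons, act_update, Finset.sum_eq_zero fun B _ => ?_,
    sum_conn_Y G y q fun B => V y (Fin.cons iX (Function.update (zT a) i B)), update_zT,
    (hV y hy).cons_X, Finset.sum_eq_zero fun j hj => ?_]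
  · ring
  · refine Finset.sum_eq_zero fun B _ => ?_
    rw [hY _ i.succ, mul_zero]
    rw [Fin.cons_succ, Function.update_of_ne (Finset.mem_erase.mp hj).1.symm]
    simp
  · rw [hY _ i.succ (by simp), mul_zero]

theorem tlap_eq (G : MetricField n) (V : TField n k) (y : Pt n) (A : Fin k → TIdx n) :
    tlap G V y A = ∑ p, ∑ q, (G y)⁻¹ p q * (tnabla G p (tnabla G q V) y A -
      ∑ r, christoffel G r p q y * tnabla G r V y A) := rfl

theorem sum_inv_metric (hG : IsMetricOn G U) (hy : y ∈ U) (u : Fin n → ℝ) (x : Fin n) :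
    ∑ p, ∑ q, (G y)⁻¹ p q * (G y q x * u p) = u x := by
  simp only [← mul_assoc, ← Finset.sum_mul, hG.inv_mul hy]
  simp

theorem sum_inv_metric' (hG : IsMetricOn G U) (hy : y ∈ U) (u : Fin n → ℝ) (x : Fin n) :
    ∑ p, ∑ q, (G y)⁻¹ p q * (G y p x * u q) = u x := by
  rw [Finset.sum_comm, ← sum_inv_metric hG hy u x]
  exact Finset.sum_congr rfl fun p _ => Finset.sum_congr rfl fun q _ => by
    rw [hG.inv_symm hy]

/-- The `Z ⋯ Z` component of the tractor Laplacian. -/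
theorem IsEinsteinOn.tlap_zT (hE : IsEinsteinOn G U lam) (hy : y ∈ U)
    (hVs : ∀ A, SmoothOn U fun z => V z A)
    (hφ : SmoothTens U φ) (hρ : SmoothTens U ρ)
    (hV : ∀ z ∈ U, IsXZForm (V z) (φ z) (ρ z)) (a : Fin (k + 1) → Fin n) :
    tlap G V y (zT a) = lap G φ y a + 2 * extD G ρ y a -
      2 * lam y * ((k : ℝ) + 1) * φ y a := by
  have hG := hE.toIsMetricOn
  -- The $Z$ components of the first derivative form an ordinary tensor with the derivative index as
  -- a slot; its covariant derivative absorbs the Christoffel term of the Laplacian.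
  let Φ : Tens n (k + 2) := fun z b => tnabla G (b 0) V z (zT (Fin.tail b))
  have hΦ : ∀ p q, tnabla G p (tnabla G q V) y (zT a) -
      ∑ r, christoffel G r p q y * tnabla G r V y (zT a) =
      nabla G Φ y (Fin.cons p (Fin.cons q a)) + ∑ j, G y p (a j) *
        (tnabla G q V y (Function.update (zT a) j iX) +
          lam y * tnabla G q V y (Function.update (zT a) j iY)) := by
    intro p q
    rw [hE.tnabla_zT hy, nabla_cons, nabla_cons, act_cons]
    simp only [Φ, Fin.cons_zero, Fin.tail_cons]
    ring
  have hΦ2 : ∀ p q, nabla G Φ y (Fin.cons p (Fin.cons q a)) = hess G φ y p q a +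
      ∑ j : Fin (k + 1), (-1 : ℝ) ^ (j : ℕ) *
        (G y q (a j) * nabla G ρ y (Fin.cons p (j.removeNth a))) := by
    intro p q
    let T : Fin (k + 1) → Tens n (k + 2) := fun j z b =>
      G z (b 0) (b j.succ) * ρ z (j.removeNth (Fin.tail b))
    have hT : ∀ j, SmoothTens U (T j) := fun j b => (hG.smooth _ _).mul (hρ _)
    have h1 : ∀ z ∈ U, ∀ b, Φ z b = nabla G φ z b + ∑ j : Fin (k + 1), (-1 : ℝ) ^ (j : ℕ) *
        T j z b := by
      intro z hz b
      simp only [Φ]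
      rw [hE.tnabla_zT_of_isXZForm hz hV, Fin.cons_self_tail]
      rfl
    rw [nabla_congr hE.isOpen hy h1, nabla_add hG hy (hφ.nabla hG)
      (fun b => ContDiffOn.sum fun j _ => contDiffOn_const.mul (hT j b)),
      nabla_sum hG hy (T := fun (j : Fin (k + 1)) z b => (-1 : ℝ) ^ (j : ℕ) * T j z b) _
        fun j _ b => contDiffOn_const.mul (hT j b)]
    congr 1
    refine Finset.sum_congr rfl fun j _ => ?_
    rw [nabla_const_mul hG hy _ (hT j), ← nabla_metric_mul hG hy hρ, Fin.insertNth_self_removeNth]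
  have hX : ∀ q j, tnabla G q V y (Function.update (zT a) j iX) =
      (-1 : ℝ) ^ (j : ℕ) * nabla G ρ y (Fin.cons q (j.removeNth a)) -
        lam y * φ y (Function.update a j q) := by
    intro q j
    have hs := isSkew_tnabla (G := G) hE.isOpen hy hVs (fun z hz => (hV z hz).skew) q
    have hz : j.removeNth (zT a) = zT (j.removeNth a) := rfl
    rw [← Fin.insertNth_removeNth, hs.insertNth, hz, hE.tnabla_X_of_isXZForm hy hV,
      ← (hV y hy).isSkew_zT.cons_removeNth j q a]
    ring
  have hY : ∀ q j, tnabla G q V y (Function.update (zT a) j iY) =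
      - φ y (Function.update a j q) := by
    intro q j
    have hs := isSkew_tnabla (G := G) hE.isOpen hy hVs (fun z hz => (hV z hz).skew) q
    have hz : j.removeNth (zT a) = zT (j.removeNth a) := rfl
    rw [← Fin.insertNth_removeNth, hs.insertNth, hz, hE.tnabla_Y_of_isXZForm hy hV,
      ← (hV y hy).isSkew_zT.cons_removeNth j q a]
    ring
  -- One copy of $d\rho$ comes from differentiating the $g\wedge\rho$ part of the first derivative.
  have s1 : ∑ p, ∑ q, (G y)⁻¹ p q * ∑ j : Fin (k + 1), (-1 : ℝ) ^ (j : ℕ) *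
      (G y q (a j) * nabla G ρ y (Fin.cons p (j.removeNth a))) = extD G ρ y a := by
    simp only [Finset.mul_sum]
    rw [Finset.sum_congr rfl fun p _ => Finset.sum_comm, Finset.sum_comm]
    refine Finset.sum_congr rfl fun j _ => ?_
    rw [← sum_inv_metric hG hy (fun p => nabla G ρ y (Fin.cons p (j.removeNth a))),
      Finset.mul_sum]
    refine Finset.sum_congr rfl fun p _ => ?_
    rw [Finset.mul_sum]
    exact Finset.sum_congr rfl fun q _ => by ring
  -- The other copy comes from the $X$ component of the first derivative. The zeroth order term is
  -- half from the $X$ component and half from the $Y$ component.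
  have s2 : ∑ p, ∑ q, (G y)⁻¹ p q * ∑ j : Fin (k + 1), G y p (a j) *
      ((-1 : ℝ) ^ (j : ℕ) * nabla G ρ y (Fin.cons q (j.removeNth a)) -
        lam y * φ y (Function.update a j q) + lam y * -φ y (Function.update a j q)) =
      extD G ρ y a - 2 * lam y * ((k : ℝ) + 1) * φ y a := by
    simp only [Finset.mul_sum]
    rw [Finset.sum_congr rfl fun p _ => Finset.sum_comm, Finset.sum_comm]
    simp only [sum_inv_metric' hG hy (fun q => (-1 : ℝ) ^ _ * nabla G ρ y
      (Fin.cons q (Fin.removeNth _ a)) - lam y * φ y (Function.update a _ q) +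
        lam y * -φ y (Function.update a _ q))]
    simp only [Function.update_eq_self, Finset.sum_add_distrib, Finset.sum_sub_distrib]
    simp only [Finset.sum_const, Finset.card_univ, Fintype.card_fin, nsmul_eq_mul, extD]
    push_cast
    ring
  rw [tlap_eq]
  simp only [hΦ, hΦ2, hX, hY]
  have s0 : ∑ p, ∑ q, (G y)⁻¹ p q * hess G φ y p q a = lap G φ y a := rfl
  simp only [mul_add ((G y)⁻¹ _ _), Finset.sum_add_distrib]
  rw [s0, s1, s2]
  ring

/-- The `X Z ⋯ Z` component of the tractor Laplacian. -/
theorem IsEinsteinOn.tlap_X (hE : IsEinsteinOn G U lam) (hy : y ∈ U)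
    (hVs : ∀ A, SmoothOn U fun z => V z A)
    (hφ : SmoothTens U φ) (hρ : SmoothTens U ρ)
    (hV : ∀ z ∈ U, IsXZForm (V z) (φ z) (ρ z)) (hρs : IsSkew (ρ y)) (a : Fin k → Fin n) :
    tlap G V y (Fin.cons iX (zT a)) = lap G ρ y a + 2 * lam y * coD G φ y a -
      lam y * n * ρ y a := by
  have hG := hE.toIsMetricOn
  let Φ : Tens n (k + 1) := fun z b => tnabla G (b 0) V z (Fin.cons iX (zT (Fin.tail b)))
  have hs := isSkew_tnabla (G := G) hE.isOpen hy hVs (fun z hz => (hV z hz).skew)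
  have hΦ : ∀ p q, tnabla G p (tnabla G q V) y (Fin.cons iX (zT a)) -
      ∑ r, christoffel G r p q y * tnabla G r V y (Fin.cons iX (zT a)) =
      nabla G Φ y (Fin.cons p (Fin.cons q a)) -
        lam y * tnabla G q V y (zT (Fin.cons p a)) + ∑ j, G y p (a j) *
          (lam y * -ρ y (Function.update a j q)) := by
    intro p q
    rw [hE.tnabla_cons hy, nabla_cons, nabla_cons, act_cons,
      hE.sum_conn_X hy p fun B => tnabla G q V y (Fin.cons B (zT a)), cons_zT]
    simp only [Φ, Fin.cons_zero, Fin.tail_cons]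
    have h1 : ∀ j : Fin k, tnabla G q V y (Fin.cons iX (Function.update (zT a) j iX)) = 0 :=
      fun j => (hs q).eq_zero_of_eq (i := 0) (j := j.succ) (Fin.succ_ne_zero j).symm (by simp)
    simp only [h1, hE.tnabla_XY_of_isXZForm hy hV, zero_add]
    ring
  have hΦ2 : ∀ p q, nabla G Φ y (Fin.cons p (Fin.cons q a)) = hess G ρ y p q a -
      lam y * nabla G φ y (Fin.cons p (Fin.cons q a)) := by
    intro p q
    have h1 : ∀ z ∈ U, ∀ b, Φ z b = nabla G ρ z b - lam z * φ z b := by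
      intro z hz b
      simp only [Φ]
      rw [hE.tnabla_X_of_isXZForm hz hV, Fin.cons_self_tail]
    -- Constancy of `lam` removes the term $d\lambda\otimes\varphi$.
    rw [nabla_congr hE.isOpen hy h1, nabla_sub hG hy (T := fun z b => lam z * φ z b)
      (hρ.nabla hG) (fun b => hE.smooth_lam.mul (hφ b)), nabla_fun_mul hG hy hE.smooth_lam hφ,
      hE.pd_lam hy]
    ring
  have s1 : ∑ p, ∑ q, (G y)⁻¹ p q * nabla G φ y (Fin.cons p (Fin.cons q a)) =
      -coD G φ y a := by simp [coD]
  -- Tracing $g\wedge\rho$ gives $n$ from the prepended slot and $-1$ from each of the other $k$.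
  -- The lost $k$ is restored by the $Y$ contribution `s3`, so the final coefficient is $n$.
  have s2 : ∑ p, ∑ q, (G y)⁻¹ p q * tnabla G q V y (zT (Fin.cons p a)) =
      -coD G φ y a + ((n : ℝ) - k) * ρ y a := by
    have h1 : ∀ p q, tnabla G q V y (zT (Fin.cons p a)) = nabla G φ y (Fin.cons q (Fin.cons p a)) +
        (G y q p * ρ y a - ∑ j : Fin k, G y q (a j) * ρ y (Function.update a j p)) := by
      intro p q
      rw [hE.tnabla_zT_of_isXZForm hy hV, Fin.sum_univ_succ, sub_eq_add_neg,
        ← Finset.sum_neg_distrib]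
      congr 2
      · simp [Fin.removeNth_zero]
      · refine Finset.sum_congr rfl fun i _ => ?_
        rw [← hρs.removeNth_succ_cons i p a]
        simp only [Fin.cons_succ, Fin.val_succ, pow_succ]
        ring
    have h2 : ∑ p, ∑ q, (G y)⁻¹ p q * nabla G φ y (Fin.cons q (Fin.cons p a)) =
        -coD G φ y a := by
      rw [← s1, Finset.sum_comm]
      exact Finset.sum_congr rfl fun p _ => Finset.sum_congr rfl fun q _ => by
        rw [hG.inv_symm hy]
    have h3 : ∑ p, ∑ q, (G y)⁻¹ p q * (G y q p * ρ y a) = n * ρ y a := by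
      rw [← hG.trace_metric hy, Finset.sum_mul]
      refine Finset.sum_congr rfl fun p _ => ?_
      rw [Finset.sum_mul]
      exact Finset.sum_congr rfl fun q _ => by rw [hG.symm y hy p q]; ring
    have h4 : ∑ p, ∑ q, (G y)⁻¹ p q * ∑ j : Fin k, G y q (a j) * ρ y (Function.update a j p) =
        k * ρ y a := by
      simp only [Finset.mul_sum]
      rw [Finset.sum_congr rfl fun p _ => Finset.sum_comm, Finset.sum_comm]
      simp only [sum_inv_metric hG hy (fun p => ρ y (Function.update a _ p))]
      simp
    simp only [h1, mul_add ((G y)⁻¹ _ _), mul_sub ((G y)⁻¹ _ _), Finset.sum_add_distrib,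
      Finset.sum_sub_distrib]
    rw [h2, h3, h4]
    ring
  have s3 : ∑ p, ∑ q, (G y)⁻¹ p q * ∑ j, G y p (a j) *
      (lam y * -ρ y (Function.update a j q)) = -(lam y * k * ρ y a) := by
    simp only [Finset.mul_sum]
    rw [Finset.sum_congr rfl fun p _ => Finset.sum_comm, Finset.sum_comm]
    simp only [sum_inv_metric' hG hy (fun q => lam y * -ρ y (Function.update a _ q))]
    simp
    ring
  have s0 : ∑ p, ∑ q, (G y)⁻¹ p q * hess G ρ y p q a = lap G ρ y a := rfl
  have h1 : ∀ p q, (G y)⁻¹ p q * (tnabla G p (tnabla G q V) y (Fin.cons iX (zT a)) -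
      ∑ r, christoffel G r p q y * tnabla G r V y (Fin.cons iX (zT a))) =
      (G y)⁻¹ p q * hess G ρ y p q a -
        lam y * ((G y)⁻¹ p q * nabla G φ y (Fin.cons p (Fin.cons q a))) -
        lam y * ((G y)⁻¹ p q * tnabla G q V y (zT (Fin.cons p a))) +
        (G y)⁻¹ p q * ∑ j, G y p (a j) * (lam y * -ρ y (Function.update a j q)) := by
    intro p q
    rw [hΦ, hΦ2]
    ring
  rw [tlap_eq]
  simp only [h1, Finset.sum_add_distrib, Finset.sum_sub_distrib]
  simp only [← Finset.mul_sum (a := lam y)]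
  rw [s0, s1, s2, s3]
  ring

end TractorCalculus

/-! ### The operator $\square_\sigma$ in the Einstein scale -/

section Box

variable {n k : ℕ} {U : Set (Pt n)} {y : Pt n} {G : MetricField n} {lam : Pt n → ℝ}
  {s : Pt n → ℝ}

/-- An Einstein metric has vanishing Cotton tensor. -/
theorem IsEinsteinOn.skewNablaP_eq_zero (hE : IsEinsteinOn G U lam) (hy : y ∈ U)
    (a b d : Fin n) : skewNablaP G a b d y = 0 := by
  have hG := hE.toIsMetricOn
  have h : ∀ i : Fin 3 → Fin n,
      nabla G (fun z (i : Fin 2 → Fin n) => schouten G (i 0) (i 1) z) y i = 0 := by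
    intro i
    rw [nabla_congr (T' := fun z i => lam z * metricT G z i) hE.isOpen hy
      fun z hz i => hE.schouten_eq z hz _ _, ← Fin.cons_self_tail i,
      nabla_fun_mul hG hy hE.smooth_lam fun i => hG.smooth _ _, hE.pd_lam hy, hG.nabla_metric hy]
    ring
  simp only [skewNablaP, h]
  ring

theorem weyl_swap_left (G : MetricField n) (a b c d : Fin n) (y : Pt n) :
    weyl G a b c d y = -weyl G b a c d y := by
  simp only [weyl]
  rw [riem_swap_left]
  ring

theorem IsEinsteinOn.weyl_swap_right (hE : IsEinsteinOn G U lam) (hy : y ∈ U)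
    (a b c d : Fin n) : weyl G a b c d y = -weyl G a b d c y := by
  simp only [weyl]
  rw [hE.riem_swap_right hy]
  ring

/-- Every other term contains the Cotton tensor, including the one with the gradient of the scale.
-/
theorem IsEinsteinOn.tractorW_eq (hE : IsEinsteinOn G U lam) (hy : y ∈ U) (A B C D : TIdx n) :
    tractorW G s y A B C D =
      ∑ a, ∑ b, ∑ c, ∑ d, projZZ A B a b * projZZ C D c d * weyl G a b c d y := by
  simp [tractorW, hE.skewNablaP_eq_zero hy]

theorem projZZ_eq_zero {A B : TIdx n} (h : (∀ a, A ≠ iZ a) ∨ (∀ a, B ≠ iZ a)) (a b : Fin n) :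
    projZZ A B a b = 0 := by
  rcases h with h | h <;> simp [projZZ, projZ_eq_zero h]

theorem IsEinsteinOn.tractorW_eq_zero (hE : IsEinsteinOn G U lam) (hy : y ∈ U)
    {A B C D : TIdx n} (h : ((∀ a, A ≠ iZ a) ∨ (∀ a, B ≠ iZ a)) ∨
      ((∀ a, C ≠ iZ a) ∨ (∀ a, D ≠ iZ a))) : tractorW G s y A B C D = 0 := by
  rw [hE.tractorW_eq hy]
  rcases h with h | h <;> simp [projZZ_eq_zero h]

theorem sum_projZZ (u : Fin n → Fin n → ℝ) (a b : Fin n) (hu : u a b = -u b a) :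
    ∑ c, ∑ d, projZZ (iZ a) (iZ b) c d * u c d = u a b := by
  have h : ∀ c d, projZZ (iZ a) (iZ b) c d * u c d =
      (1 / 2) * ((if c = a then 1 else 0) * ((if d = b then 1 else 0) * u c d)) -
      (1 / 2) * ((if c = b then 1 else 0) * ((if d = a then 1 else 0) * u c d)) := by
    intro c d
    simp only [projZZ, projZ]
    ring
  simp only [h, Finset.sum_sub_distrib, ← Finset.mul_sum]
  simp
  linarith

theorem IsEinsteinOn.tractorW_Z (hE : IsEinsteinOn G U lam) (hy : y ∈ U) (a b c d : Fin n) :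
    tractorW G s y (iZ a) (iZ b) (iZ c) (iZ d) = weyl G a b c d y := by
  rw [hE.tractorW_eq hy]
  simp only [mul_assoc, ← Finset.mul_sum]
  simp only [sum_projZZ (fun c d => weyl G _ _ c d y) c d (hE.weyl_swap_right hy _ _ c d)]
  exact sum_projZZ (fun a b => weyl G a b c d y) a b (weyl_swap_left G a b c d y)

theorem hInv_eq_zero (G : MetricField n) (y : Pt n) {A : TIdx n} (h : ∀ a, A ≠ iZ a)
    (b : Fin n) : hInv G y A (iZ b) = 0 := by
  rcases A with _ | a | _
  · rfl
  · exact absurd rfl (h a)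
  · rfl

theorem IsEinsteinOn.tractorWUp_eq (hE : IsEinsteinOn G U lam) (hy : y ∈ U) (A B C D : TIdx n) :
    tractorWUp G s y A B C D = ∑ b, ∑ d, hInv G y B (iZ b) * hInv G y D (iZ d) *
      tractorW G s y A (iZ b) C (iZ d) := by
  unfold tractorWUp
  rw [sum_TIdx]
  simp only [hE.tractorW_eq_zero hy (B := iY) (Or.inl (Or.inr (by simp))),
    hE.tractorW_eq_zero hy (B := iX) (Or.inl (Or.inr (by simp))), mul_zero, Finset.sum_const_zero,
    zero_add, add_zero]
  refine Finset.sum_congr rfl fun b _ => ?_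
  rw [sum_TIdx, hE.tractorW_eq_zero hy (D := iY) (Or.inr (Or.inr (by simp))),
    hE.tractorW_eq_zero hy (D := iX) (Or.inr (Or.inr (by simp)))]
  ring

/-- The tractor metric pairs $Z$ slots only with $Z$ slots, so raising indices does not leave them.
-/
theorem IsEinsteinOn.isZ₄_tractorWUp (hE : IsEinsteinOn G U lam) (hy : y ∈ U) :
    IsZ₄ (tractorWUp G s y) := by
  intro A B
  constructor
  · intro C D h
    dsimp only
    rw [hE.tractorWUp_eq hy]
    refine Finset.sum_eq_zero fun b _ => Finset.sum_eq_zero fun d _ => ?_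
    rcases h with h | h
    · rw [hE.tractorW_eq_zero hy (Or.inr (Or.inl h)), mul_zero]
    · rw [hInv_eq_zero G y h]; ring
  · intro C D h
    dsimp only
    rw [hE.tractorWUp_eq hy]
    refine Finset.sum_eq_zero fun b _ => Finset.sum_eq_zero fun d _ => ?_
    rcases h with h | h
    · rw [hE.tractorW_eq_zero hy (Or.inl (Or.inl h)), mul_zero]
    · rw [hInv_eq_zero G y h]; ring

theorem IsEinsteinOn.tractorWUp_Z (hE : IsEinsteinOn G U lam) (hy : y ∈ U) (a b c d : Fin n) :
    tractorWUp G s y (iZ a) (iZ b) (iZ c) (iZ d) =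
      raise G y (fun a b c d => weyl G a b c d y) a b c d := by
  rw [hE.tractorWUp_eq hy]
  simp only [hE.tractorW_Z hy]
  rfl

theorem sharpSharp_eq (W : TIdx n → TIdx n → TIdx n → TIdx n → ℝ) (V : (Fin k → TIdx n) → ℝ)
    (A : Fin k → TIdx n) : sharpSharp W V A = dblAct W V A := rfl

/-- All derivatives of $\sigma=1$ vanish; $D_A\sigma$ keeps $nY_A$ and $-JX_A$, with $J=n\lambda$.
-/
theorem IsEinsteinOn.scaleTractor_eq (hE : IsEinsteinOn G U lam) (hy : y ∈ U)
    (hs : ∀ z ∈ U, s z = 1) (A : TIdx n) :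
    scaleTractor G s y A = projY A - lam y * projX A := by
  have hn : (n : ℝ) ≠ 0 := by
    have := hE.dim
    exact_mod_cast (by omega : n ≠ 0)
  have h1 : ∀ p, ∀ z ∈ U, ∀ B : Fin 0 → TIdx n,
      tnabla G p (fun z (_ : Fin 0 → TIdx n) => s z) z B = 0 := by
    intro p z hz B
    rw [tnabla_eq, pd_congr (v := fun _ => 1) hE.isOpen hz hs]
    simp [act]
  have h2 : ∀ p q, ∀ B : Fin 0 → TIdx n,
      tnabla G p (tnabla G q (fun z (_ : Fin 0 → TIdx n) => s z)) y B = 0 := by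
    intro p q B
    rw [tnabla_eq, pd_congr (v := fun _ => 0) hE.isOpen hy fun z hz => h1 q z hz B]
    simp [act]
  simp only [scaleTractor, tractorD, h1 _ y hy, tlap_eq, h2, hs y hy, hE.traceJ_eq hy]
  simp
  field_simp

theorem contract_projY (G : MetricField n) (V : TField n (k + 1)) (y : Pt n)
    (A : Fin k → TIdx n) : contract G (fun _ => projY) V y A = V y (Fin.cons iX A) := by
  unfold contract
  rw [sum_TIdx]
  simp only [sum_TIdx]
  simp [projY, hInv]

theorem IsEinsteinOn.boxS_eq (hE : IsEinsteinOn G U lam) (hy : y ∈ U)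
    (hs : ∀ z ∈ U, s z = 1) {w : ℝ} (hw : w = 1 - (n : ℝ) / 2) (V : TField n k)
    (A : Fin k → TIdx n) : boxS G s w V y A =
      -(tlap G V y A + w * (n * lam y) * V y A) - dblAct (tractorWUp G s y) (V y) A := by
  have h1 : boxS G s w V y A =
      modD G s w V y (Fin.cons iX A) - lam y * modD G s w V y (Fin.cons iY A) := by
    unfold boxS contract
    rw [sum_TIdx]
    simp only [sum_TIdx, hE.scaleTractor_eq hy hs]
    simp [projY, projX, hInv]
    ring
  -- This is the critical weight at which the $Y$ and $Z$ parts of the $D$-operator drop out, so the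
  -- contribution of the `iY` component vanishes.
  have h2 : (n : ℝ) + 2 * w - 2 = 0 := by rw [hw]; ring
  rw [h1]
  simp only [modD, tractorD, h2, Fin.cons_zero, Fin.tail_cons, projX, hE.traceJ_eq hy,
    sharpSharp_eq]
  ring

end Box

/-! ### Assembling the two operators -/

section Operators

variable {n p : ℕ} {U : Set (Pt n)} {y : Pt n} {G : MetricField n} {lam : Pt n → ℝ}
  {s : Pt n → ℝ} {f : Tens n (p + 1)}

theorem lap_const_mul {k : ℕ} (hG : IsMetricOn G U) (hy : y ∈ U) (r : ℝ) {T : Tens n k}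
    (hT : SmoothTens U T) (a : Fin k → Fin n) :
    lap G (fun z a => r * T z a) y a = r * lap G T y a := by
  have h : ∀ b : Fin (k + 2) → Fin n, nabla G (nabla G fun z a => r * T z a) y b =
      r * nabla G (nabla G T) y b := fun b => by
    rw [nabla_congr hG.isOpen hy fun z hz b => nabla_const_mul hG hz r hT b,
      nabla_const_mul hG hy r (hT.nabla hG)]
  simp only [lap, trace₂, h, mul_left_comm _ r, ← Finset.mul_sum]

theorem coD_const_mul {k : ℕ} (hG : IsMetricOn G U) (hy : y ∈ U) (r : ℝ) {T : Tens n (k + 1)}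
    (hT : SmoothTens U T) (a : Fin k → Fin n) :
    coD G (fun z a => r * T z a) y a = r * coD G T y a := by
  simp only [coD, nabla_const_mul hG hy r hT, mul_left_comm _ r, ← Finset.mul_sum, mul_neg]

theorem extD_const_mul {k : ℕ} (hG : IsMetricOn G U) (hy : y ∈ U) (r : ℝ) {T : Tens n k}
    (hT : SmoothTens U T) (a : Fin (k + 1) → Fin n) :
    extD G (fun z a => r * T z a) y a = r * extD G T y a := by
  simp only [extD, nabla_const_mul hG hy r hT, mul_left_comm _ r, ← Finset.mul_sum]

theorem dblAct_const_mul {ι : Type*} [Fintype ι] {k : ℕ} (W : ι → ι → ι → ι → ℝ) (r : ℝ)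
    (V : (Fin k → ι) → ℝ) (a : Fin k → ι) :
    dblAct W (fun b => r * V b) a = r * dblAct W V a := by
  simp only [dblAct, act_fun_mul, Finset.mul_sum]

theorem opM_smooth (hG : IsMetricOn G U) (hf : SmoothTens U f) (w : ℝ)
    (A : Fin (p + 1) → TIdx n) : SmoothOn U fun z => opM G w f z A := by
  unfold opM
  refine ContDiffOn.add (contDiffOn_const.mul ?_) ?_
  · exact ContDiffOn.sum fun a _ => contDiffOn_const.mul (hf a)
  · refine contDiffOn_const.mul (ContDiffOn.sum fun t _ => contDiffOn_const.mul
      (contDiffOn_const.mul ?_))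
    exact ContDiffOn.sum fun a _ => contDiffOn_const.mul (hf.coD hG a)

theorem IsEinsteinOn.operators_eq (hE : IsEinsteinOn G U lam) (hy : y ∈ U)
    (hs : ∀ z ∈ U, s z = 1) (hf : SmoothTens U f) (hsk : ∀ z ∈ U, IsSkew (f z)) {k : ℝ}
    (hk : k = (p : ℝ) + 1) :
    (∀ a, opL G s 1 f y a =
      (1 / k) * (((n : ℝ) / 2 - k - 1) * extD G (coD G f) y a +
        ((n : ℝ) / 2 - k + 1) * coD G (extD G f) y a +
        2 * ((n : ℝ) / 2 - k - 1) * ((n : ℝ) / 2 - k + 1) * ((n : ℝ) / 2 - k) * lam y * f y a)) ∧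
    (∀ a, opG G s 1 f y a =
      (1 / k) * (coD G (extD G (coD G f)) y a +
        2 * ((n : ℝ) / 2 - k + 1) * ((n : ℝ) / 2 - k) * lam y * coD G f y a)) := by
  have hG := hE.toIsMetricOn
  have hk0 : k ≠ 0 := by rw [hk]; positivity
  -- The coefficient $(n+w-2k)/k$ of $M$ at $w=k+1-\frac n2$.
  let r : ℝ := ((n : ℝ) / 2 - k + 1) / k
  have hr : ((n : ℝ) + ((p : ℝ) + 1 + (1 : ℕ) - (n : ℝ) / 2) - 2 * ((p : ℝ) + 1)) /
      ((p : ℝ) + 1) = r := by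
    simp only [r, hk]
    congr 1
    push_cast
    ring
  let V : TField n (p + 1) := opM G ((p : ℝ) + 1 + (1 : ℕ) - (n : ℝ) / 2) f
  have hδ := hf.coD hG
  have hV : ∀ z ∈ U, IsXZForm (V z) (fun a => r * f z a) (fun a => 1 / k * coD G f z a) := by
    intro z hz
    have h := isXZForm_form (hsk z hz) (isSkew_coD hG hz hf hsk) r
    rw [← hk] at h
    have hVz : V z = fun A => r * formZ (f z) A + formX (coD G f z) A := by
      funext A; simp only [V, opM, hr]
    rwa [hVz]
  have hVs : ∀ A, SmoothOn U fun z => V z A := opM_smooth hG hf _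
  have hφ : SmoothTens U fun z a => r * f z a := fun a => contDiffOn_const.mul (hf a)
  have hρ : SmoothTens U fun z a => 1 / k * coD G f z a := fun a => contDiffOn_const.mul (hδ a)
  have hbox : ∀ A, boxPow G s ((p : ℝ) + 1 + (1 : ℕ) - (n : ℝ) / 2 - ((p : ℝ) + 1)) 1 V y A =
      -(tlap G V y A + (1 - (n : ℝ) / 2) * (n * lam y) * V y A) -
        dblAct (tractorWUp G s y) (V y) A := by
    intro A
    have hw : (p : ℝ) + 1 + (1 : ℕ) - (n : ℝ) / 2 - ((p : ℝ) + 1) - (0 : ℕ) =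
      1 - (n : ℝ) / 2 := by push_cast; ring
    change boxS G s _ V y A = _
    rw [hE.boxS_eq hy hs hw, hw]
  have hW : (fun b c d e => tractorWUp G s y (iZ b) (iZ c) (iZ d) (iZ e)) =
      raise G y fun a b c d => weyl G a b c d y := by
    funext a b c d; exact hE.tractorWUp_Z hy a b c d
  constructor
  · intro a
    have h1 : opL G s 1 f y a = boxPow G s
        ((p : ℝ) + 1 + (1 : ℕ) - (n : ℝ) / 2 - ((p : ℝ) + 1)) 1 V y (zT a) := by
      simp only [opL, opQ, hs y hy, one_pow, inv_one, one_mul, V]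
    have h2 : (fun b => V y (zT b)) = fun b => r * f y b := funext fun b => (hV y hy).zT b
    rw [h1, hbox, hE.tlap_zT hy hVs hφ hρ hV, lap_const_mul hG hy r hf,
      extD_const_mul hG hy _ hδ, (hE.isZ₄_tractorWUp hy).dblAct_zT, hW, h2, (hV y hy).zT,
      dblAct_const_mul, hE.dblAct_weyl hy (hsk y hy)]
    have h3 := weitzenboeck hG hy hf hsk a
    -- Eliminating the Laplacian makes the Riemann action cancel against the one inside the Weyl
    -- action. The scalars combine to $2\lambda(\frac n2-k)(\frac n2-k-1)$ times `r f`.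
    have h4 : lap G f y a = -(extD G (coD G f) y a + coD G (extD G f) y a) -
      dblAct (raise G y fun a b c d => riem G a b c d y) (f y) a := by linarith
    rw [h4]
    have hp : (p : ℝ) = k - 1 := by rw [hk]; ring
    push_cast
    simp only [r, hp]
    field_simp
    ring
  · intro a
    have h1 : opG G s 1 f y a = boxPow G s
        ((p : ℝ) + 1 + (1 : ℕ) - (n : ℝ) / 2 - ((p : ℝ) + 1)) 1 V y (Fin.cons iX (zT a)) := by
      simp only [opG, opQ, hs y hy, one_pow, inv_one, one_mul, contract_projY, V]
    have h2 : (fun b => V y (Fin.cons iX (zT b))) = fun b => 1 / k * coD G f y b :=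
      funext fun b => (hV y hy).cons_X b
    have hsδ := isSkew_coD hG hy hf hsk
    have hsρ : IsSkew fun b => 1 / k * coD G f y b := fun t b => by
      dsimp only; rw [hsδ t b]; ring
    rw [h1, hbox, hE.tlap_X hy hVs hφ hρ hV hsρ, lap_const_mul hG hy _ hδ,
      coD_const_mul hG hy _ hf, (hE.isZ₄_tractorWUp hy).dblAct_cons_X, hW, h2, (hV y hy).cons_X,
      dblAct_const_mul, hE.dblAct_weyl hy hsδ]
    -- The same cancellation in degree $k-1$; the scalars combine to $\frac{2\lambda}{k}(\frac
    -- n2-k+1)(\frac n2-k)\,\delta f$.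
    have h3 := hE.weitzenboeck_coD hy hf hsk a
    have h4 : lap G (coD G f) y a = -coD G (extD G (coD G f)) y a -
      dblAct (raise G y fun a b c d => riem G a b c d y) (coD G f y) a := by linarith
    rw [h4]
    have hp : (p : ℝ) = k - 1 := by rw [hk]; ring
    simp only [r, hp]
    field_simp
    ring

end Operators

/-! ### Metrics and forms on a manifold in a chart -/

theorem coD_eq_add_mul {n k : ℕ} {G : MetricField n} {y : Pt n} {S T R : Tens n (k + 1)} {r : ℝ}
    (h : ∀ b, nabla G T y b = nabla G S y b + r * nabla G R y b) (a : Fin k → Fin n) :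
    coD G T y a = coD G S y a + r * coD G R y a := by
  simp only [coD, h, mul_add, Finset.sum_add_distrib, mul_left_comm _ r, ← Finset.mul_sum]
  ring

section Charts

variable {n : ℕ} {M : Type*} [TopologicalSpace M] [ChartedSpace (EuclideanSpace ℝ (Fin n)) M]
  {e : OpenPartialHomeomorph M (EuclideanSpace ℝ (Fin n))} {y : Pt n}

theorem mfderiv_symm_bijective (he : e ∈ Chart n M) (hy : y ∈ e.target) :
    Function.Bijective (mfderiv (𝓡 n) (𝓡 n) e.symm y) := by
  have h1 : e.MDifferentiable (𝓡 n) (𝓡 n) :=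
    ⟨(contMDiffOn_of_mem_maximalAtlas he).mdifferentiableOn (by simp),
      (contMDiffOn_symm_of_mem_maximalAtlas he).mdifferentiableOn (by simp)⟩
  exact h1.symm.mfderiv_bijective hy

theorem sum_coordVec (v : Fin n → ℝ) : ∑ i, v i • coordVec n e y i =
    mfderiv (𝓡 n) (𝓡 n) e.symm y (WithLp.toLp 2 v : EuclideanSpace ℝ (Fin n)) := by
  have h : (WithLp.toLp 2 v : EuclideanSpace ℝ (Fin n)) =
      ∑ i, v i • (EuclideanSpace.single i (1 : ℝ)) := by
    ext j
    simp [Pi.single_apply]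
  rw [h]
  have := map_sum (mfderiv (𝓡 n) (𝓡 n) e.symm y)
    (fun i => (v i • (EuclideanSpace.single i (1 : ℝ) : EuclideanSpace ℝ (Fin n)) : _))
    Finset.univ
  refine Eq.trans ?_ this.symm
  exact Finset.sum_congr rfl fun i _ =>
    (map_smul (mfderiv (𝓡 n) (𝓡 n) e.symm y) (v i) _).symm

theorem Metric.isMetricOn_comp (g : Metric n M) (he : e ∈ Chart n M) :
    IsMetricOn (g.comp e) e.target where
  isOpen := e.open_target
  smooth a b := g.smooth e he a b
  symm z _ a b := g.symm _ _ _
  det_ne_zero z hz hdet := by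
    -- A null vector of a singular Gram matrix gives a combination of coordinate vectors orthogonal
    -- to every tangent vector, since these vectors span.
    obtain ⟨v, hv, h⟩ := Matrix.exists_vecMul_eq_zero_iff.2 hdet
    have hbij := mfderiv_symm_bijective he hz
    have h0 : ∑ i, v i • coordVec n e z i = 0 := by
      refine g.nondeg _ _ fun u => ?_
      obtain ⟨u', rfl⟩ := hbij.2 u
      let u₁ : EuclideanSpace ℝ (Fin n) := u'
      have hu : mfderiv (𝓡 n) (𝓡 n) e.symm z u' = ∑ j, u₁ j • coordVec n e z j :=
        (sum_coordVec (e := e) (y := z) (fun j => u₁ j)).symm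
      rw [hu]
      simp only [map_sum, map_smul, LinearMap.sum_apply, LinearMap.smul_apply, smul_eq_mul]
      refine Finset.sum_eq_zero fun j _ => ?_
      have hj := congrFun h j
      have hj' : ∑ i, v i * g.val (e.symm z) (coordVec n e z i) (coordVec n e z j) = 0 := hj
      rw [hj', mul_zero]
    rw [sum_coordVec] at h0
    have h1 := hbij.1 (h0.trans (map_zero _).symm)
    exact hv (by funext i; exact congrArg (fun w : EuclideanSpace ℝ (Fin n) => w i) h1)

theorem Form.isSkew_comp {k : ℕ} (f : Form n M k) (y : Pt n) : IsSkew (f.comp e y) := by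
  intro s a
  have h := (f.val (e.symm y)).map_perm (fun j => coordVec n e y (a j)) s
  simp only [Form.comp]
  refine h.trans ?_
  rw [Units.smul_def, zsmul_eq_mul]

/-- The metric determined by an Einstein scale is Einstein in every chart. -/
theorem IsEinsteinScale.isEinsteinOn {c : Set (Metric n M)} {σ : Density c 1}
    (hσ : IsEinsteinScale σ) (hn : 3 ≤ n) {g : Metric n M} (hg : g ∈ c)
    (hgσ : ∀ x, σ.rep g x = 1) (he : e ∈ Chart n M) :
    IsEinsteinOn (g.comp e) e.target fun z => 1 / (n : ℝ) * traceJ (g.comp e) z where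
  toIsMetricOn := g.isMetricOn_comp he
  dim := hn
  smooth_lam := contDiffOn_const.mul (g.isMetricOn_comp he).smooth_traceJ
  schouten_eq z hz a b := by
    have h := (hσ g hg).2 e he z hz
    -- In its own scale $\sigma=1$ has zero Hessian, so the Einstein condition says that $P$ is pure
    -- trace.
    have h1 : ∀ i, nabla (g.comp e) (nabla (g.comp e)
        (fun z (_ : Fin 0 → Fin n) => (1 : ℝ))) z i = 0 := by
      intro i
      have h2 : nabla (g.comp e) (fun z (_ : Fin 0 → Fin n) => (1 : ℝ)) = fun _ _ => 0 := by
        funext z i; simp [nabla]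
      rw [h2]
      simp [nabla]
    simp only [hgσ, h1, zero_add, mul_one] at h
    exact h a b

end Charts

end WeightedForms

end

theorem mainTheorem7 {n : ℕ} (hn : 3 ≤ n)
    {M : Type*} [TopologicalSpace M] [ChartedSpace (EuclideanSpace ℝ (Fin n)) M]
    [IsManifold (𝓡 n) ∞ M]
    -- a conformal structure with an Einstein scale `σ`
    (c : Set (Metric n M)) (hc : IsConformalClass c)
    (σ : Density c 1) (hσ : IsEinsteinScale σ)
    -- `g` is the metric of the class determined by `σ`
    (g : Metric n M) (hg : g ∈ c) (hgσ : ∀ x, σ.rep g x = 1)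
    -- the degree is `k = p + 1`, with `1 ≤ k ≤ n / 2`
    (p : ℕ) (hk : 2 * (p + 1) ≤ n)
    (k w : ℝ) (hk' : k = (p : ℝ) + 1) (hw : w = k + 1 - (n : ℝ) / 2)
    (f : WeightedForm c (p + 1) w)
    (e : OpenPartialHomeomorph M (EuclideanSpace ℝ (Fin n))) (he : e ∈ Chart n M)
    (y : Pt n) (hy : y ∈ e.target) :
    let G := g.comp e
    let s : Pt n → ℝ := fun z => σ.rep g (e.symm z)
    let F := (f.rep g).comp e
    let N : ℝ := (n : ℝ) / 2
    (∀ a, opL G s 1 F y a =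
      (1 / k) * ((N - k - 1) * extD G (coD G F) y a + (N - k + 1) * coD G (extD G F) y a +
        2 / (n : ℝ) * (N - k - 1) * (N - k + 1) * (N - k) * traceJ G y * F y a)) ∧
    (∀ a, opG G s 1 F y a =
      (1 / k) * coD G (fun z b => extD G (coD G F) z b +
        2 / (n : ℝ) * (N - k + 1) * (N - k) * traceJ G z * F z b) y a) := by
  intro G s F N
  have hE := hσ.isEinsteinOn hn hg hgσ he
  have hG := hE.toIsMetricOn
  have hF : SmoothTens e.target F := fun a => (f.rep g).smooth e he a
  obtain ⟨hL, hGop⟩ := hE.operators_eq (s := s) (f := F) hy (fun z _ => hgσ _) hF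
    (fun z _ => (f.rep g).isSkew_comp z) hk'
  refine ⟨fun a => ?_, fun a => ?_⟩
  · rw [hL a]
    ring
  · rw [hGop a]
    congr 1
    have hlam : SmoothTens e.target fun z b => 1 / (n : ℝ) * traceJ G z * F z b := fun b =>
      hE.smooth_lam.mul (hF b)
    have hext : SmoothTens e.target (extD G (coD G F)) := fun b =>
      ContDiffOn.sum fun j _ => contDiffOn_const.mul ((hF.coD hG).nabla hG _)
    -- `traceJ G` is locally constant, so only `F` is differentiated in the last term, and the
    -- coefficient can be taken out of the outer codifferential at `y`.
    have h1 : ∀ b, nabla G (fun z b => extD G (coD G F) z b +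
        2 / (n : ℝ) * (N - k + 1) * (N - k) * traceJ G z * F z b) y b =
        nabla G (extD G (coD G F)) y b + 2 * (N - k + 1) * (N - k) * (1 / (n : ℝ) * traceJ G y) *
          nabla G F y b := by
      intro b
      rw [nabla_congr (T' := fun z b => extD G (coD G F) z b + (2 * (N - k + 1) * (N - k)) *
        (1 / (n : ℝ) * traceJ G z * F z b)) hG.isOpen hy (fun z _ b => by ring),
        nabla_add hG hy hext (fun b => contDiffOn_const.mul (hlam b)),
        nabla_const_mul hG hy _ hlam, ← Fin.cons_self_tail b,
        nabla_fun_mul hG hy hE.smooth_lam hF, hE.pd_lam hy]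
      ring
    rw [coD_eq_add_mul h1]
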